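/- **Setting.** Let $d,m\ge1$, let $X$ be an $\mathbb R^d$-valued random variable on a probability space, $f:\mathbb R^d\times\mathbb R^m\to\mathbb R$ with $f(X,\theta)\in L^1(\mathbb P)$ for all $\theta$, and $F(\theta)=\mathbb E[f(X,\theta)]$. Let $g:\mathbb R^d\times\mathbb R^m\to\mathbb R^m$ be measurable, $b(\theta)=\mathbb E[g(X,\theta)]$, and let $\theta_n=\theta_{n-1}-\gamma_n g(X_n,\theta_{n-1})$, $n\ge1$, where $(X_n)_{n\ge1}$ are i.i.d. copies of $X$ and $\theta_0\in L^2(\mathbb P)$ is independent of $(X_n)_{n\ge1}$. Write $a\vee b=\max(a,b)$, $a\wedge b=\min(a,b)$, $\Sigma_n=\sum_{k=1}^n\gamma_k$, $\nabla F^{-1}(0)=\{\nabla F=0\}$, $\mathcal L_\ell=\{F\le\ell\}$, and $\mathcal A$ for the random set of accumulation points of $(\theta_n)$. Assume: * $\inf F>-\infty$, $F$ is differentiable, $\|\nabla F(\theta')-\nabla F(\theta)\|\le L\|\theta'-\theta\|^\alpha$ with $L>0$, $\alpha\in(0,1]$; $F(\theta)\to\infty$ as $\|\theta\|\to\infty$.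 * For some $C_g>0$, $0<\kappa\le c$ and all $\theta$: $\mathbb E\|g(X,\theta)\|^2\le C_g(F(\theta)-\inf F+1)$, $b(\theta)^\top\nabla F(\theta)\ge\kappa\|\nabla F(\theta)\|^2$, $\|b(\theta)\|\le c\|\nabla F(\theta)\|$. * $F\in C^1$ is Łojasiewicz: each $\theta_\star\in\nabla F^{-1}(0)$ has an open neighborhood $\mathcal V$ and $\beta\in(0,1)$, $\zeta>0$ with $|F(\theta)-F(\theta_\star)|^\beta\le\zeta\|\nabla F(\theta)\|$ on $\mathcal V$. ($F$ is *globally Łojasiewicz* if one can take $\mathcal V=\mathbb R^m$.) * $\gamma_n>0$, $\sum\gamma_n=\infty$, $\sum\gamma_n^{1+\alpha}<\infty$; either $\ln(\gamma_{n-1}/\gamma_n)=o(\gamma_n)$, or $\ln(\gamma_{n-1}/\gamma_n)\sim\gamma_n/\gamma_\star$ for some $\gamma_\star>0$; $\sum_n\gamma_n/\Sigma_n=\infty$; $\gamma_n=O(\Sigma_n^{-\rho})$; $\gamma_n=\Theta(n^{-s})$ with $s\in(0,1]$; $\rho>3\vee\frac2\alpha$, $s\in[\frac\rho{1+\rho},1]$,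 and $\kappa\gamma_\star>\frac12\vee\alpha$ if $s=1$. (If $s=1$, the second alternative with $\gamma_\star$ necessarily holds.) **Claim.** $(\theta_n)$ converges a.s. to a random variable $\theta_\star$ with $\nabla F(\theta_\star)=0$ and $F(\theta_n)\to F(\theta_\star)$ a.s. Below, $n\propto N$ means $n=\lceil aN\rceil$ with a fixed $a>0$ (e.g. $a=1$, $n=N$). **(i)** For every $\delta\in(0,1)$ there is $\ell_\delta>\inf F$ with $\mathbb P(\mathcal A\subset\mathcal L_{\ell_\delta})\ge1-\delta$ such that: * (a) there are $\beta\in(0,1)$, $\zeta>0$ such that every $\theta_\star'\in\nabla F^{-1}(0)\cap\mathcal L_{\ell_\delta}$ has an open neighborhood on which $|F-F(\theta_\star')|^\beta\le\zeta\|\nabla F\|$; * (b) there is $\beta\in(0,1)$ for which the same holds with $\zeta=1$. For any such $(\beta,\zeta)$ (with $\zeta=1$ in case (b)), provided in case (a) that $\kappa\gamma_\star>\zeta^{1/\beta}(\alpha\vee\frac12)$ if $\beta\le\frac12$ and $s=1$, and for every $a>0$, there is $C_\delta>0$ such that for all $\sigma\in[\underline\sigma,1)$ and all $\varepsilon>0$,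 setting $n\propto N$, $$\|\theta_n-\theta_\star\|\le\frac{C_\delta}{1-\sigma}\,\varepsilon\quad\text{with probability at least }1-\delta.$$ Here, with $r=\frac1{2\beta-1}\wedge(\alpha\rho-1)\wedge\frac{\rho-1}2$ when $\beta>\frac12$, $$N=\begin{cases}\big\lceil\varepsilon^{\frac{-1}{1-\sigma}(\frac{2\vee\alpha^{-1}}s\vee\frac2{2s-1}\vee\frac1{(1+\alpha)s-1})}\big\rceil,&\beta\le\frac12,\\ \big\lceil\varepsilon^{\frac{-1}{1-\sigma}(\frac1{r(1-s)}\vee\frac2{2s-1}\vee\frac1{(1+\alpha)s-1})}\big\rceil,&\beta>\frac12,\ s<1,\\ \big\lceil\exp(\varepsilon^{-\frac1{r(1-\sigma)}})\big\rceil,&\beta>\frac12,\ s=1,\end{cases}$$ $$\underline\sigma=\begin{cases}\frac1{2(2s-1)}\vee\frac{\alpha s}{2((1+\alpha)s-1)}\vee\frac{1-((1-\alpha)\vee\frac12)s}{2(\alpha\wedge\frac12)s},&\beta\le\frac12,\\ \frac1{2(2s-1)}\vee\frac{\alpha s}{2((1+\alpha)s-1)}\vee\frac{1+r}{2r},&\beta>\frac12,\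 s<1,\\ \frac{1+r}{2r},&\beta>\frac12,\ s=1.\end{cases}$$ **(ii)** If $F$ is globally Łojasiewicz, there are $\beta\in[\frac\alpha{1+\alpha},1)$, $\zeta>0$ with $(F-\inf F)^\beta\le\zeta\|\nabla F\|$ on $\mathbb R^m$. For any such $(\beta,\zeta)$ with $\beta\in(\frac\alpha{1+\alpha},1)\cup\{\frac12\}$, provided, if $\beta\le\frac12$ and $s=1$, that $\kappa\gamma_\star>\zeta^{2+\lambda\frac{1+\alpha}\alpha}\big(\frac{(1+\alpha)L^{1/\alpha}}\alpha\big)^\lambda\alpha$ with $\lambda=\frac{1-2\beta}{\frac{1+\alpha}\alpha\beta-1}$ if $\beta<\frac12$ and $\lambda=0$ if $\beta=\frac12$, and for every $a>0$, there is $C>0$ such that for all $\delta\in(0,1)$, $\sigma\in[\underline\sigma,1)$ and $\varepsilon>0$, setting $n\propto N$, $$\|\theta_n-\theta_\star\|\le\frac{C}{\delta(1-\sigma)}\,\varepsilon\quad\text{with probability at least }1-\delta.$$ Here, with $r=\frac1{2\beta-1}\wedge(\alpha\rho-1)$ when $\beta>\frac12$, $$N=\begin{cases}\big\lceil\varepsilon^{\frac{-1}{1-\sigma}(\frac1{\alpha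 s}\vee\frac2{2s-1}\vee\frac1{(1+\alpha)s-1})}\big\rceil,&\beta\le\frac12,\\ \big\lceil\varepsilon^{\frac{-1}{1-\sigma}(\frac1{r(1-s)}\vee\frac2{2s-1}\vee\frac1{(1+\alpha)s-1})}\big\rceil,&\beta>\frac12,\ s<1,\\ \big\lceil\exp(\varepsilon^{-\frac1{r(1-\sigma)}})\big\rceil,&\beta>\frac12,\ s=1,\end{cases}$$ $$\underline\sigma=\begin{cases}\frac1{2(2s-1)}\vee\frac{\alpha s}{2((1+\alpha)s-1)},&\beta\le\frac12,\\ \frac1{2(2s-1)}\vee\frac{\alpha s}{2((1+\alpha)s-1)}\vee\frac{1+r}{2r},&\beta>\frac12,\ s<1,\\ \frac{1+r}{2r},&\beta>\frac12,\ s=1.\end{cases}$$ **Cost.** When producing $\theta_0$, drawing an innovation, reading a learning rate, evaluating $g$ and performing a scalar arithmetic operation each have a fixed price, computing $\theta_n$ costs at most $Cn$ for all $n\ge1$, for some constant $C>0$. Moreover, in (i) and (ii), $\underline\sigma<1$ and, for every $\varepsilon\in(0,1]$ and $a>0$, the choice $\sigma=\underline\sigma$ minimizes the cost of computing $\theta_n$,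 $n\propto N$, among all $\sigma\in[\underline\sigma,1)$. -/

import Mathlib

open MeasureTheory ProbabilityTheory Filter Topology Asymptotics Set
open scoped NNReal

noncomputable section

namespace SGD

/-- `ℝ^k` with its Euclidean norm. -/
abbrev Vec (k : ℕ) : Type := EuclideanSpace ℝ (Fin k)

/-! ### Loss landscape, oracle, dynamics -/

/-- The objective `F(θ) = 𝔼[f(X, θ)]`. -/
def objective {Ω : Type*} [MeasurableSpace Ω] (P : Measure Ω) {d m : ℕ}
    (X : Ω → Vec d) (f : Vec d → Vec m → ℝ) (θ : Vec m) : ℝ :=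
  ∫ ω, f (X ω) θ ∂P

/-- The mean oracle `b(θ) = 𝔼[g(X, θ)]`. -/
def meanOracle {Ω : Type*} [MeasurableSpace Ω] (P : Measure Ω) {d m : ℕ}
    (X : Ω → Vec d) (g : Vec d → Vec m → Vec m) (θ : Vec m) : Vec m :=
  ∫ ω, g (X ω) θ ∂P

/-- The set of stationary points `∇F⁻¹(0)`. -/
def stationary {m : ℕ} (F : Vec m → ℝ) : Set (Vec m) := {θ | gradient F θ = 0}

/-- `F` is lower bounded and differentiable with `(L, α)`-Hölder gradient. -/
structure HolderSmooth {m : ℕ} (F : Vec m → ℝ) (L α : ℝ) : Prop where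
  bddBelow : BddBelow (range F)
  differentiable : Differentiable ℝ F
  L_pos : 0 < L
  α_pos : 0 < α
  α_le_one : α ≤ 1
  holder : ∀ θ θ' : Vec m, ‖gradient F θ' - gradient F θ‖ ≤ L * ‖θ' - θ‖ ^ α

/-- Growth of the second moment of the oracle, and the two bias conditions. -/
structure OracleBounds {Ω : Type*} [MeasurableSpace Ω] (P : Measure Ω) {d m : ℕ}
    (X : Ω → Vec d) (F : Vec m → ℝ) (g : Vec d → Vec m → Vec m) (Cg κ c : ℝ) : Prop where
  C_pos : 0 < Cg
  κ_pos : 0 < κ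
  κ_le : κ ≤ c
  memLp : ∀ θ, MemLp (fun ω => g (X ω) θ) 2 P
  second_moment : ∀ θ, ∫ ω, ‖g (X ω) θ‖ ^ 2 ∂P ≤ Cg * ((F θ - ⨅ η, F η) + 1)
  lower : ∀ θ, κ * ‖gradient F θ‖ ^ 2 ≤ inner ℝ (meanOracle P X g θ) (gradient F θ)
  upper : ∀ θ, ‖meanOracle P X g θ‖ ≤ c * ‖gradient F θ‖

/-- `(θ n)` is the stochastic gradient descent driven by the innovations `ξ 1, ξ 2, …` (i.i.d. copies
of `X`; `ξ 0` and `γ 0` play no role), started at a square integrable `θ 0` that is independent of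
the innovations. -/
structure IsSGD {Ω : Type*} [MeasurableSpace Ω] (P : Measure Ω) {d m : ℕ}
    (X : Ω → Vec d) (ξ : ℕ → Ω → Vec d) (g : Vec d → Vec m → Vec m) (γ : ℕ → ℝ)
    (θ : ℕ → Ω → Vec m) : Prop where
  measurable_X : Measurable X
  measurable_innov : ∀ n, 1 ≤ n → Measurable (ξ n)
  measurable_oracle : Measurable (fun p : Vec d × Vec m => g p.1 p.2)
  measurable_init : Measurable (θ 0)
  indep : iIndepFun (fun n => ξ (n + 1)) P
  identDistrib : ∀ n, 1 ≤ n → IdentDistrib (ξ n) X P P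
  memLp_init : MemLp (θ 0) 2 P
  indep_init : IndepFun (θ 0) (fun ω (n : ℕ) => ξ (n + 1) ω) P
  step : ∀ n ω, θ (n + 1) ω = θ n ω - γ (n + 1) • g (ξ (n + 1) ω) (θ n ω)

/-! ### Learning rates (indexed by `n ≥ 1`) -/

/-- `∑_{k=1}^n γ_k`. -/
def partialSum (γ : ℕ → ℝ) (n : ℕ) : ℝ := ∑ k ∈ Finset.Icc 1 n, γ k

/-- Positive rates with `∑ γ_n = ∞` and `∑ γ_n^{1+α} < ∞`. -/
structure RobbinsMonro (γ : ℕ → ℝ) (α : ℝ) : Prop where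
  pos : ∀ n, 1 ≤ n → 0 < γ n
  diverges : Tendsto (partialSum γ) atTop atTop
  summable : Summable (fun n => γ (n + 1) ^ (1 + α))

/-- Finer description of the rates: either `ln(γ_{n-1}/γ_n) = o(γ_n)` or
`ln(γ_{n-1}/γ_n) ∼ γ_n/γ⋆`; `∑ γ_n/(γ_1+⋯+γ_n) = ∞`; `γ_n = O((γ_1+⋯+γ_n)^{-ρ})`, `ρ > 1/α`. -/
structure RateRegularity (γ : ℕ → ℝ) (α ρ γstar : ℝ) : Prop where
  log_ratio :
    ((fun n => Real.log (γ (n - 1) / γ n)) =o[atTop] γ) ∨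
      (0 < γstar ∧ (fun n => Real.log (γ (n - 1) / γ n)) ~[atTop] fun n => γ n / γstar)
  ratio_diverges :
    Tendsto (partialSum fun n => γ n / partialSum γ n) atTop atTop
  ρ_gt : 1 / α < ρ
  decay : γ =O[atTop] fun n => partialSum γ n ^ (-ρ)

/-! ### Łojasiewicz conditions -/

/-- `F` is (locally) Łojasiewicz. -/
def IsLojasiewicz {m : ℕ} (F : Vec m → ℝ) : Prop :=
  ContDiff ℝ 1 F ∧ ∀ θs ∈ stationary F, ∃ V : Set (Vec m), IsOpen V ∧ θs ∈ V ∧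
    ∃ β ∈ Ioo (0 : ℝ) 1, ∃ ζ > (0 : ℝ), ∀ θ ∈ V, |F θ - F θs| ^ β ≤ ζ * ‖gradient F θ‖

/-- `F` is globally Łojasiewicz: the neighborhood is the whole space. -/
def IsGloballyLojasiewicz {m : ℕ} (F : Vec m → ℝ) : Prop :=
  ContDiff ℝ 1 F ∧ ∀ θs ∈ stationary F,
    ∃ β ∈ Ioo (0 : ℝ) 1, ∃ ζ > (0 : ℝ), ∀ θ, |F θ - F θs| ^ β ≤ ζ * ‖gradient F θ‖

/-- `F` satisfies the Łojasiewicz inequality with the same `(β, ζ)` near every stationary point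
in `K`. -/
def LojasiewiczOn {m : ℕ} (F : Vec m → ℝ) (K : Set (Vec m)) (β ζ : ℝ) : Prop :=
  ∀ θs ∈ stationary F ∩ K, ∃ V : Set (Vec m), IsOpen V ∧ θs ∈ V ∧
    ∀ θ ∈ V, |F θ - F θs| ^ β ≤ ζ * ‖gradient F θ‖

/-- `(F - inf F)^β ≤ ζ ‖∇F‖` everywhere. -/
def LojasiewiczGap {m : ℕ} (F : Vec m → ℝ) (β ζ : ℝ) : Prop :=
  ∀ θ, (F θ - ⨅ η, F η) ^ β ≤ ζ * ‖gradient F θ‖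

/-- The sublevel set `{F ≤ ℓ}`. -/
def sublevel {m : ℕ} (F : Vec m → ℝ) (ℓ : ℝ) : Set (Vec m) := {θ | F θ ≤ ℓ}

/-- The set of accumulation points of a sequence. -/
def accPoints {m : ℕ} (u : ℕ → Vec m) : Set (Vec m) := {x | MapClusterPt x atTop u}

/-! ### Exponents, admissible `σ` and iteration counts -/

/-- `r = 1/(2β-1) ∧ (αρ-1) ∧ (ρ-1)/2` (local case, used for `β > 1/2`). -/
def rLocal (α ρ β : ℝ) : ℝ := min (1 / (2 * β - 1)) (min (α * ρ - 1) ((ρ - 1) / 2))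

/-- `r = 1/(2β-1) ∧ (αρ-1)` (global case, used for `β > 1/2`). -/
def rGlobal (α ρ β : ℝ) : ℝ := min (1 / (2 * β - 1)) (α * ρ - 1)

/-- The smallest admissible `σ` in the local case. -/
def sigmaLocal (α ρ s β : ℝ) : ℝ :=
  if β ≤ 1 / 2 then
    max (1 / (2 * (2 * s - 1)))
      (max (α * s / (2 * ((1 + α) * s - 1)))
        ((1 - max (1 - α) (1 / 2) * s) / (2 * min α (1 / 2) * s)))
  else if s < 1 then
    max (1 / (2 * (2 * s - 1)))
      (max (α * s / (2 * ((1 + α) * s - 1)))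
        ((1 + rLocal α ρ β) / (2 * rLocal α ρ β)))
  else (1 + rLocal α ρ β) / (2 * rLocal α ρ β)

/-- The smallest admissible `σ` in the global case. -/
def sigmaGlobal (α ρ s β : ℝ) : ℝ :=
  if β ≤ 1 / 2 then
    max (1 / (2 * (2 * s - 1))) (α * s / (2 * ((1 + α) * s - 1)))
  else if s < 1 then
    max (1 / (2 * (2 * s - 1)))
      (max (α * s / (2 * ((1 + α) * s - 1)))
        ((1 + rGlobal α ρ β) / (2 * rGlobal α ρ β)))
  else (1 + rGlobal α ρ β) / (2 * rGlobal α ρ β)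

/-- The iteration count for the tolerance `ε` in the local case. -/
def countLocal (α ρ s β ε σ : ℝ) : ℕ :=
  if β ≤ 1 / 2 then
    ⌈ε ^ (-1 / (1 - σ) *
      max (max 2 α⁻¹ / s) (max (2 / (2 * s - 1)) (1 / ((1 + α) * s - 1))))⌉₊
  else if s < 1 then
    ⌈ε ^ (-1 / (1 - σ) *
      max (1 / (rLocal α ρ β * (1 - s))) (max (2 / (2 * s - 1)) (1 / ((1 + α) * s - 1))))⌉₊
  else ⌈Real.exp (ε ^ (-(1 / (rLocal α ρ β * (1 - σ)))))⌉₊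

/-- The iteration count for the tolerance `ε` in the global case. -/
def countGlobal (α ρ s β ε σ : ℝ) : ℕ :=
  if β ≤ 1 / 2 then
    ⌈ε ^ (-1 / (1 - σ) *
      max (1 / (α * s)) (max (2 / (2 * s - 1)) (1 / ((1 + α) * s - 1))))⌉₊
  else if s < 1 then
    ⌈ε ^ (-1 / (1 - σ) *
      max (1 / (rGlobal α ρ β * (1 - s))) (max (2 / (2 * s - 1)) (1 / ((1 + α) * s - 1))))⌉₊
  else ⌈Real.exp (ε ^ (-(1 / (rGlobal α ρ β * (1 - σ)))))⌉₊

/-- `n ∝ N` with proportionality factor `a > 0`: the integer `⌈a N⌉` (so `n = N` for `a = 1`). -/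
def proportional (a : ℝ) (N : ℕ) : ℕ := ⌈a * N⌉₊

/-- The exponent `λ` of the threshold on `κ γ⋆` in the global case. -/
def lambdaExp (α β : ℝ) : ℝ :=
  if β < 1 / 2 then (1 - 2 * β) / ((1 + α) / α * β - 1) else 0

/-- The threshold on `κ γ⋆` in the global case with `β ≤ 1/2` and `s = 1`. -/
def globalThreshold (L α β ζ : ℝ) : ℝ :=
  ζ ^ (2 + lambdaExp α β * ((1 + α) / α)) *
    ((1 + α) * L ^ (1 / α) / α) ^ lambdaExp α β * α

/-! ### Computational cost

The algorithm is run in an oracle model in which every primitive has a fixed price. -/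

/-- Prices of the primitives: producing `θ_0`, drawing one innovation, reading one learning rate,
one evaluation of the oracle `g`, one scalar arithmetic operation. -/
structure Prices where
  init : ℝ≥0
  sample : ℝ≥0
  rate : ℝ≥0
  oracle : ℝ≥0
  arith : ℝ≥0

/-- A result together with the cost incurred to compute it. -/
structure Timed (A : Type*) where
  val : A
  cost : ℝ≥0

/-- Return `x` and pay `c`. -/
def Timed.pay {A : Type*} (c : ℝ≥0) (x : A) : Timed A := ⟨x, c⟩

/-- Sequential composition; the costs add up. -/
def Timed.andThen {A B : Type*} (x : Timed A) (k : A → Timed B) : Timed B :=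
  ⟨(k x.val).val, x.cost + (k x.val).cost⟩

/-- One iteration: read the rate, draw the innovation, call the oracle, then `m` multiplications and
`m` subtractions. -/
def timedStep (p : Prices) {d m : ℕ} (g : Vec d → Vec m → Vec m) (rate : ℝ) (x : Vec d)
    (θ : Vec m) : Timed (Vec m) :=
  (Timed.pay p.rate rate).andThen fun η =>
  (Timed.pay p.sample x).andThen fun y =>
  (Timed.pay p.oracle (g y θ)).andThen fun v =>
  (Timed.pay (m * p.arith) (η • v)).andThen fun w =>
  Timed.pay (m * p.arith) (θ - w)

/-- `n` iterations of the algorithm on the stream of innovations `x 1, x 2, …`. -/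
def timedRun (p : Prices) {d m : ℕ} (g : Vec d → Vec m → Vec m) (γ : ℕ → ℝ) (x : ℕ → Vec d)
    (θ0 : Vec m) : ℕ → Timed (Vec m)
  | 0 => Timed.pay p.init θ0
  | n + 1 => (timedRun p g γ x θ0 n).andThen fun θ => timedStep p g (γ (n + 1)) (x (n + 1)) θ

end SGD

end

/-! The proof is an energy estimate carried out on events that may depend on the whole future. Fix
an event `A` and a reference level `v`, and let `v_k` be the integral of `F(θ_k) - v` over `A`. The
descent lemma for Hölder gradients shows that one step lowers `v_k` by `κ γ_{k+1}` times the
integral of `‖∇F(θ_k)‖²` over `A`, up to a noise term and a remainder of order `γ_{k+1}^{1+α}`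
(`setIntegral_gap_step`). Over such an `A` a single noise term need not integrate to zero. The noise
increments are however orthogonal on the whole space, so by Cauchy–Schwarz any weighted sum of their
integrals over `A` is controlled by the `ℓ²` norm of the weights (`exists_integral_noiseSum_sq_le`,
`sq_setIntegral_le`). One may therefore take for `A` the event `capture`: from some time on the
iterates stay in a region where the Łojasiewicz inequality holds relative to `v`, and their energies
tend to `v`. No stopping times are needed.

Rates are measured along a clock `τ`. The Łojasiewicz inequality turns the dissipation into a
contraction of the excess by `(τ_k/τ_{k+1})^K` up to an admissible error (`Drift`). For exponent at
most `1/2` the excess is bounded by a multiple of the squared gradient. For a larger exponent the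
same holds effectively as long as the excess exceeds `τ^{-x}`, and a smaller excess is absorbed in
the error. With `K > x` this gives `v_k ≤ M τ_k^{-x}`, and summing the dissipation to infinity gives
`v_k ≥ -M τ_k^{-x}`. A weighted summation by parts followed by Cauchy–Schwarz then bounds the mean
length of the remaining trajectory by `τ_n^{-(x+u-1)/2}`, where `γ` is at most of order `(Δτ)
τ^{-u}` (`EnergyRecursion.length_le`). The clock is `k + 1` with `u = s`, except when `s = 1` and
the exponent exceeds `1/2`; there it is `1 + log (k + 1)` with `u = 0`.

Finite mean length implies convergence on each such event. The events exhaust the space up to a null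
set: the energies converge by a supermartingale argument, the gradients vanish
(`ae_tendsto_gradient`), and by compactness finitely many critical values and neighborhoods capture
every trajectory of bounded limiting energy (`LojasiewiczOn.exists_cover`, `exists_capture`). The
same bound controls the mean distance to the limit, and Markov's inequality makes it a statement in
probability. In the global case `A` is the whole space and `v = inf F`, so Markov's inequality gives
the explicit factor `1/δ`. The thresholds on `σ` are those for which the counts match the exponents
`(x+u-1)/2` (`Attains`), and the cost claims follow since the cost is affine in `n` and the counts
increase with `σ`. -/

namespace SGD

/-! ### Sums along a slowly growing clock -/

/-- A clock: a nondecreasing sequence with values in `[1, ∞)` that at most doubles in each step. -/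
structure IsClock (τ : ℕ → ℝ) : Prop where
  one_le : ∀ k, 1 ≤ τ k
  mono : ∀ k, τ k ≤ τ (k + 1)
  le_two_mul : ∀ k, τ (k + 1) ≤ 2 * τ k

namespace IsClock

variable {τ : ℕ → ℝ}

lemma pos (hτ : IsClock τ) (k : ℕ) : 0 < τ k := lt_of_lt_of_le one_pos (hτ.one_le k)

lemma monotone (hτ : IsClock τ) : Monotone τ := monotone_nat_of_le_succ hτ.mono

end IsClock

/-- Two-sided comparison of an increment of a power with its differential. -/
lemma rpow_increment {a b : ℝ} (ha : 0 < a) (hab : a ≤ b) (hb : b ≤ 2 * a) (p : ℝ) :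
    ∃ c, 2 ^ (-|p - 1|) ≤ c ∧ c ≤ 2 ^ |p - 1| ∧
      b ^ p - a ^ p = p * c * ((b - a) * a ^ (p - 1)) := by
  rcases hab.eq_or_lt with rfl | hlt
  · exact ⟨1, Real.rpow_le_one_of_one_le_of_nonpos one_le_two (by simp),
      Real.one_le_rpow one_le_two (abs_nonneg _), by simp⟩
  · have hd : ∀ x ∈ Ioo a b, HasDerivAt (fun x : ℝ => x ^ p) (p * x ^ (p - 1)) x := fun x hx =>
      Real.hasDerivAt_rpow_const (Or.inl (ha.trans hx.1).ne')
    have hc : ContinuousOn (fun x : ℝ => x ^ p) (Icc a b) := fun x hx =>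
      (Real.continuousAt_rpow_const x p (Or.inl (ha.trans_le hx.1).ne')).continuousWithinAt
    obtain ⟨ξ, hξ, h⟩ := exists_hasDerivAt_eq_slope _ _ hlt hc hd
    have hξ0 : 0 < ξ := ha.trans hξ.1
    have h1 : 1 ≤ ξ / a := (one_le_div ha).2 hξ.1.le
    have h2 : ξ / a ≤ 2 := (div_le_iff₀ ha).2 (hξ.2.le.trans hb)
    -- The mean value point satisfies `1 ≤ ξ / a ≤ 2`, so replacing it by `a` costs at most a factor
    -- `2 ^ |p - 1|` either way.
    refine ⟨(ξ / a) ^ (p - 1), ?_, ?_, ?_⟩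
    · rcases le_total 0 (p - 1) with hp | hp
      · exact (Real.rpow_le_one_of_one_le_of_nonpos one_le_two (by simp)).trans
          (Real.one_le_rpow h1 hp)
      · rw [abs_of_nonpos hp, neg_neg]
        exact Real.rpow_le_rpow_of_nonpos (by linarith) h2 hp
    · rcases le_total 0 (p - 1) with hp | hp
      · rw [abs_of_nonneg hp]
        exact Real.rpow_le_rpow (by linarith) h2 hp
      · exact (Real.rpow_le_one_of_one_le_of_nonpos h1 hp).trans
          (Real.one_le_rpow one_le_two (abs_nonneg _))
    · rw [Real.div_rpow hξ0.le ha.le]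
      have ha' : a ^ (p - 1) ≠ 0 := (Real.rpow_pos_of_pos ha _).ne'
      have hba : b - a ≠ 0 := by linarith
      have h3 : b ^ p - a ^ p = p * ξ ^ (p - 1) * (b - a) := by
        rw [h]; field_simp
      rw [h3]; field_simp

/-- A Riemann sum for `∫ t^(p-1) dt`: each term is at most a constant times the increment of `τ ^
p`, and these telescope. The doubling bound keeps the constant independent of the clock. -/
lemma IsClock.sum_growing {τ : ℕ → ℝ} (hτ : IsClock τ) {p : ℝ} (hp : 0 < p) (n m : ℕ) :
    ∑ k ∈ Finset.Ico n m, (τ (k + 1) - τ k) * τ k ^ (p - 1) ≤ 2 ^ |p - 1| / p * τ m ^ p := by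
  rcases le_or_gt m n with hmn | hmn
  · rw [Finset.Ico_eq_empty_of_le hmn, Finset.sum_empty]
    have := Real.rpow_pos_of_pos (hτ.pos m) p
    positivity
  · have hstep : ∀ k, (τ (k + 1) - τ k) * τ k ^ (p - 1) ≤
        2 ^ |p - 1| / p * (τ (k + 1) ^ p - τ k ^ p) := by
      intro k
      obtain ⟨c, hc, -, h⟩ := rpow_increment (hτ.pos k) (hτ.mono k) (hτ.le_two_mul k) p
      have h0 : 0 ≤ (τ (k + 1) - τ k) * τ k ^ (p - 1) :=
        mul_nonneg (sub_nonneg.2 (hτ.mono k)) (Real.rpow_pos_of_pos (hτ.pos k) _).le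
      rw [h]
      have h2 : (2 : ℝ) ^ |p - 1| * 2 ^ (-|p - 1|) = 1 := by
        rw [← Real.rpow_add two_pos]; simp
      have h3 : 2 ^ |p - 1| / p * (p * c * ((τ (k + 1) - τ k) * τ k ^ (p - 1))) =
          (2 ^ |p - 1| * c) * ((τ (k + 1) - τ k) * τ k ^ (p - 1)) := by field_simp
      rw [h3]
      refine le_mul_of_one_le_left h0 ?_
      exact h2.symm.le.trans (mul_le_mul_of_nonneg_left hc (by positivity))
    calc _ ≤ ∑ k ∈ Finset.Ico n m, 2 ^ |p - 1| / p * (τ (k + 1) ^ p - τ k ^ p) :=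
          Finset.sum_le_sum fun k _ => hstep k
      _ = 2 ^ |p - 1| / p * (τ m ^ p - τ n ^ p) := by
          rw [← Finset.mul_sum, Finset.sum_Ico_sub (fun k => τ k ^ p) hmn.le]
      _ ≤ _ := by
          have := Real.rpow_pos_of_pos (hτ.pos n) p
          gcongr; linarith

/-- The tail counterpart of `sum_growing`, by telescoping `τ ^ (-q)`; the bound does not depend on
`m`, so it controls infinite tails. -/
lemma IsClock.sum_decaying {τ : ℕ → ℝ} (hτ : IsClock τ) {q : ℝ} (hq : 0 < q) (n m : ℕ) :
    ∑ k ∈ Finset.Ico n m, (τ (k + 1) - τ k) * τ k ^ (-1 - q) ≤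
      2 ^ (1 + q) / q * τ n ^ (-q) := by
  rcases le_or_gt m n with hmn | hmn
  · rw [Finset.Ico_eq_empty_of_le hmn, Finset.sum_empty]
    have := Real.rpow_pos_of_pos (hτ.pos n) (-q)
    positivity
  · have hstep : ∀ k, (τ (k + 1) - τ k) * τ k ^ (-1 - q) ≤
        2 ^ (1 + q) / q * (τ k ^ (-q) - τ (k + 1) ^ (-q)) := by
      intro k
      obtain ⟨c, hc, -, h⟩ := rpow_increment (hτ.pos k) (hτ.mono k) (hτ.le_two_mul k) (-q)
      have habs : |-q - 1| = 1 + q := by rw [abs_of_neg (by linarith)]; ring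
      rw [habs] at hc
      rw [show -q - 1 = -1 - q by ring] at h
      have h0 : 0 ≤ (τ (k + 1) - τ k) * τ k ^ (-1 - q) :=
        mul_nonneg (sub_nonneg.2 (hτ.mono k)) (Real.rpow_pos_of_pos (hτ.pos k) _).le
      have h2 : (2 : ℝ) ^ (1 + q) * 2 ^ (-(1 + q)) = 1 := by
        rw [← Real.rpow_add two_pos]; simp
      have h3 : 2 ^ (1 + q) / q * (τ k ^ (-q) - τ (k + 1) ^ (-q)) =
          (2 ^ (1 + q) * c) * ((τ (k + 1) - τ k) * τ k ^ (-1 - q)) := by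
        rw [← neg_sub (τ (k + 1) ^ (-q)), h]; field_simp
      rw [h3]
      refine le_mul_of_one_le_left h0 ?_
      exact h2.symm.le.trans (mul_le_mul_of_nonneg_left hc (by positivity))
    calc _ ≤ ∑ k ∈ Finset.Ico n m, 2 ^ (1 + q) / q * (τ k ^ (-q) - τ (k + 1) ^ (-q)) :=
          Finset.sum_le_sum fun k _ => hstep k
      _ = 2 ^ (1 + q) / q * (τ n ^ (-q) - τ m ^ (-q)) := by
          rw [← Finset.mul_sum, ← neg_sub (τ m ^ (-q)),
            ← Finset.sum_Ico_sub (fun k => τ k ^ (-q)) hmn.le, ← Finset.sum_neg_distrib]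
          simp
      _ ≤ _ := by
          have := Real.rpow_pos_of_pos (hτ.pos m) (-q)
          gcongr; linarith

/-- The contraction factor `1 - (τ_k / τ_{k+1})^K`. -/
noncomputable def contraction (τ : ℕ → ℝ) (K : ℝ) (k : ℕ) : ℝ := 1 - (τ k / τ (k + 1)) ^ K

lemma IsClock.contraction_nonneg {τ : ℕ → ℝ} (hτ : IsClock τ) {K : ℝ} (hK : 0 ≤ K) (k : ℕ) :
    0 ≤ contraction τ K k :=
  sub_nonneg.2 (Real.rpow_le_one (div_nonneg (hτ.pos k).le (hτ.pos _).le)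
    ((div_le_one (hτ.pos _)).2 (hτ.mono k)) hK)

/-- Apply `1 - exp (-y) ≤ y` to `y = K log (τ_{k+1} / τ_k)`, then `log z ≤ z - 1`. This needs only
`K ≥ 0`. -/
lemma IsClock.contraction_le {τ : ℕ → ℝ} (hτ : IsClock τ) {K : ℝ} (hK : 0 ≤ K) (k : ℕ) :
    contraction τ K k ≤ K * ((τ (k + 1) - τ k) / τ k) := by
  have h0 := hτ.pos k
  have h1 := hτ.pos (k + 1)
  have hpos : 0 < τ k / τ (k + 1) := div_pos h0 h1
  have h2 : Real.log (τ (k + 1) / τ k) ≤ (τ (k + 1) - τ k) / τ k := by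
    have := Real.log_le_sub_one_of_pos (div_pos h1 h0)
    rwa [sub_div, div_self h0.ne']
  have h3 : Real.log (τ k / τ (k + 1)) = -Real.log (τ (k + 1) / τ k) := by
    rw [← Real.log_inv, inv_div]
  have h4 := Real.add_one_le_exp (Real.log (τ k / τ (k + 1)) * K)
  rw [contraction, Real.rpow_def_of_pos hpos]
  rw [h3] at h4 ⊢
  nlinarith [mul_le_mul_of_nonneg_left h2 hK]

/-- Along a clock, step sizes `Γ` whose powers are dominated as needed for errors of order
`τ ^ (-x)`. -/
structure StepBounds (Γ τ : ℕ → ℝ) (x u C : ℝ) (n₀ : ℕ) : Prop where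
  clock : IsClock τ
  C_nonneg : 0 ≤ C
  pos : ∀ k, 0 < Γ k
  le : ∀ k, n₀ ≤ k → Γ k ≤ C * ((τ (k + 1) - τ k) * τ k ^ (-u))
  sq_le : ∀ k, n₀ ≤ k → Γ k ^ 2 ≤ C * ((τ (k + 1) - τ k) * τ k ^ (-1 - 2 * x))

/-- The recursion satisfied by the mean excess `v`, the mean squared gradient `d` and the mean
martingale increment `ν`. -/
structure EnergyRecursion (Γ τ v d ν : ℕ → ℝ) (x K C : ℝ) (n₀ : ℕ) : Prop where
  d_nonneg : ∀ k, 0 ≤ d k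
  dissipation : ∀ k, n₀ ≤ k →
    Γ k * d k ≤ v k - v (k + 1) + ν k + C * ((τ (k + 1) - τ k) * τ k ^ (-1 - x))
  drift : ∀ k, n₀ ≤ k →
    contraction τ K k * v k ≤ Γ k * d k + C * ((τ (k + 1) - τ k) * τ k ^ (-1 - x))
  noise : ∀ (c : ℕ → ℝ) (n m : ℕ), n₀ ≤ n →
    (∑ k ∈ Finset.Ico n m, c k * ν k) ^ 2 ≤ C * ∑ k ∈ Finset.Ico n m, c k ^ 2 * Γ k ^ 2
  limit : ∀ ε > 0, ∀ᶠ k in atTop, -ε ≤ v k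

/-! ### Decay of the mean excess and of the trajectory length for an abstract energy recursion -/

section Energy

variable {Γ τ v d ν : ℕ → ℝ} {x u K C : ℝ} {n₀ : ℕ}

/-- Individual `ν k` need not vanish, so cancellation is available only for whole weighted sums,
through their `ℓ²` bound. Weights of order `τ ^ p` lead to the clock sum of exponent `2p - 2x - 1`;
each application takes `R` proportional to `τ_n ^ (p - x)`, the order of the deterministic remainder
with the same weights. -/
lemma EnergyRecursion.abs_noise_le (h : EnergyRecursion Γ τ v d ν x K C n₀)
    (hΓ : StepBounds Γ τ x u C n₀) {c : ℕ → ℝ} {p b : ℝ} {n m : ℕ} (hn : n₀ ≤ n)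
    (hc : ∀ k, n₀ ≤ k → |c k| ≤ b * τ k ^ p) (hb : 0 ≤ b) {R : ℝ} (hR : 0 ≤ R)
    (hsum : ∑ k ∈ Finset.Ico n m, (τ (k + 1) - τ k) * τ k ^ (2 * p - 2 * x - 1) ≤ R ^ 2) :
    |∑ k ∈ Finset.Ico n m, c k * ν k| ≤ C * b * R := by
  have hτ := hΓ.clock
  have h1 : ∑ k ∈ Finset.Ico n m, c k ^ 2 * Γ k ^ 2 ≤ C * b ^ 2 * R ^ 2 := by
    calc _ ≤ ∑ k ∈ Finset.Ico n m, C * b ^ 2 * ((τ (k + 1) - τ k) * τ k ^ (2 * p - 2 * x - 1)) := by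
          refine Finset.sum_le_sum fun k hk => ?_
          have hk' : n₀ ≤ k := hn.trans (Finset.mem_Ico.1 hk).1
          have h2 : c k ^ 2 ≤ (b * τ k ^ p) ^ 2 := sq_le_sq' (by
            linarith [abs_le.1 (hc k hk')]) (abs_le.1 (hc k hk')).2
          calc c k ^ 2 * Γ k ^ 2 ≤ (b * τ k ^ p) ^ 2 *
                (C * ((τ (k + 1) - τ k) * τ k ^ (-1 - 2 * x))) := by
                have := hΓ.sq_le k hk'
                gcongr
            _ = _ := by
                have e : τ k ^ (2 * p - 2 * x - 1) = (τ k ^ p) ^ 2 * τ k ^ (-1 - 2 * x) := by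
                  rw [← Real.rpow_natCast, ← Real.rpow_mul (hτ.pos k).le,
                    ← Real.rpow_add (hτ.pos k)]
                  congr 1; push_cast; ring
                rw [e]; ring
      _ ≤ _ := by
          rw [← Finset.mul_sum]
          have := hΓ.C_nonneg
          gcongr
  refine abs_le_of_sq_le_sq ?_ (by have := hΓ.C_nonneg; positivity)
  calc _ ≤ C * (C * b ^ 2 * R ^ 2) := (h.noise c n m hn).trans
        (mul_le_mul_of_nonneg_left h1 hΓ.C_nonneg)
    _ = _ := by ring

/-- The mean excess is at most of order `τ ^ (-x)`. -/
lemma EnergyRecursion.le (h : EnergyRecursion Γ τ v d ν x K C n₀)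
    (hΓ : StepBounds Γ τ x u C n₀) (hx : 0 < x) (hK : x < K) :
    ∃ M, 0 ≤ M ∧ ∀ n, n₀ ≤ n → v n ≤ M * τ n ^ (-x) := by
  have hτ := hΓ.clock
  have hC := hΓ.C_nonneg
  have hKx : 0 < K - x := sub_pos.2 hK
  set A : ℝ := 2 ^ |2 * (K - x) - 1| / (2 * (K - x)) with hA
  set B : ℝ := 2 ^ |(K - x) - 1| / (K - x) with hB
  have hA0 : 0 ≤ A := by positivity
  have hB0 : 0 ≤ B := by positivity
  refine ⟨|τ n₀ ^ K * v n₀| + C * 2 ^ K * √A + 2 ^ K * (2 * C) * B, by positivity, fun n hn => ?_⟩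
  -- The integrating factor `τ ^ K` turns the contraction into a telescoping difference. The error
  -- appears twice, once from the dissipation and once from the drift, whence `2 * C`.
  have hstep : ∀ k, n₀ ≤ k → τ (k + 1) ^ K * v (k + 1) - τ k ^ K * v k ≤
      τ (k + 1) ^ K * ν k +
        2 ^ K * (2 * C) * ((τ (k + 1) - τ k) * τ k ^ ((K - x) - 1)) := by
    intro k hk
    have h1 := h.dissipation k hk
    have h2 := h.drift k hk
    have hp := Real.rpow_pos_of_pos (hτ.pos (k + 1)) K
    have h3 : v (k + 1) ≤ (τ k / τ (k + 1)) ^ K * v k + ν k +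
        2 * C * ((τ (k + 1) - τ k) * τ k ^ (-1 - x)) := by
      rw [contraction] at h2; linarith
    have h4 : τ (k + 1) ^ K ≤ 2 ^ K * τ k ^ K := by
      rw [← Real.mul_rpow two_pos.le (hτ.pos k).le]
      exact Real.rpow_le_rpow (hτ.pos _).le (hτ.le_two_mul k) (hx.trans hK).le
    have h5 : τ (k + 1) ^ K * (τ k / τ (k + 1)) ^ K = τ k ^ K := by
      rw [Real.div_rpow (hτ.pos k).le (hτ.pos _).le]; field_simp
    have h6 : τ k ^ ((K - x) - 1) = τ k ^ K * τ k ^ (-1 - x) := by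
      rw [← Real.rpow_add (hτ.pos k)]; congr 1; ring
    have h7 : 0 ≤ 2 * C * ((τ (k + 1) - τ k) * τ k ^ (-1 - x)) := by
      have := sub_nonneg.2 (hτ.mono k)
      have := Real.rpow_pos_of_pos (hτ.pos k) (-1 - x)
      positivity
    have h8 := mul_le_mul_of_nonneg_left h3 hp.le
    have h9 := mul_le_mul_of_nonneg_right h4 h7
    rw [h6]
    calc _ ≤ τ (k + 1) ^ K * ((τ k / τ (k + 1)) ^ K * v k + ν k +
        2 * C * ((τ (k + 1) - τ k) * τ k ^ (-1 - x))) - τ k ^ K * v k := by linarith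
      _ = (τ (k + 1) ^ K * (τ k / τ (k + 1)) ^ K) * v k - τ k ^ K * v k +
          τ (k + 1) ^ K * ν k + τ (k + 1) ^ K *
            (2 * C * ((τ (k + 1) - τ k) * τ k ^ (-1 - x))) := by ring
      _ ≤ _ := by rw [h5]; linarith
  have hsum := Finset.sum_le_sum fun k (hk : k ∈ Finset.Ico n₀ n) =>
    hstep k (Finset.mem_Ico.1 hk).1
  rw [Finset.sum_Ico_sub (fun k => τ k ^ K * v k) hn, Finset.sum_add_distrib,
    ← Finset.mul_sum] at hsum
  have hnoise := h.abs_noise_le hΓ (c := fun k => τ (k + 1) ^ K) (p := K) (b := 2 ^ K) (m := n)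
    le_rfl (fun k _ => by
      rw [abs_of_pos (Real.rpow_pos_of_pos (hτ.pos _) _),
        ← Real.mul_rpow two_pos.le (hτ.pos k).le]
      exact Real.rpow_le_rpow (hτ.pos _).le (hτ.le_two_mul k) (hx.trans hK).le)
    (by positivity) (R := √A * τ n ^ (K - x))
    (mul_nonneg (Real.sqrt_nonneg _) (Real.rpow_pos_of_pos (hτ.pos _) _).le) (by
      have := hτ.sum_growing (p := 2 * (K - x)) (by positivity) n₀ n
      rw [mul_pow, Real.sq_sqrt hA0, ← Real.rpow_natCast, ← Real.rpow_mul (hτ.pos n).le,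
        show 2 * K - 2 * x - 1 = 2 * (K - x) - 1 by ring,
        show (K - x) * (2 : ℕ) = 2 * (K - x) by push_cast; ring]
      exact this)
  have hrem := hτ.sum_growing hKx n₀ n
  -- Since `K > x`, the initial value is absorbed into the growing term.
  have h1 : 1 ≤ τ n ^ (K - x) := Real.one_le_rpow (hτ.one_le n) hKx.le
  have h2 : |τ n₀ ^ K * v n₀| ≤ |τ n₀ ^ K * v n₀| * τ n ^ (K - x) :=
    le_mul_of_one_le_right (abs_nonneg _) h1
  have h3 : τ n ^ K * v n ≤ (|τ n₀ ^ K * v n₀| + C * 2 ^ K * √A + 2 ^ K * (2 * C) * B) *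
      τ n ^ (K - x) := by
    have h5 := (abs_le.1 hnoise).2
    have h6 := le_abs_self (τ n₀ ^ K * v n₀)
    have h7 : 2 ^ K * (2 * C) * ∑ k ∈ Finset.Ico n₀ n, (τ (k + 1) - τ k) * τ k ^ ((K - x) - 1) ≤
        2 ^ K * (2 * C) * (B * τ n ^ (K - x)) := by gcongr
    linarith
  have h4 : τ n ^ (-x) * τ n ^ K = τ n ^ (K - x) := by
    rw [← Real.rpow_add (hτ.pos n)]; congr 1; ring
  rw [← h4] at h3
  have hp := Real.rpow_pos_of_pos (hτ.pos n) K
  nlinarith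

/-- The mean excess is at least of order `-τ ^ (-x)`. -/
lemma EnergyRecursion.ge (h : EnergyRecursion Γ τ v d ν x K C n₀)
    (hΓ : StepBounds Γ τ x u C n₀) (hx : 0 < x) :
    ∃ M, 0 ≤ M ∧ ∀ n, n₀ ≤ n → -(M * τ n ^ (-x)) ≤ v n := by
  have hτ := hΓ.clock
  have hC := hΓ.C_nonneg
  set A : ℝ := 2 ^ (1 + 2 * x) / (2 * x) with hA
  set B : ℝ := 2 ^ (1 + x) / x with hB
  have hA0 : 0 ≤ A := by positivity
  have hB0 : 0 ≤ B := by positivity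
  refine ⟨C * 1 * √A + C * B, by positivity, fun n hn => le_of_forall_pos_le_add fun ε hε => ?_⟩
  -- Sum the dissipation from `n` to a far time `m` where the excess is at least `-ε`, dropping the
  -- nonnegative gradient terms. The noise and remainder bounds are uniform in `m`.
  obtain ⟨m, hm, hnm⟩ := ((h.limit ε hε).and (eventually_ge_atTop n)).exists
  have hsum : ∑ k ∈ Finset.Ico n m, (v (k + 1) - v k) ≤ ∑ k ∈ Finset.Ico n m,
      (1 * ν k + C * ((τ (k + 1) - τ k) * τ k ^ (-1 - x))) :=
    Finset.sum_le_sum fun k hk => by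
      have hk' := hn.trans (Finset.mem_Ico.1 hk).1
      have := h.dissipation k hk'
      have := mul_nonneg (hΓ.pos k).le (h.d_nonneg k)
      linarith
  rw [Finset.sum_Ico_sub v hnm, Finset.sum_add_distrib, ← Finset.mul_sum _ _ C] at hsum
  have hnoise := h.abs_noise_le hΓ (c := fun _ => 1) (p := 0) (b := 1) (n := n) (m := m)
    hn (fun k _ => by simp) zero_le_one (R := √A * τ n ^ (-x))
    (mul_nonneg (Real.sqrt_nonneg _) (Real.rpow_pos_of_pos (hτ.pos _) _).le) (by
      have := hτ.sum_decaying (q := 2 * x) (by positivity) n m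
      rw [mul_pow, Real.sq_sqrt hA0, ← Real.rpow_natCast, ← Real.rpow_mul (hτ.pos n).le]
      convert this using 4 <;> (push_cast; ring))
  have hrem := mul_le_mul_of_nonneg_left (hτ.sum_decaying hx n m) hC
  have h5 := (abs_le.1 hnoise).2
  linarith

/-- The mean length of the trajectory after time `n` is at most of order
`τ_n ^ (-(x + u - 1) / 2)`. -/
theorem EnergyRecursion.length_le (h : EnergyRecursion Γ τ v d ν x K C n₀)
    (hΓ : StepBounds Γ τ x u C n₀) (hx : 0 < x) (hK : x < K) (hu0 : u ≤ 1) (hu : 1 - u < x) :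
    ∃ M, 0 ≤ M ∧ ∀ n m, n₀ ≤ n →
      ∑ k ∈ Finset.Ico n m, Γ k * √(d k) ≤ M * τ n ^ (-((x + u - 1) / 2)) := by
  have hτ := hΓ.clock
  have hC := hΓ.C_nonneg
  obtain ⟨M₁, hM₁, hle⟩ := h.le hΓ hx hK
  obtain ⟨M₂, hM₂, hge⟩ := h.ge hΓ hx
  set M := max M₁ M₂ with hMdef
  have hM : 0 ≤ M := hM₁.trans (le_max_left _ _)
  have habs : ∀ n, n₀ ≤ n → |v n| ≤ M * τ n ^ (-x) := fun n hn => by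
    have hp := (Real.rpow_pos_of_pos (hτ.pos n) (-x)).le
    refine abs_le.2 ⟨?_, (hle n hn).trans (mul_le_mul_of_nonneg_right (le_max_left _ _) hp)⟩
    have := mul_le_mul_of_nonneg_right (le_max_right M₁ M₂) hp
    linarith [hge n hn]
  -- The weight `τ ^ y` must satisfy `y > 1 - u`, so that the sums of `Γ τ ^ (-y)` converge, and `y
  -- < x`, so that the weighted dissipation converges. It cancels in the final exponent.
  obtain ⟨y, hy1, hy2⟩ := exists_between hu
  have hy0 : 0 < y := by linarith
  have hxy : 0 < x - y := sub_pos.2 hy2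
  set A : ℝ := 2 ^ (1 + 2 * (x - y)) / (2 * (x - y)) with hA
  set B : ℝ := 2 ^ (1 + (x - y)) / (x - y) with hB
  set E : ℝ := 2 ^ (1 + (u + y - 1)) / (u + y - 1) with hE
  have hA0 : 0 ≤ A := by positivity
  have hB0 : 0 ≤ B := by positivity
  have hE0 : 0 ≤ E := div_nonneg (by positivity) (by linarith)
  set G : ℝ := M + M + y * 2 ^ |y - 1| * M * B + C * 1 * √A + C * B with hG
  have hG0 : 0 ≤ G := by positivity
  -- Summation by parts against the dissipation inequality: boundary terms, increments of the weight
  -- times the excess, noise, and remainder are all of order `τ_n ^ (y - x)`.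
  have hweighted : ∀ n m, n₀ ≤ n → n ≤ m →
      ∑ k ∈ Finset.Ico n m, τ k ^ y * (Γ k * d k) ≤ G * τ n ^ (y - x) := by
    intro n m hn hnm
    have hstep : ∀ k ∈ Finset.Ico n m, τ k ^ y * (Γ k * d k) ≤
        -(τ (k + 1) ^ y * v (k + 1) - τ k ^ y * v k) +
        (y * 2 ^ |y - 1| * M + C) * ((τ (k + 1) - τ k) * τ k ^ (-1 - (x - y))) +
        τ k ^ y * ν k := by
      intro k hk
      have hk' := hn.trans (Finset.mem_Ico.1 hk).1
      have hp := Real.rpow_pos_of_pos (hτ.pos k) y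
      have h1 := mul_le_mul_of_nonneg_left (h.dissipation k hk') hp.le
      obtain ⟨c, -, hc, hinc⟩ := rpow_increment (hτ.pos k) (hτ.mono k) (hτ.le_two_mul k) y
      have hδ := sub_nonneg.2 (hτ.mono k)
      have hinc0 : 0 ≤ τ (k + 1) ^ y - τ k ^ y :=
        sub_nonneg.2 (Real.rpow_le_rpow (hτ.pos k).le (hτ.mono k) hy0.le)
      have hinc1 : τ (k + 1) ^ y - τ k ^ y ≤
          y * 2 ^ |y - 1| * ((τ (k + 1) - τ k) * τ k ^ (y - 1)) := by
        rw [hinc]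
        have := (Real.rpow_pos_of_pos (hτ.pos k) (y - 1)).le
        gcongr
      have hv : v (k + 1) ≤ M * τ k ^ (-x) := by
        refine (le_abs_self _).trans ((habs (k + 1) (hk'.trans (Nat.le_succ k))).trans ?_)
        exact mul_le_mul_of_nonneg_left
          (Real.rpow_le_rpow_of_nonpos (hτ.pos k) (hτ.mono k) (by linarith)) hM
      have h2 : (τ (k + 1) ^ y - τ k ^ y) * v (k + 1) ≤
          y * 2 ^ |y - 1| * ((τ (k + 1) - τ k) * τ k ^ (y - 1)) * (M * τ k ^ (-x)) :=
        (mul_le_mul_of_nonneg_left hv hinc0).trans (mul_le_mul_of_nonneg_right hinc1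
          (mul_nonneg hM (Real.rpow_pos_of_pos (hτ.pos k) _).le))
      have e1 : τ k ^ (y - 1) * τ k ^ (-x) = τ k ^ (-1 - (x - y)) := by
        rw [← Real.rpow_add (hτ.pos k)]; congr 1; ring
      have e2 : τ k ^ y * τ k ^ (-1 - x) = τ k ^ (-1 - (x - y)) := by
        rw [← Real.rpow_add (hτ.pos k)]; congr 1; ring
      have h3 : y * 2 ^ |y - 1| * ((τ (k + 1) - τ k) * τ k ^ (y - 1)) * (M * τ k ^ (-x)) =
          y * 2 ^ |y - 1| * M * ((τ (k + 1) - τ k) * τ k ^ (-1 - (x - y))) := by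
        rw [← e1]; ring
      have h4 : τ k ^ y * (C * ((τ (k + 1) - τ k) * τ k ^ (-1 - x))) =
          C * ((τ (k + 1) - τ k) * τ k ^ (-1 - (x - y))) := by rw [← e2]; ring
      linarith
    have hsum := Finset.sum_le_sum hstep
    rw [Finset.sum_add_distrib, Finset.sum_add_distrib, Finset.sum_neg_distrib,
      Finset.sum_Ico_sub (fun k => τ k ^ y * v k) hnm, ← Finset.mul_sum] at hsum
    have hnoise := h.abs_noise_le hΓ (c := fun k => τ k ^ y) (p := y) (b := 1) (n := n) (m := m)
      hn (fun k _ => by rw [abs_of_pos (Real.rpow_pos_of_pos (hτ.pos _) _), one_mul])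
      zero_le_one (R := √A * τ n ^ (y - x))
      (mul_nonneg (Real.sqrt_nonneg _) (Real.rpow_pos_of_pos (hτ.pos _) _).le) (by
        have := hτ.sum_decaying (q := 2 * (x - y)) (by positivity) n m
        rw [mul_pow, Real.sq_sqrt hA0, ← Real.rpow_natCast, ← Real.rpow_mul (hτ.pos n).le]
        convert this using 4 <;> (push_cast; ring))
    have hrem := mul_le_mul_of_nonneg_left (hτ.sum_decaying hxy n m)
      (by positivity : 0 ≤ y * 2 ^ |y - 1| * M + C)
    rw [neg_sub x y] at hrem
    have hvn : ∀ j, n ≤ j → |τ j ^ y * v j| ≤ M * τ n ^ (y - x) := by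
      intro j hj
      have hp := Real.rpow_pos_of_pos (hτ.pos j) y
      rw [abs_mul, abs_of_pos hp]
      calc τ j ^ y * |v j| ≤ τ j ^ y * (M * τ j ^ (-x)) :=
            mul_le_mul_of_nonneg_left (habs j (hn.trans hj)) hp.le
        _ = M * τ j ^ (y - x) := by
            rw [sub_eq_add_neg y x, Real.rpow_add (hτ.pos j)]; ring
        _ ≤ _ := mul_le_mul_of_nonneg_left (Real.rpow_le_rpow_of_nonpos (hτ.pos n)
            (hτ.monotone hj) (by linarith)) hM
    have h5 := (abs_le.1 hnoise).2
    have h6 := (abs_le.1 (hvn n le_rfl)).2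
    have h7 := (abs_le.1 (hvn m hnm)).1
    rw [hG]
    linarith
  refine ⟨√(C * E) * √G, by positivity, fun n m hn => ?_⟩
  rcases le_or_gt m n with hmn | hnm
  · rw [Finset.Ico_eq_empty_of_le hmn, Finset.sum_empty]
    have := Real.rpow_pos_of_pos (hτ.pos n) (-((x + u - 1) / 2))
    positivity
  -- Cauchy–Schwarz with `Γ √d = √(Γ τ^(-y)) · √(τ^y Γ d)`. The exponents combine to `-(u+y-1)/2 +
  -- (y-x)/2 = -(x+u-1)/2`.
  have hcs := Real.sum_mul_le_sqrt_mul_sqrt (Finset.Ico n m)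
    (fun k => √(Γ k * τ k ^ (-y))) (fun k => √(τ k ^ y * (Γ k * d k)))
  have hleft : ∀ k, √(Γ k * τ k ^ (-y)) * √(τ k ^ y * (Γ k * d k)) = Γ k * √(d k) := by
    intro k
    have hp := hΓ.pos k
    have hw := Real.rpow_pos_of_pos (hτ.pos k) (-y)
    rw [← Real.sqrt_mul (by positivity)]
    have : Γ k * τ k ^ (-y) * (τ k ^ y * (Γ k * d k)) = Γ k ^ 2 * d k := by
      have e : τ k ^ (-y) * τ k ^ y = 1 := by
        rw [← Real.rpow_add (hτ.pos k)]; simp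
      linear_combination (Γ k ^ 2 * d k) * e
    rw [this, Real.sqrt_mul (by positivity), Real.sqrt_sq hp.le]
  have hs1 : ∑ k ∈ Finset.Ico n m, √(Γ k * τ k ^ (-y)) ^ 2 ≤
      C * E * τ n ^ (-(u + y - 1)) := by
    calc _ ≤ ∑ k ∈ Finset.Ico n m,
          C * ((τ (k + 1) - τ k) * τ k ^ (-1 - (u + y - 1))) := by
          refine Finset.sum_le_sum fun k hk => ?_
          have hw := Real.rpow_pos_of_pos (hτ.pos k) (-y)
          rw [Real.sq_sqrt (mul_nonneg (hΓ.pos k).le hw.le)]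
          have := hΓ.le k (hn.trans (Finset.mem_Ico.1 hk).1)
          have e : τ k ^ (-1 - (u + y - 1)) = τ k ^ (-u) * τ k ^ (-y) := by
            rw [← Real.rpow_add (hτ.pos k)]; congr 1; ring
          rw [e]
          calc _ ≤ C * ((τ (k + 1) - τ k) * τ k ^ (-u)) * τ k ^ (-y) := by gcongr
            _ = _ := by ring
      _ ≤ _ := by
          rw [← Finset.mul_sum, mul_assoc]
          exact mul_le_mul_of_nonneg_left (hτ.sum_decaying (by linarith) n m) hC
  have hs2 : ∑ k ∈ Finset.Ico n m, √(τ k ^ y * (Γ k * d k)) ^ 2 ≤ G * τ n ^ (y - x) := by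
    refine le_trans (Finset.sum_le_sum fun k _ => ?_) (hweighted n m hn hnm.le)
    rw [Real.sq_sqrt]
    exact mul_nonneg (Real.rpow_pos_of_pos (hτ.pos k) _).le
      (mul_nonneg (hΓ.pos k).le (h.d_nonneg k))
  simp only [hleft] at hcs
  refine hcs.trans ?_
  calc _ ≤ √(C * E * τ n ^ (-(u + y - 1))) * √(G * τ n ^ (y - x)) := by gcongr
    _ = √(C * E) * √G * (√(τ n ^ (-(u + y - 1))) * √(τ n ^ (y - x))) := by
        rw [Real.sqrt_mul (by positivity), Real.sqrt_mul hG0]; ring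
    _ = _ := by
        rw [← Real.sqrt_mul (Real.rpow_pos_of_pos (hτ.pos n) _).le,
          ← Real.rpow_add (hτ.pos n), Real.sqrt_eq_rpow (τ n ^ _),
          ← Real.rpow_mul (hτ.pos n).le]
        congr 2; ring

end Energy

/-! ### Smoothness and the Łojasiewicz inequality -/

section Landscape

variable {m : ℕ} {F : Vec m → ℝ} {L α : ℝ}

/-- The excess `F - inf F`. -/
noncomputable def gap (F : Vec m → ℝ) (θ : Vec m) : ℝ := F θ - ⨅ η, F η

lemma HolderSmooth.gap_nonneg (h : HolderSmooth F L α) (θ : Vec m) : 0 ≤ gap F θ :=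
  sub_nonneg.2 (ciInf_le h.bddBelow θ)

lemma HolderSmooth.continuous (h : HolderSmooth F L α) : Continuous F :=
  h.differentiable.continuous

lemma HolderSmooth.continuous_gap (h : HolderSmooth F L α) : Continuous (gap F) :=
  h.continuous.sub continuous_const

lemma HolderSmooth.continuous_gradient (h : HolderSmooth F L α) : Continuous (gradient F) := by
  refine continuous_iff_continuousAt.2 fun θ => tendsto_iff_norm_sub_tendsto_zero.2 ?_
  have h1 : Tendsto (fun η : Vec m => L * ‖η - θ‖ ^ α) (𝓝 θ) (𝓝 0) := by
    have : Continuous fun η : Vec m => L * ‖η - θ‖ ^ α :=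
      continuous_const.mul ((continuous_id.sub continuous_const).norm.rpow_const
        fun _ => Or.inr h.α_pos.le)
    have := this.tendsto θ
    simpa [Real.zero_rpow h.α_pos.ne'] using this
  exact squeeze_zero (fun _ => norm_nonneg _) (fun η => h.holder θ η) h1

/-- The descent lemma for Hölder gradients. -/
lemma HolderSmooth.descent (h : HolderSmooth F L α) (θ v : Vec m) :
    F (θ + v) ≤ F θ + inner ℝ (gradient F θ) v + L / (1 + α) * ‖v‖ ^ (1 + α) := by
  have hα := h.α_pos
  have hα1 : (0 : ℝ) < 1 + α := by linarith
  -- `φ` is the defect of the inequality along the segment. The Hölder bound makes its derivative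
  -- nonpositive, and the claim is `φ 1 ≤ φ 0`.
  let φ : ℝ → ℝ := fun t =>
    F (θ + t • v) - t * inner ℝ (gradient F θ) v - L / (1 + α) * ‖v‖ ^ (1 + α) * t ^ (1 + α)
  have hd : ∀ t : ℝ, HasDerivAt φ (inner ℝ (gradient F (θ + t • v)) v -
      inner ℝ (gradient F θ) v - L / (1 + α) * ‖v‖ ^ (1 + α) * ((1 + α) * t ^ α)) t := by
    intro t
    have h1 : HasDerivAt (fun t : ℝ => θ + t • v) v t := by
      simpa using ((hasDerivAt_id t).smul_const v).const_add θ
    have h2 := (h.differentiable (θ + t • v)).hasGradientAt.hasFDerivAt.comp_hasDerivAt t h1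
    have h3 : HasDerivAt (fun t : ℝ => t ^ (1 + α)) ((1 + α) * t ^ α) t := by
      simpa using Real.hasDerivAt_rpow_const (x := t) (p := 1 + α) (Or.inr (by linarith))
    have h4 := (hasDerivAt_id t).mul_const (inner ℝ (gradient F θ) v)
    simp only [InnerProductSpace.toDual_apply_apply, one_mul] at h2 h4
    exact (h2.sub h4).sub (h3.const_mul _)
  have hanti : AntitoneOn φ (Icc 0 1) := by
    refine antitoneOn_of_deriv_nonpos (convex_Icc 0 1)
      (fun t _ => (hd t).continuousAt.continuousWithinAt)
      (fun t _ => (hd t).differentiableAt.differentiableWithinAt) fun t ht => ?_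
    rw [interior_Icc] at ht
    rw [(hd t).deriv]
    have h1 := real_inner_le_norm (gradient F (θ + t • v) - gradient F θ) v
    rw [inner_sub_left] at h1
    have h2 := h.holder θ (θ + t • v)
    rw [add_sub_cancel_left, norm_smul, Real.norm_of_nonneg ht.1.le,
      Real.mul_rpow ht.1.le (norm_nonneg _)] at h2
    have h3 : L / (1 + α) * ‖v‖ ^ (1 + α) * ((1 + α) * t ^ α) =
        L * (t ^ α * ‖v‖ ^ α) * ‖v‖ := by
      rw [add_comm 1 α, Real.rpow_add_one' (norm_nonneg _) (by linarith)]
      field_simp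
    rw [h3]
    have := mul_le_mul_of_nonneg_right h2 (norm_nonneg v)
    linarith
  have := hanti (by simp : (0 : ℝ) ∈ Icc (0 : ℝ) 1) (by simp : (1 : ℝ) ∈ Icc (0 : ℝ) 1) zero_le_one
  simp only [φ, zero_smul, one_smul, add_zero, zero_mul, one_mul, Real.one_rpow, mul_one,
    Real.zero_rpow hα1.ne', mul_zero, sub_zero] at this
  linarith

/-- A gradient step cannot bring `F` below its infimum. The decrease guaranteed by the descent lemma
for the best step length is therefore at most the gap. -/
lemma HolderSmooth.norm_gradient_rpow_le (h : HolderSmooth F L α) (θ : Vec m) :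
    ‖gradient F θ‖ ^ ((1 + α) / α) ≤ (1 + α) * L ^ (1 / α) / α * gap F θ := by
  have hα := h.α_pos
  have hL := h.L_pos
  have hα1 : (0 : ℝ) < 1 + α := by linarith
  rcases (norm_nonneg (gradient F θ)).eq_or_lt with h0 | h0
  · rw [← h0, Real.zero_rpow (by positivity)]
    have := h.gap_nonneg θ
    positivity
  set G := ‖gradient F θ‖ with hG
  -- The step length maximizing `t G² - L/(1+α) (t G)^(1+α)`.
  let t : ℝ := (G ^ (1 - α) / L) ^ (1 / α)
  have hbase : 0 < G ^ (1 - α) / L := div_pos (Real.rpow_pos_of_pos h0 _) hL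
  have ht : 0 < t := Real.rpow_pos_of_pos hbase _
  have htα : t ^ α = G ^ (1 - α) / L := by
    simp only [t]; rw [← Real.rpow_mul hbase.le]; simp [hα.ne']
  have h1 := h.descent θ (-(t • gradient F θ))
  rw [inner_neg_right, inner_smul_right, real_inner_self_eq_norm_sq, norm_neg, norm_smul,
    Real.norm_of_nonneg ht.le, ← hG] at h1
  have h2 : (t * G) ^ (1 + α) = t * G ^ 2 / L := by
    rw [Real.mul_rpow ht.le h0.le, Real.rpow_add ht, Real.rpow_one, htα,
      Real.rpow_add h0, Real.rpow_one]
    have : G ^ (1 - α) * G ^ α = G := by rw [← Real.rpow_add h0]; simp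
    linear_combination (t / L * G) * this
  rw [h2] at h1
  have h3 := ciInf_le h.bddBelow (θ + -(t • gradient F θ))
  have h4 : t * G ^ 2 * (α / (1 + α)) ≤ gap F θ := by
    have e : t * G ^ 2 * (α / (1 + α)) = t * G ^ 2 - L / (1 + α) * (t * G ^ 2 / L) := by
      field_simp; ring
    rw [e, gap]; linarith
  have h5 : G ^ ((1 + α) / α) = L ^ (1 / α) * (t * G ^ 2) := by
    have e1 : L ^ (1 / α) * t = G ^ ((1 - α) / α) := by
      simp only [t]
      rw [← Real.mul_rpow hL.le hbase.le, mul_div_cancel₀ _ hL.ne', ← Real.rpow_mul h0.le]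
      congr 1; ring
    rw [← mul_assoc, e1, ← Real.rpow_natCast, ← Real.rpow_add h0]
    congr 1; field_simp; push_cast; ring
  rw [h5]
  calc L ^ (1 / α) * (t * G ^ 2) =
        (1 + α) * L ^ (1 / α) / α * (t * G ^ 2 * (α / (1 + α))) := by field_simp
    _ ≤ _ := by gcongr

lemma HolderSmooth.norm_gradient_le (h : HolderSmooth F L α) (θ : Vec m) :
    ‖gradient F θ‖ ≤ ((1 + α) * L ^ (1 / α) / α * gap F θ) ^ (α / (1 + α)) := by
  have hα := h.α_pos
  have h1 := Real.rpow_le_rpow (by positivity) (h.norm_gradient_rpow_le θ)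
    (by positivity : 0 ≤ α / (1 + α))
  rwa [← Real.rpow_mul (norm_nonneg _),
    show (1 + α) / α * (α / (1 + α)) = 1 by field_simp, Real.rpow_one] at h1

/-- Since `α ≤ 1`, the exponent `(1 + α) / α` is at least two, so only gradients of norm at most one
need the additional constant. -/
lemma HolderSmooth.norm_gradient_sq_le (h : HolderSmooth F L α) :
    ∃ C, 0 ≤ C ∧ ∀ θ, ‖gradient F θ‖ ^ 2 ≤ C * (gap F θ + 1) := by
  have hα := h.α_pos
  have hα1 := h.α_le_one
  have hL := h.L_pos
  refine ⟨(1 + α) * L ^ (1 / α) / α + 1, by positivity, fun θ => ?_⟩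
  have h0 := h.gap_nonneg θ
  have hQ : 0 ≤ (1 + α) * L ^ (1 / α) / α := by positivity
  rcases le_total ‖gradient F θ‖ 1 with h1 | h1
  · have : ‖gradient F θ‖ ^ 2 ≤ 1 := pow_le_one₀ (norm_nonneg _) h1
    nlinarith [mul_nonneg hQ h0]
  · have h2 : ‖gradient F θ‖ ^ 2 ≤ ‖gradient F θ‖ ^ ((1 + α) / α) := by
      rw [← Real.rpow_natCast]
      refine Real.rpow_le_rpow_of_exponent_le h1 ?_
      rw [le_div_iff₀ hα]; push_cast; linarith
    have := h.norm_gradient_rpow_le θ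
    nlinarith

/-- Quadratic growth makes the initial energy integrable as soon as `θ 0` is square integrable. -/
lemma HolderSmooth.gap_le (h : HolderSmooth F L α) :
    ∃ C, 0 ≤ C ∧ ∀ θ, gap F θ ≤ C * (1 + ‖θ‖ ^ 2) := by
  have hα := h.α_pos
  have hL := h.L_pos
  refine ⟨gap F 0 + ‖gradient F 0‖ + L / (1 + α), ?_, fun θ => ?_⟩
  · have := h.gap_nonneg 0
    positivity
  have h1 := h.descent 0 θ
  rw [zero_add] at h1
  have h2 := real_inner_le_norm (gradient F 0) θ
  have h3 : ‖θ‖ ^ (1 + α) ≤ 1 + ‖θ‖ ^ 2 := by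
    rcases le_total ‖θ‖ 1 with h4 | h4
    · have := Real.rpow_le_one (norm_nonneg θ) h4 (by linarith : 0 ≤ 1 + α)
      nlinarith [sq_nonneg ‖θ‖]
    · have : ‖θ‖ ^ (1 + α) ≤ ‖θ‖ ^ (2 : ℝ) :=
        Real.rpow_le_rpow_of_exponent_le h4 (by linarith [h.α_le_one])
      rw [Real.rpow_two] at this
      linarith
  have h4 : ‖θ‖ ≤ 1 + ‖θ‖ ^ 2 := by nlinarith [sq_nonneg (‖θ‖ - 1)]
  have h5 := mul_le_mul_of_nonneg_left h3 (by positivity : 0 ≤ L / (1 + α))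
  have h6 := mul_le_mul_of_nonneg_left h4 (norm_nonneg (gradient F 0))
  have h7 := h.gap_nonneg 0
  have h8 := mul_nonneg h7 (sq_nonneg ‖θ‖)
  have h9 : gap F θ = F θ - F 0 + gap F 0 := by rw [gap, gap]; ring
  nlinarith

lemma isBounded_sublevel (h : Tendsto F (Bornology.cobounded (Vec m)) atTop) (ℓ : ℝ) :
    Bornology.IsBounded (sublevel F ℓ) := by
  have := h.eventually (eventually_gt_atTop ℓ)
  refine Bornology.isBounded_def.2 ?_
  filter_upwards [this] with θ hθ
  simpa [sublevel] using hθ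

lemma isCompact_sublevel (h1 : HolderSmooth F L α)
    (h : Tendsto F (Bornology.cobounded (Vec m)) atTop) (ℓ : ℝ) : IsCompact (sublevel F ℓ) :=
  Metric.isCompact_of_isClosed_isBounded (isClosed_le h1.continuous continuous_const)
    (isBounded_sublevel h ℓ)

lemma isCompact_stationary_inter (h1 : HolderSmooth F L α)
    (h : Tendsto F (Bornology.cobounded (Vec m)) atTop) (ℓ : ℝ) :
    IsCompact (stationary F ∩ sublevel F ℓ) :=
  (isCompact_sublevel h1 h ℓ).inter_left (isClosed_eq h1.continuous_gradient continuous_const)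

/-- A stationary point where a Łojasiewicz inequality holds has the reference value. -/
lemma eq_of_stationary {β ζ v : ℝ} (hβ : 0 < β) {θ : Vec m} (hθ : θ ∈ stationary F)
    (h : |F θ - v| ^ β ≤ ζ * ‖gradient F θ‖) : F θ = v := by
  rw [show gradient F θ = 0 from hθ, norm_zero, mul_zero] at h
  have h1 : |F θ - v| ^ β = 0 := le_antisymm h (Real.rpow_nonneg (abs_nonneg _) _)
  have h2 := ((Real.rpow_eq_zero (abs_nonneg _) hβ.ne').1 h1)
  exact sub_eq_zero.1 (abs_eq_zero.1 h2)

/-- On a sublevel set, the Łojasiewicz inequality holds with uniform exponent and constant. -/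
lemma exists_lojasiewiczOn (h1 : HolderSmooth F L α)
    (h : Tendsto F (Bornology.cobounded (Vec m)) atTop) (h5 : IsLojasiewicz F) (ℓ : ℝ) :
    ∃ β ∈ Ioo (0 : ℝ) 1, ∃ ζ > (0 : ℝ), LojasiewiczOn F (sublevel F ℓ) β ζ := by
  classical
  choose! V hVo hV β hβ ζ hζ hVβ using h5.2
  -- Where the excess is below one, raising the exponent to the maximal `β₀` of a finite subcover
  -- only decreases the power.
  let W : Vec m → Set (Vec m) := fun θs => V θs ∩ {θ | |F θ - F θs| < 1}
  have hWo : ∀ θs ∈ stationary F, IsOpen (W θs) := fun θs hs => (hVo θs hs).inter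
    (isOpen_lt (h1.continuous.sub continuous_const).abs continuous_const)
  obtain ⟨T, hT⟩ := (isCompact_stationary_inter h1 h ℓ).elim_finite_subcover
    (fun i : stationary F => W i) (fun i => hWo i i.2) (fun θ hθ => mem_iUnion.2
      ⟨⟨θ, hθ.1⟩, hV θ hθ.1, by simp⟩)
  obtain ⟨β₀, hβ0, hβ1, hβT⟩ : ∃ β₀ : ℝ, 0 < β₀ ∧ β₀ < 1 ∧ ∀ i ∈ T, β i ≤ β₀ := by
    refine T.induction_on ⟨1 / 2, by norm_num, by norm_num, by simp⟩ ?_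
    rintro i s - ⟨b, hb0, hb1, hb⟩
    refine ⟨max b (β i), lt_max_of_lt_left hb0, max_lt hb1 (hβ i i.2).2, fun j hj => ?_⟩
    rcases Finset.mem_insert.1 hj with rfl | hj
    · exact le_max_right _ _
    · exact (hb j hj).trans (le_max_left _ _)
  obtain ⟨ζ₀, hζ0, hζT⟩ : ∃ ζ₀ : ℝ, 0 < ζ₀ ∧ ∀ i ∈ T, ζ i ≤ ζ₀ := by
    refine T.induction_on ⟨1, by norm_num, by simp⟩ ?_
    rintro i s - ⟨b, hb0, hb⟩
    refine ⟨max b (ζ i), lt_max_of_lt_left hb0, fun j hj => ?_⟩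
    rcases Finset.mem_insert.1 hj with rfl | hj
    · exact le_max_right _ _
    · exact (hb j hj).trans (le_max_left _ _)
  refine ⟨β₀, ⟨hβ0, hβ1⟩, ζ₀, hζ0, fun θs hθs => ?_⟩
  obtain ⟨i, hi, hmem⟩ := mem_iUnion₂.1 (hT hθs)
  refine ⟨W i, hWo i i.2, hmem, fun θ hθ => ?_⟩
  -- A stationary point inside the neighborhood of `i` has the value `F i`, so the inequality
  -- centered at `i` is also one centered at that point.
  rw [eq_of_stationary (hβ i i.2).1 hθs.1 (hVβ i i.2 θs hmem.1)]
  calc |F θ - F i| ^ β₀ ≤ |F θ - F i| ^ β i :=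
        Real.rpow_le_rpow_of_exponent_ge' (abs_nonneg _) (le_of_lt hθ.2) (hβ i i.2).1.le (hβT i hi)
    _ ≤ ζ i * ‖gradient F θ‖ := hVβ i i.2 θ hθ.1
    _ ≤ _ := mul_le_mul_of_nonneg_right (hζT i hi) (norm_nonneg _)

/-- Raising the exponent makes the constant equal to one. -/
lemma LojasiewiczOn.normalize {K : Set (Vec m)} {β β' ζ : ℝ} (h1 : HolderSmooth F L α)
    (h : LojasiewiczOn F K β ζ) (hβ : 0 ≤ β) (hβ' : β < β') : LojasiewiczOn F K β' 1 := by
  intro θs hθs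
  obtain ⟨V, hVo, hV, hVβ⟩ := h θs hθs
  have hc : Continuous fun θ => |F θ - F θs| ^ (β' - β) * ζ :=
    ((h1.continuous.sub continuous_const).abs.rpow_const
      fun _ => Or.inr (sub_pos.2 hβ').le).mul continuous_const
  refine ⟨V ∩ {θ | |F θ - F θs| ^ (β' - β) * ζ < 1}, hVo.inter (isOpen_lt hc continuous_const),
    ⟨hV, by simp [Real.zero_rpow (sub_pos.2 hβ').ne']⟩, fun θ hθ => ?_⟩
  have h2 := hVβ θ hθ.1
  have h3 := Real.rpow_nonneg (abs_nonneg (F θ - F θs)) (β' - β)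
  calc |F θ - F θs| ^ β' = |F θ - F θs| ^ (β' - β) * |F θ - F θs| ^ β := by
        rw [← Real.rpow_add_of_nonneg (abs_nonneg _) (sub_pos.2 hβ').le hβ]; simp
    _ ≤ |F θ - F θs| ^ (β' - β) * (ζ * ‖gradient F θ‖) := by gcongr
    _ = (|F θ - F θs| ^ (β' - β) * ζ) * ‖gradient F θ‖ := by ring
    _ ≤ _ := mul_le_mul_of_nonneg_right (le_of_lt hθ.2) (norm_nonneg _)

/-- Finitely many critical values `v` and bounded open sets `U v` on which the Łojasiewicz
inequality holds relative to `v` capture every sequence of bounded energy with vanishing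
gradients and converging energies. -/
lemma LojasiewiczOn.exists_cover {ℓ β ζ : ℝ} (h1 : HolderSmooth F L α)
    (h4 : Tendsto F (Bornology.cobounded (Vec m)) atTop)
    (h : LojasiewiczOn F (sublevel F ℓ) β ζ) (hβ : 0 < β) {η : ℝ} (hη : 0 < η) :
    ∃ (S : Finset ℝ) (U : ℝ → Set (Vec m)),
      (∀ v, IsOpen (U v) ∧ Bornology.IsBounded (U v) ∧
        ∀ θ ∈ U v, |F θ - v| ^ β ≤ ζ * ‖gradient F θ‖ ∧ |F θ - v| ≤ η) ∧
      ∀ (t : ℕ → Vec m) (v : ℝ), v ≤ ℓ → Tendsto (fun n => F (t n)) atTop (𝓝 v) →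
        Tendsto (fun n => gradient F (t n)) atTop (𝓝 0) → v ∈ S ∧ ∀ᶠ n in atTop, t n ∈ U v := by
  classical
  choose! V hVo hV hVβ using h
  let K : Set (Vec m) := stationary F ∩ sublevel F ℓ
  let W : Vec m → Set (Vec m) := fun θs => V θs ∩ {θ | |F θ - F θs| < η} ∩ Metric.ball θs 1
  have hWo : ∀ θs ∈ stationary F ∩ sublevel F ℓ, IsOpen (W θs) := fun θs hs =>
    ((hVo θs hs).inter (isOpen_lt (h1.continuous.sub continuous_const).abs continuous_const)).inter
      Metric.isOpen_ball
  obtain ⟨T, hT⟩ := (isCompact_stationary_inter h1 h4 ℓ).elim_finite_subcover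
    (fun i : K => W i) (fun i => hWo i i.2)
    (fun θ hθ => mem_iUnion.2 ⟨⟨θ, hθ⟩, ⟨hV θ hθ, by simpa using hη⟩, by simp⟩)
  -- The finite cover is grouped by critical value, so that all of `U v` shares one reference value
  -- `v`.
  let U : ℝ → Set (Vec m) := fun v => ⋃ i ∈ T.filter (fun i : K => F i = v), W i
  have hUo : ∀ v, IsOpen (U v) := fun v => isOpen_biUnion fun i _ => hWo i i.2
  refine ⟨T.image (fun i : K => F i), U, fun v => ⟨hUo v, ?_, ?_⟩, ?_⟩
  · exact (Bornology.isBounded_biUnion_finset _).2 fun i _ =>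
      Metric.isBounded_ball.subset inter_subset_right
  · intro θ hθ
    obtain ⟨i, hi, hmem⟩ := mem_iUnion₂.1 hθ
    have hv := (Finset.mem_filter.1 hi).2
    rw [← hv]
    exact ⟨hVβ i i.2 θ hmem.1.1, le_of_lt hmem.1.2⟩
  · intro t v hv htF htG
    have hcap : ∀ x, x ∈ stationary F → F x = v → v ∈ T.image (fun i : K => F i) ∧ x ∈ U v := by
      intro x hx hxv
      have hxK : x ∈ stationary F ∩ sublevel F ℓ := ⟨hx, by rw [sublevel, mem_ofPred, hxv]; exact hv⟩
      obtain ⟨i, hi, hmem⟩ := mem_iUnion₂.1 (hT hxK)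
      have : F x = F i := eq_of_stationary hβ hx (hVβ i i.2 x hmem.1.1)
      have hiv : F i = v := this ▸ hxv
      exact ⟨Finset.mem_image.2 ⟨i, hi, hiv⟩,
        mem_iUnion₂.2 ⟨i, Finset.mem_filter.2 ⟨hi, hiv⟩, hmem⟩⟩
    have hcomp := isCompact_sublevel h1 h4 (v + 1)
    have hev : ∀ᶠ n in atTop, t n ∈ sublevel F (v + 1) :=
      (htF.eventually (eventually_lt_nhds (lt_add_one v))).mono fun n hn => le_of_lt hn
    have hlim : ∀ (φ : ℕ → ℕ) (x : Vec m), Tendsto φ atTop atTop →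
        Tendsto (t ∘ φ) atTop (𝓝 x) → x ∈ stationary F ∧ F x = v := by
      intro φ x hφ hx
      constructor
      · exact tendsto_nhds_unique ((h1.continuous_gradient.tendsto x).comp hx) (htG.comp hφ)
      · exact tendsto_nhds_unique ((h1.continuous.tendsto x).comp hx) (htF.comp hφ)
    constructor
    · obtain ⟨x, -, φ, hφ, hx⟩ := hcomp.tendsto_subseq' hev.frequently
      obtain ⟨h2, h3⟩ := hlim φ x hφ.tendsto_atTop hx
      exact (hcap x h2 h3).1
    -- Infinitely many visits outside `U v` would accumulate, by compactness of sublevel sets, at a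
    -- stationary point of value `v` outside `U v`, which `hcap` excludes.
    · by_contra hne
      rw [not_eventually] at hne
      have hfr := hne.and_eventually hev
      obtain ⟨x, hx, φ, hφ, hxφ⟩ := (hcomp.diff (hUo v)).tendsto_subseq'
        (hfr.mono fun n hn => ⟨hn.2, hn.1⟩)
      obtain ⟨h2, h3⟩ := hlim φ x hφ.tendsto_atTop hxφ
      exact hx.2 (hcap x h2 h3).2

/-- A coercive smooth function attains its infimum, at a stationary point. -/
lemma exists_stationary_eq_iInf (h1 : HolderSmooth F L α)
    (h4 : Tendsto F (Bornology.cobounded (Vec m)) atTop) :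
    ∃ θs ∈ stationary F, F θs = ⨅ η, F η := by
  obtain ⟨θs, hθs⟩ := h1.continuous.exists_forall_le
    (by rwa [Metric.cobounded_eq_cocompact] at h4)
  refine ⟨θs, ?_, le_antisymm (le_ciInf hθs) (ciInf_le h1.bddBelow θs)⟩
  have : IsLocalMin F θs := Eventually.of_forall hθs
  have h2 := this.fderiv_eq_zero
  rw [stationary, mem_ofPred, gradient, h2, map_zero]

/-- The inequality is the global one at a minimizer. An exponent below `α / (1 + α)` is impossible:
with the gradient bound of order `gap ^ (α / (1 + α))` it would keep positive gaps away from zero,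
whereas the continuous gap takes arbitrarily small positive values. -/
lemma exists_lojasiewiczGap (hm : 1 ≤ m) (h1 : HolderSmooth F L α)
    (h4 : Tendsto F (Bornology.cobounded (Vec m)) atTop) (h : IsGloballyLojasiewicz F) :
    ∃ β ∈ Ico (α / (1 + α)) 1, ∃ ζ > (0 : ℝ), LojasiewiczGap F β ζ := by
  obtain ⟨θs, hs, hmin⟩ := exists_stationary_eq_iInf h1 h4
  obtain ⟨β, hβ, ζ, hζ, hL⟩ := h.2 θs hs
  have hgap : LojasiewiczGap F β ζ := fun θ => by
    have := hL θ
    have h0 : 0 ≤ F θ - ⨅ η, F η := h1.gap_nonneg θ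
    rwa [hmin, abs_of_nonneg h0] at this
  refine ⟨β, ⟨le_of_not_gt fun hlt => ?_, hβ.2⟩, ζ, hζ, hgap⟩
  have hα := h1.α_pos
  set p := α / (1 + α) with hp
  set Q := (1 + α) * L ^ (1 / α) / α with hQ
  have hQ0 : 0 ≤ Q := by have := h1.L_pos; positivity
  have hsmall : ∀ θ, 0 < gap F θ → 1 ≤ ζ * Q ^ p * gap F θ ^ (p - β) := by
    intro θ hθ
    have h2 := (hgap θ).trans (mul_le_mul_of_nonneg_left (h1.norm_gradient_le θ) hζ.le)
    change gap F θ ^ β ≤ _ at h2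
    rw [← hp, ← hQ, Real.mul_rpow hQ0 hθ.le] at h2
    rw [Real.rpow_sub hθ]
    have := Real.rpow_pos_of_pos hθ β
    rw [← mul_div_assoc, le_div_iff₀ this]
    linarith
  -- Positive dimension makes the cobounded filter nontrivial, so coercivity provides a point of gap
  -- at least one.
  have : Nonempty (Fin m) := ⟨⟨0, hm⟩⟩
  obtain ⟨θ₁, hθ₁⟩ := (h4.eventually (eventually_ge_atTop ((⨅ η, F η) + 1))).exists
  have hcont : Tendsto (fun x : ℝ => ζ * Q ^ p * x ^ (p - β)) (𝓝[>] 0) (𝓝 0) := by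
    have : Continuous fun x : ℝ => ζ * Q ^ p * x ^ (p - β) :=
      continuous_const.mul (continuous_id.rpow_const fun _ => Or.inr (sub_pos.2 hlt).le)
    have := this.tendsto 0
    simp only [Real.zero_rpow (sub_pos.2 hlt).ne', mul_zero] at this
    exact this.mono_left nhdsWithin_le_nhds
  obtain ⟨x, hx1, hx0, hx2⟩ := ((hcont.eventually (eventually_lt_nhds one_pos)).and
    (Ioo_mem_nhdsGT one_pos)).exists
  obtain ⟨θ, rfl⟩ := mem_range_of_exists_le_of_exists_ge h1.continuous_gap
    ⟨θs, show gap F θs ≤ x by rw [gap, hmin, sub_self]; exact hx0.le⟩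
    ⟨θ₁, show x ≤ gap F θ₁ by rw [gap]; linarith⟩
  linarith [hsmall θ hx0]

end Landscape

/-! ### Independence of the innovations from the past -/

/-- On the π-system of intersections, `P(a ∩ b ∩ c) = P(a) P(b ∩ c) = P(a) P(b) P(c)`. It joins the
initial value, independent of all innovations, with the past innovations, independent of the next
one. -/
lemma indep_sup_left {Ω : Type*} {m₁ m₂ m₃ : MeasurableSpace Ω} {mΩ : MeasurableSpace Ω}
    {P : Measure Ω} [IsProbabilityMeasure P] (h₁ : m₁ ≤ mΩ) (h₂ : m₂ ≤ mΩ) (h₃ : m₃ ≤ mΩ)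
    (h : Indep m₁ (m₂ ⊔ m₃) P) (h' : Indep m₂ m₃ P) : Indep (m₁ ⊔ m₂) m₃ P := by
  let p : Set (Set Ω) := {s | ∃ a b, MeasurableSet[m₁] a ∧ MeasurableSet[m₂] b ∧ s = a ∩ b}
  have hp : IsPiSystem p := by
    rintro _ ⟨a, b, ha, hb, rfl⟩ _ ⟨a', b', ha', hb', rfl⟩ -
    exact ⟨a ∩ a', b ∩ b', ha.inter ha', hb.inter hb', inter_inter_inter_comm a b a' b'⟩
  have hgen : m₁ ⊔ m₂ = MeasurableSpace.generateFrom p := by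
    refine le_antisymm (sup_le (fun a ha => ?_) (fun b hb => ?_)) ?_
    · exact MeasurableSpace.measurableSet_generateFrom ⟨a, univ, ha, MeasurableSet.univ, by simp⟩
    · exact MeasurableSpace.measurableSet_generateFrom ⟨univ, b, MeasurableSet.univ, hb, by simp⟩
    · refine MeasurableSpace.generateFrom_le ?_
      rintro _ ⟨a, b, ha, hb, rfl⟩
      exact MeasurableSet.inter ((le_sup_left : m₁ ≤ m₁ ⊔ m₂) a ha)
        ((le_sup_right : m₂ ≤ m₁ ⊔ m₂) b hb)
  refine IndepSets.indep (sup_le h₁ h₂) h₃ hp (@MeasurableSpace.isPiSystem_measurableSet Ω m₃) hgen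
    (@MeasurableSpace.generateFrom_measurableSet Ω m₃).symm ?_
  rw [IndepSets_iff]
  rintro _ c ⟨a, b, ha, hb, rfl⟩ hc
  rw [Indep_iff] at h h'
  have hb' : MeasurableSet[m₂ ⊔ m₃] b := (le_sup_left : m₂ ≤ m₂ ⊔ m₃) b hb
  have hc' : MeasurableSet[m₂ ⊔ m₃] c := (le_sup_right : m₃ ≤ m₂ ⊔ m₃) c hc
  rw [inter_assoc, h a (b ∩ c) ha (hb'.inter hc'), h' b c hb hc, h a b ha hb', mul_assoc]

/-! ### Integrating out an innovation with the past frozen -/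

section Freezing

variable {Ω S E : Type*} {mΩ : MeasurableSpace Ω} [MeasurableSpace S] [MeasurableSpace E]
  {P : Measure Ω} [IsProbabilityMeasure P] {Y : Ω → S} {ξ X : Ω → E}

/-- By independence the joint law is a product, so Tonelli integrates out the innovation for a fixed
value of `Y`. This stands in for conditional expectations. -/
lemma lintegral_comp_of_indepFun (hY : Measurable Y) (hξ : Measurable ξ) (hX : Measurable X)
    (h : IndepFun Y ξ P) (hid : IdentDistrib ξ X P P) {φ : S × E → ENNReal} (hφ : Measurable φ) :
    ∫⁻ ω, φ (Y ω, ξ ω) ∂P = ∫⁻ ω, ∫⁻ ω', φ (Y ω, X ω') ∂P ∂P := by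
  have h1 := (indepFun_iff_map_prod_eq_prod_map_map hY.aemeasurable hξ.aemeasurable).1 h
  rw [hid.map_eq] at h1
  rw [← lintegral_map (μ := P) (f := φ) (g := fun ω => (Y ω, ξ ω)) hφ (hY.prodMk hξ), h1,
    lintegral_prod _ hφ.aemeasurable, lintegral_map hφ.lintegral_prod_right' hY]
  refine lintegral_congr fun ω => ?_
  exact lintegral_map (f := fun y => φ (Y ω, y)) (hφ.comp measurable_prodMk_left) hX

lemma integral_comp_of_indepFun (hY : Measurable Y) (hξ : Measurable ξ) (hX : Measurable X)
    (h : IndepFun Y ξ P) (hid : IdentDistrib ξ X P P) {φ : S × E → ℝ} (hφ : Measurable φ)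
    (hint : Integrable (fun ω => φ (Y ω, ξ ω)) P) :
    ∫ ω, φ (Y ω, ξ ω) ∂P = ∫ ω, ∫ ω', φ (Y ω, X ω') ∂P ∂P := by
  have h1 := (indepFun_iff_map_prod_eq_prod_map_map hY.aemeasurable hξ.aemeasurable).1 h
  rw [hid.map_eq] at h1
  have h2 : Integrable φ (P.map fun ω => (Y ω, ξ ω)) :=
    (integrable_map_measure hφ.aestronglyMeasurable (hY.prodMk hξ).aemeasurable).2 hint
  have : IsProbabilityMeasure (P.map X) := Measure.isProbabilityMeasure_map hX.aemeasurable
  rw [← integral_map (μ := P) (f := φ) (φ := fun ω => (Y ω, ξ ω)) (hY.prodMk hξ).aemeasurable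
    hφ.aestronglyMeasurable, h1, integral_prod _ (h1 ▸ h2), integral_map hY.aemeasurable
    hφ.stronglyMeasurable.integral_prod_right'.aestronglyMeasurable]
  refine integral_congr_ae (Eventually.of_forall fun ω => ?_)
  exact integral_map hX.aemeasurable (hφ.comp measurable_prodMk_left).aestronglyMeasurable

end Freezing

/-! ### Filtration of the iterates and centered noise -/

section Dynamics

set_option linter.unusedSectionVars false

variable {Ω : Type*} [mΩ : MeasurableSpace Ω] {P : Measure Ω} [IsProbabilityMeasure P] {d m : ℕ}
  {X : Ω → Vec d} {ξ : ℕ → Ω → Vec d} {g : Vec d → Vec m → Vec m} {γ : ℕ → ℝ}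
  {θ : ℕ → Ω → Vec m}

/-- The information available after `n` steps. -/
def history (hθ : IsSGD P X ξ g γ θ) : Filtration ℕ mΩ where
  seq n := MeasurableSpace.comap (θ 0) inferInstance ⊔
    ⨆ k ∈ Iio n, MeasurableSpace.comap (ξ (k + 1)) inferInstance
  mono' _ _ h := sup_le_sup_left (biSup_mono fun _ hi => lt_of_lt_of_le hi h) _
  le' _ := sup_le hθ.measurable_init.comap_le
    (iSup₂_le fun k _ => (hθ.measurable_innov (k + 1) (Nat.le_add_left 1 k)).comap_le)

lemma history_indep (hθ : IsSGD P X ξ g γ θ) (n : ℕ) :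
    Indep (history hθ n) (MeasurableSpace.comap (ξ (n + 1)) inferInstance) P := by
  have hξ : ∀ k, Measurable (ξ (k + 1)) := fun k => hθ.measurable_innov (k + 1) (Nat.le_add_left 1 k)
  have hseq : ∀ k, MeasurableSpace.comap (ξ (k + 1)) inferInstance ≤
      MeasurableSpace.comap (fun ω (n : ℕ) => ξ (n + 1) ω) inferInstance := by
    rintro k _ ⟨s, hs, rfl⟩
    exact ⟨(fun f : ℕ → Vec d => f k) ⁻¹' s, measurable_pi_apply k hs, rfl⟩
  refine indep_sup_left hθ.measurable_init.comap_le (iSup₂_le fun k _ => (hξ k).comap_le)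
    (hξ n).comap_le (indep_of_indep_of_le_right hθ.indep_init
      (sup_le (iSup₂_le fun k _ => hseq k) (hseq n))) ?_
  have h1 := indep_iSup_of_disjoint (fun k => (hξ k).comap_le) hθ.indep
    (S := Iio n) (T := {n}) (by simp)
  simpa using h1

lemma indepFun_of_history (hθ : IsSGD P X ξ g γ θ) {S : Type*} [MeasurableSpace S] {Y : Ω → S}
    {n : ℕ} (hY : Measurable[history hθ n] Y) : IndepFun Y (ξ (n + 1)) P :=
  indep_of_indep_of_le_left (history_indep hθ n) hY.comap_le

lemma measurable_innov_history (hθ : IsSGD P X ξ g γ θ) (n : ℕ) :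
    Measurable[history hθ (n + 1)] (ξ (n + 1)) := by
  refine measurable_iff_comap_le.2 (le_trans ?_ le_sup_right)
  exact le_biSup (fun k => MeasurableSpace.comap (ξ (k + 1)) inferInstance) (mem_Iio.2 (Nat.lt_succ_self n))

lemma measurable_iterate (hθ : IsSGD P X ξ g γ θ) (n : ℕ) :
    Measurable[history hθ n] (θ n) := by
  induction n with
  | zero => exact measurable_iff_comap_le.2 le_sup_left
  | succ n ih =>
    have h1 : θ (n + 1) = fun ω => θ n ω - γ (n + 1) • g (ξ (n + 1) ω) (θ n ω) :=
      funext (hθ.step n)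
    rw [h1]
    have h2 : Measurable[history hθ (n + 1)] (θ n) :=
      ih.mono ((history hθ).mono (Nat.le_succ n)) le_rfl
    exact h2.sub ((hθ.measurable_oracle.comp
      (Measurable.prodMk (measurable_innov_history hθ n) h2)).const_smul (γ (n + 1)))

lemma measurable_iterate' (hθ : IsSGD P X ξ g γ θ) (n : ℕ) : Measurable (θ n) :=
  (measurable_iterate hθ n).mono ((history hθ).le n) le_rfl

lemma measurable_meanOracle (hθ : IsSGD P X ξ g γ θ) : Measurable (meanOracle P X g) := by
  have h : StronglyMeasurable fun p : Vec m × Ω => g (X p.2) p.1 :=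
    (hθ.measurable_oracle.comp
      ((hθ.measurable_X.comp measurable_snd).prodMk measurable_fst)).stronglyMeasurable
  exact h.integral_prod_right'.measurable

/-- The centered oracle evaluated by step `k + 1`. -/
noncomputable def noise (P : Measure Ω) (X : Ω → Vec d) (ξ : ℕ → Ω → Vec d) (g : Vec d → Vec m → Vec m)
    (θ : ℕ → Ω → Vec m) (k : ℕ) (ω : Ω) : Vec m :=
  g (ξ (k + 1) ω) (θ k ω) - meanOracle P X g (θ k ω)

lemma measurable_noise (hθ : IsSGD P X ξ g γ θ) (k : ℕ) :
    Measurable[history hθ (k + 1)] (noise P X ξ g θ k) := by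
  have h2 : Measurable[history hθ (k + 1)] (θ k) :=
    (measurable_iterate hθ k).mono ((history hθ).mono (Nat.le_succ k)) le_rfl
  exact (hθ.measurable_oracle.comp
      (Measurable.prodMk (measurable_innov_history hθ k) h2)).sub
    ((measurable_meanOracle hθ).comp h2)

lemma measurable_noise' (hθ : IsSGD P X ξ g γ θ) (k : ℕ) : Measurable (noise P X ξ g θ k) :=
  (measurable_noise hθ k).mono ((history hθ).le _) le_rfl

lemma measurable_oracle_eval (hθ : IsSGD P X ξ g γ θ) (k : ℕ) :
    Measurable fun ω => g (ξ (k + 1) ω) (θ k ω) :=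
  hθ.measurable_oracle.comp
    ((hθ.measurable_innov (k + 1) (Nat.le_add_left 1 k)).prodMk (measurable_iterate' hθ k))

variable {F : Vec m → ℝ} {L α Cg κ c : ℝ}

/-- The noise is orthogonal to the past. -/
lemma integral_inner_noise (hθ : IsSGD P X ξ g γ θ) (h2 : OracleBounds P X F g Cg κ c) {k : ℕ}
    {ψ : Ω → Vec m} (hψ : Measurable[history hθ k] ψ)
    (hint : Integrable (fun ω => inner ℝ (ψ ω) (noise P X ξ g θ k ω)) P) :
    ∫ ω, inner ℝ (ψ ω) (noise P X ξ g θ k ω) ∂P = 0 := by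
  -- Freeze the pair `(ψ, θ k)`, which is determined by the past. The inner integral is then the
  -- inner product of a constant with a centered vector.
  let φ : (Vec m × Vec m) × Vec d → ℝ :=
    fun p => inner ℝ p.1.1 (g p.2 p.1.2 - meanOracle P X g p.1.2)
  have hφ : Measurable φ := by
    have h3 : Measurable fun p : (Vec m × Vec m) × Vec d => g p.2 p.1.2 :=
      hθ.measurable_oracle.comp (measurable_snd.prodMk (measurable_snd.comp measurable_fst))
    have h4 : Measurable fun p : (Vec m × Vec m) × Vec d => meanOracle P X g p.1.2 :=
      (measurable_meanOracle hθ).comp (measurable_snd.comp measurable_fst)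
    exact (measurable_fst.comp measurable_fst).inner (h3.sub h4)
  have hY : Measurable[history hθ k] fun ω => (ψ ω, θ k ω) :=
    Measurable.prodMk hψ (measurable_iterate hθ k)
  have h3 := integral_comp_of_indepFun (hY.mono ((history hθ).le k) le_rfl)
    (hθ.measurable_innov (k + 1) (Nat.le_add_left 1 k)) hθ.measurable_X
    (indepFun_of_history hθ hY) (hθ.identDistrib (k + 1) (Nat.le_add_left 1 k)) hφ hint
  refine h3.trans ?_
  refine integral_eq_zero_of_ae (Eventually.of_forall fun ω => ?_)
  have hg : Integrable (fun ω' => g (X ω') (θ k ω)) P :=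
    (h2.memLp (θ k ω)).integrable one_le_two
  change ∫ ω', inner ℝ (ψ ω) (g (X ω') (θ k ω) - meanOracle P X g (θ k ω)) ∂P = 0
  have h4 := integral_inner (𝕜 := ℝ)
    (f := fun ω' => g (X ω') (θ k ω) - meanOracle P X g (θ k ω))
    (hg.sub (integrable_const _)) (ψ ω)
  rw [h4, integral_sub hg (integrable_const _)]
  simp [meanOracle]

lemma enorm_sq_eq_ofReal {E : Type*} [NormedAddCommGroup E] (x : E) :
    ‖x‖ₑ ^ 2 = ENNReal.ofReal (‖x‖ ^ 2) := by
  rw [← ofReal_norm, ENNReal.ofReal_pow (norm_nonneg _)]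

lemma lintegral_oracle_le (h2 : OracleBounds P X F g Cg κ c) (t : Vec m) :
    ∫⁻ ω, ‖g (X ω) t‖ₑ ^ 2 ∂P ≤ ENNReal.ofReal (Cg * (gap F t + 1)) := by
  simp_rw [enorm_sq_eq_ofReal]
  rw [← ofReal_integral_eq_lintegral_ofReal (h2.memLp t).norm.integrable_sq
    (Eventually.of_forall fun ω => by positivity)]
  exact ENNReal.ofReal_le_ofReal (h2.second_moment t)

/-- Jensen's inequality, in the form of a nonnegative variance for the norm of the oracle. -/
lemma norm_meanOracle_sq_le (h2 : OracleBounds P X F g Cg κ c) (t : Vec m) :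
    ‖meanOracle P X g t‖ ^ 2 ≤ Cg * (gap F t + 1) := by
  refine le_trans ?_ (h2.second_moment t)
  have h3 := (h2.memLp t).norm
  have h4 : ‖meanOracle P X g t‖ ≤ ∫ ω, ‖g (X ω) t‖ ∂P := norm_integral_le_integral_norm _
  have h5 := variance_nonneg (fun ω => ‖g (X ω) t‖) P
  rw [variance_eq_sub h3] at h5
  have h6 : ‖meanOracle P X g t‖ ^ 2 ≤ (∫ ω, ‖g (X ω) t‖ ∂P) ^ 2 := by gcongr
  simp only [Pi.pow_apply] at h5
  linarith

/-- Conditional second moment bound for the oracle, against a nonnegative weight. -/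
lemma lintegral_mul_oracle_le (hθ : IsSGD P X ξ g γ θ) (h2 : OracleBounds P X F g Cg κ c) {k : ℕ}
    {h : Ω → ENNReal} (hh : Measurable[history hθ k] h) :
    ∫⁻ ω, h ω * ‖g (ξ (k + 1) ω) (θ k ω)‖ₑ ^ 2 ∂P ≤
      ∫⁻ ω, h ω * ENNReal.ofReal (Cg * (gap F (θ k ω) + 1)) ∂P := by
  have hY : Measurable[history hθ k] fun ω => (h ω, θ k ω) :=
    Measurable.prodMk hh (measurable_iterate hθ k)
  have hφ : Measurable fun p : (ENNReal × Vec m) × Vec d => p.1.1 * ‖g p.2 p.1.2‖ₑ ^ 2 := by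
    have h3 : Measurable fun p : (ENNReal × Vec m) × Vec d => g p.2 p.1.2 :=
      hθ.measurable_oracle.comp (measurable_snd.prodMk (measurable_snd.comp measurable_fst))
    exact (measurable_fst.comp measurable_fst).mul (h3.enorm.pow_const 2)
  have h3 := lintegral_comp_of_indepFun (hY.mono ((history hθ).le k) le_rfl)
    (hθ.measurable_innov (k + 1) (Nat.le_add_left 1 k)) hθ.measurable_X
    (indepFun_of_history hθ hY) (hθ.identDistrib (k + 1) (Nat.le_add_left 1 k)) hφ
  refine h3.le.trans (lintegral_mono fun ω => ?_)
  simp only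
  have hm : Measurable fun ω' => ‖g (X ω') (θ k ω)‖ₑ ^ 2 :=
    (hθ.measurable_oracle.comp (hθ.measurable_X.prodMk measurable_const)).enorm.pow_const 2
  rw [lintegral_const_mul _ hm]
  gcongr
  exact lintegral_oracle_le h2 _

/-- From `‖a - b‖² ≤ 2‖a‖² + 2‖b‖²`, with both the oracle and its mean controlled by the second
moment bound; this is the origin of the factor `4`. -/
lemma lintegral_mul_noise_le (hθ : IsSGD P X ξ g γ θ) (h1 : HolderSmooth F L α)
    (h2 : OracleBounds P X F g Cg κ c) {k : ℕ}
    {h : Ω → ENNReal} (hh : Measurable[history hθ k] h) :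
    ∫⁻ ω, h ω * ‖noise P X ξ g θ k ω‖ₑ ^ 2 ∂P ≤
      ∫⁻ ω, h ω * ENNReal.ofReal (4 * Cg * (gap F (θ k ω) + 1)) ∂P := by
  have hh' : Measurable h := hh.mono ((history hθ).le k) le_rfl
  have hgap : Measurable fun ω => gap F (θ k ω) :=
    h1.continuous_gap.measurable.comp (measurable_iterate' hθ k)
  have hm1 : Measurable fun ω => h ω * ENNReal.ofReal (2 * Cg * (gap F (θ k ω) + 1)) :=
    hh'.mul ((hgap.add_const 1).const_mul _).ennreal_ofReal
  have hpt : ∀ ω, h ω * ‖noise P X ξ g θ k ω‖ₑ ^ 2 ≤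
      2 * (h ω * ‖g (ξ (k + 1) ω) (θ k ω)‖ₑ ^ 2) +
        h ω * ENNReal.ofReal (2 * Cg * (gap F (θ k ω) + 1)) := by
    intro ω
    have h3 : ‖noise P X ξ g θ k ω‖ₑ ^ 2 ≤ 2 * ‖g (ξ (k + 1) ω) (θ k ω)‖ₑ ^ 2 +
        ENNReal.ofReal (2 * Cg * (gap F (θ k ω) + 1)) := by
      have e : ∀ a : ℝ, (2 : ENNReal) * ENNReal.ofReal a = ENNReal.ofReal (2 * a) := fun a => by
        rw [ENNReal.ofReal_mul two_pos.le, ENNReal.ofReal_ofNat]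
      rw [enorm_sq_eq_ofReal, enorm_sq_eq_ofReal, e, ← ENNReal.ofReal_add (by positivity)
          (by have := h2.C_pos; have := h1.gap_nonneg (θ k ω); positivity)]
      refine ENNReal.ofReal_le_ofReal ?_
      have h4 := norm_meanOracle_sq_le h2 (θ k ω)
      have h5 := norm_sub_le (g (ξ (k + 1) ω) (θ k ω)) (meanOracle P X g (θ k ω))
      have h6 : ‖noise P X ξ g θ k ω‖ ≤
        ‖g (ξ (k + 1) ω) (θ k ω)‖ + ‖meanOracle P X g (θ k ω)‖ := h5
      nlinarith [sq_nonneg (‖g (ξ (k + 1) ω) (θ k ω)‖ - ‖meanOracle P X g (θ k ω)‖),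
        norm_nonneg (noise P X ξ g θ k ω)]
    calc _ ≤ h ω * (2 * ‖g (ξ (k + 1) ω) (θ k ω)‖ₑ ^ 2 +
        ENNReal.ofReal (2 * Cg * (gap F (θ k ω) + 1))) := by gcongr
      _ = _ := by ring
  refine (lintegral_mono hpt).trans ?_
  have hm2 : Measurable fun ω => h ω * ‖g (ξ (k + 1) ω) (θ k ω)‖ₑ ^ 2 :=
    hh'.mul ((measurable_oracle_eval hθ k).enorm.pow_const 2)
  rw [lintegral_add_right _ hm1, lintegral_const_mul _ hm2]
  have h3 := lintegral_mul_oracle_le hθ h2 hh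
  calc _ ≤ 2 * ∫⁻ ω, h ω * ENNReal.ofReal (Cg * (gap F (θ k ω) + 1)) ∂P +
        ∫⁻ ω, h ω * ENNReal.ofReal (2 * Cg * (gap F (θ k ω) + 1)) ∂P := by gcongr
    _ = ∫⁻ ω, (2 * (h ω * ENNReal.ofReal (Cg * (gap F (θ k ω) + 1))) +
        h ω * ENNReal.ofReal (2 * Cg * (gap F (θ k ω) + 1))) ∂P := by
        rw [lintegral_add_right _ hm1, lintegral_const_mul]
        exact hh'.mul ((hgap.add_const 1).const_mul _).ennreal_ofReal
    _ ≤ _ := by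
        refine lintegral_mono fun ω => le_of_eq ?_
        have hC := h2.C_pos
        have hg := h1.gap_nonneg (θ k ω)
        have e : 4 * Cg * (gap F (θ k ω) + 1) =
            2 * (Cg * (gap F (θ k ω) + 1)) + 2 * Cg * (gap F (θ k ω) + 1) := by ring
        rw [e, ENNReal.ofReal_add (by positivity) (by positivity),
          ENNReal.ofReal_mul (p := 2) (by norm_num), ENNReal.ofReal_ofNat]
        ring

end Dynamics

/-! ### Energy estimates and almost sure behaviour -/

/-- By Tonelli the sum has finite mean, so it is finite almost everywhere. -/
lemma ae_summable_of_sum_integral_le {Ω : Type*} {mΩ : MeasurableSpace Ω} {P : Measure Ω}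
    {f : ℕ → Ω → ℝ} (hf : ∀ k, Integrable (f k) P) (h0 : ∀ k ω, 0 ≤ f k ω) {C : ℝ}
    (hC : ∀ n, ∑ k ∈ Finset.range n, ∫ ω, f k ω ∂P ≤ C) :
    ∀ᵐ ω ∂P, Summable fun k => f k ω := by
  have h1 : ∫⁻ ω, ∑' k, ENNReal.ofReal (f k ω) ∂P ≤ ENNReal.ofReal C := by
    rw [lintegral_tsum fun k => (hf k).aemeasurable.ennreal_ofReal]
    refine ENNReal.tsum_le_of_sum_range_le fun n => ?_
    simp_rw [← ofReal_integral_eq_lintegral_ofReal (hf _) (Eventually.of_forall (h0 _))]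
    rw [← ENNReal.ofReal_sum_of_nonneg fun k _ => integral_nonneg (h0 k)]
    exact ENNReal.ofReal_le_ofReal (hC n)
  have h2 : AEMeasurable (fun ω => ∑' k, ENNReal.ofReal (f k ω)) P :=
    AEMeasurable.tsum fun k => (hf k).aemeasurable.ennreal_ofReal
  filter_upwards [ae_lt_top' h2 (ne_top_of_le_ne_top ENNReal.ofReal_ne_top h1)] with ω hω
  have h3 := ENNReal.summable_toReal hω.ne
  simpa [ENNReal.toReal_ofReal (h0 _ ω)] using h3

/-- A perturbed descent recursion with summable weighted squared gradients and convergent noise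
has vanishing gradients. -/
lemma tendsto_gradient_zero {E : Type*} [NormedAddCommGroup E] [NormedSpace ℝ E]
    {t b D : ℕ → E} {Γ : ℕ → ℝ} {G : E → E} {L α c : ℝ} (hα : 0 < α) (hc : 0 ≤ c)
    (hΓ : ∀ k, 0 ≤ Γ k) (hdiv : Tendsto (fun n => ∑ k ∈ Finset.range n, Γ k) atTop atTop)
    (hstep : ∀ k, t (k + 1) = t k - Γ k • b k - Γ k • D k)
    (hb : ∀ k, ‖b k‖ ≤ c * ‖G (t k)‖) (hG : ∀ x y, ‖G y - G x‖ ≤ L * ‖y - x‖ ^ α)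
    (hL : 0 ≤ L) (hsum : Summable fun k => Γ k * ‖G (t k)‖ ^ 2)
    (hD : CauchySeq fun n => ∑ k ∈ Finset.range n, Γ k • D k) :
    Tendsto (fun k => G (t k)) atTop (𝓝 0) := by
  have hdisp : ∀ n k, n ≤ k → t k - t n =
      -(∑ j ∈ Finset.Ico n k, Γ j • b j) - ∑ j ∈ Finset.Ico n k, Γ j • D j := by
    intro n k hk
    rw [← Finset.sum_Ico_sub t hk, ← Finset.sum_neg_distrib, ← Finset.sum_sub_distrib]
    refine Finset.sum_congr rfl fun j _ => ?_
    rw [hstep j]; abel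
  refine Metric.tendsto_atTop.2 fun ε hε => ?_
  set η := ε / 3 with hη
  have hη0 : 0 < η := by positivity
  -- A displacement of at most `δ` changes the gradient by at most `ε / 3`.
  obtain ⟨δ, hδ0, hδ⟩ : ∃ δ > 0, L * δ ^ α ≤ η := by
    have h1 : Continuous fun x : ℝ => L * x ^ α :=
      continuous_const.mul (continuous_id.rpow_const fun _ => Or.inr hα.le)
    have h2 := h1.tendsto 0
    simp only [Real.zero_rpow hα.ne', mul_zero] at h2
    have h3 := (h2.mono_left (nhdsWithin_le_nhds (s := Ioi 0))).eventually (eventually_lt_nhds hη0)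
    obtain ⟨δ, hδ, hδ0⟩ := (h3.and self_mem_nhdsWithin).exists
    exact ⟨δ, hδ0, hδ.le⟩
  obtain ⟨N₁, hN₁⟩ := Metric.cauchySeq_iff.1 hD (δ / 2) (by positivity)
  obtain ⟨N₂, hN₂⟩ := Metric.cauchySeq_iff.1 hsum.hasSum.tendsto_sum_nat.cauchySeq
    (η * δ / (2 * (c + 1))) (by positivity)
  refine ⟨max N₁ N₂, fun n hn => ?_⟩
  rw [dist_zero_right]
  by_contra! hlt
  have hn1 : N₁ ≤ n := (le_max_left _ _).trans hn
  have hn2 : N₂ ≤ n := (le_max_right _ _).trans hn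
  -- If the gradient stayed above `η`, then `Γ ≤ η⁻² Γ ‖G‖²` would be summable, against the
  -- divergence of the steps.
  have hex : ∃ k, n ≤ k ∧ ‖G (t k)‖ ≤ η := by
    by_contra! hall
    have h1 : Summable fun k => Γ k := by
      refine Summable.of_norm_bounded_eventually_nat (hsum.mul_left (1 / η ^ 2)) ?_
      filter_upwards [eventually_ge_atTop n] with k hk
      rw [Real.norm_of_nonneg (hΓ k)]
      have h2 : η ^ 2 ≤ ‖G (t k)‖ ^ 2 := by
        have := hall k hk
        gcongr
      have h3 := mul_le_mul_of_nonneg_left h2 (hΓ k)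
      rw [one_div, inv_mul_eq_div, le_div_iff₀ (by positivity)]
      exact h3
    exact not_tendsto_atTop_of_tendsto_nhds h1.hasSum.tendsto_sum_nat hdiv
  classical
  obtain ⟨hk1, hk2⟩ := Nat.find_spec hex
  -- At the first return below `η`, all earlier gradients from `n` on exceed `η`. Hence `‖G‖ ≤ ‖G‖²
  -- / η` there, and the drift travels at most `δ / 2`; the noise does too, being Cauchy. So `‖G (t
  -- n)‖ ≤ 2 ε / 3`, a contradiction.
  set k := Nat.find hex with hk
  have hbig : ∀ j ∈ Finset.Ico n k, η ≤ ‖G (t j)‖ := by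
    intro j hj
    have h1 := Finset.mem_Ico.1 hj
    have := Nat.find_min hex h1.2
    push Not at this
    exact (this h1.1).le
  have h1 : ‖∑ j ∈ Finset.Ico n k, Γ j • D j‖ ≤ δ / 2 := by
    have := hN₁ k (hn1.trans hk1) n hn1
    rw [dist_eq_norm, ← Finset.sum_Ico_eq_sub _ hk1] at this
    exact this.le
  have h2 : ∑ j ∈ Finset.Ico n k, Γ j * ‖G (t j)‖ ^ 2 ≤ η * δ / (2 * (c + 1)) := by
    have := hN₂ k (hn2.trans hk1) n hn2
    rw [Real.dist_eq, ← Finset.sum_Ico_eq_sub _ hk1] at this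
    exact (le_abs_self _).trans this.le
  have h3 : ‖∑ j ∈ Finset.Ico n k, Γ j • b j‖ ≤ δ / 2 := by
    calc _ ≤ ∑ j ∈ Finset.Ico n k, (c / η) * (Γ j * ‖G (t j)‖ ^ 2) := by
          refine norm_sum_le_of_le _ fun j hj => ?_
          rw [norm_smul, Real.norm_of_nonneg (hΓ j)]
          have h4 : ‖G (t j)‖ ≤ ‖G (t j)‖ ^ 2 / η := by
            rw [le_div_iff₀ hη0, pow_two]
            exact mul_le_mul_of_nonneg_left (hbig j hj) (norm_nonneg _)
          calc Γ j * ‖b j‖ ≤ Γ j * (c * (‖G (t j)‖ ^ 2 / η)) :=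
                mul_le_mul_of_nonneg_left ((hb j).trans (mul_le_mul_of_nonneg_left h4 hc)) (hΓ j)
            _ = _ := by ring
      _ ≤ (c / η) * (η * δ / (2 * (c + 1))) := by
          rw [← Finset.mul_sum]
          exact mul_le_mul_of_nonneg_left h2 (by positivity)
      _ = (c / (c + 1)) * (δ / 2) := by field_simp
      _ ≤ _ := mul_le_of_le_one_left (by positivity) ((div_le_one (by positivity)).2 (by linarith))
  have h4 : ‖t k - t n‖ ≤ δ := by
    rw [hdisp n k hk1]
    refine (norm_sub_le _ _).trans ?_
    rw [norm_neg]; linarith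
  have h5 : ‖G (t n)‖ ≤ ‖G (t k)‖ + L * δ ^ α := by
    have h6 := hG (t k) (t n)
    rw [norm_sub_rev (t n)] at h6
    have h7 := mul_le_mul_of_nonneg_left (Real.rpow_le_rpow (norm_nonneg _) h4 hα.le) hL
    have h8 := norm_sub_norm_le (G (t n)) (G (t k))
    linarith
  linarith

/-! ### Energy balance of one step and integrability -/

section Dynamics

set_option linter.unusedSectionVars false

variable {Ω : Type*} [mΩ : MeasurableSpace Ω] {P : Measure Ω} [IsProbabilityMeasure P] {d m : ℕ}
  {X : Ω → Vec d} {ξ : ℕ → Ω → Vec d} {g : Vec d → Vec m → Vec m} {γ : ℕ → ℝ}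
  {θ : ℕ → Ω → Vec m} {F : Vec m → ℝ} {L α Cg κ c : ℝ}

lemma step_eq (hθ : IsSGD P X ξ g γ θ) (k : ℕ) (ω : Ω) :
    θ (k + 1) ω = θ k ω - γ (k + 1) • meanOracle P X g (θ k ω) -
      γ (k + 1) • noise P X ξ g θ k ω := by
  rw [hθ.step, noise, smul_sub]; abel

/-- One-step energy inequality. -/
lemma gap_step (hθ : IsSGD P X ξ g γ θ) (h1 : HolderSmooth F L α)
    (h2 : OracleBounds P X F g Cg κ c) {k : ℕ} (hγ : 0 ≤ γ (k + 1)) (ω : Ω) :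
    gap F (θ (k + 1) ω) ≤ gap F (θ k ω) - κ * γ (k + 1) * ‖gradient F (θ k ω)‖ ^ 2 -
      γ (k + 1) * inner ℝ (gradient F (θ k ω)) (noise P X ξ g θ k ω) +
      L * γ (k + 1) ^ (1 + α) * (1 + ‖g (ξ (k + 1) ω) (θ k ω)‖ ^ 2) := by
  have hα := h1.α_pos
  have hL := h1.L_pos
  set G := gradient F (θ k ω)
  set v := g (ξ (k + 1) ω) (θ k ω) with hv
  have h3 := h1.descent (θ k ω) (-(γ (k + 1) • v))
  rw [← sub_eq_add_neg, hv, ← hθ.step, ← hv, inner_neg_right, inner_smul_right, norm_neg,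
    norm_smul, Real.norm_of_nonneg hγ, Real.mul_rpow hγ (norm_nonneg _)] at h3
  have h4 : inner ℝ G v = inner ℝ (meanOracle P X g (θ k ω)) G +
      inner ℝ G (noise P X ξ g θ k ω) := by
    rw [noise, inner_sub_right, real_inner_comm G (meanOracle P X g (θ k ω))]; ring
  have h5 := mul_le_mul_of_nonneg_left (h2.lower (θ k ω)) hγ
  -- Only the second moment of the oracle is controlled, and `1 + α ≤ 2`.
  have h6 : ‖v‖ ^ (1 + α) ≤ 1 + ‖v‖ ^ 2 := by
    rcases le_total ‖v‖ 1 with h | h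
    · have := Real.rpow_le_one (norm_nonneg v) h (by linarith : 0 ≤ 1 + α)
      nlinarith [sq_nonneg ‖v‖]
    · have : ‖v‖ ^ (1 + α) ≤ ‖v‖ ^ (2 : ℝ) :=
        Real.rpow_le_rpow_of_exponent_le h (by linarith [h1.α_le_one])
      rw [Real.rpow_two] at this
      linarith
  have hp := Real.rpow_nonneg hγ (1 + α)
  have h7 : L / (1 + α) * (γ (k + 1) ^ (1 + α) * ‖v‖ ^ (1 + α)) ≤
      L * (γ (k + 1) ^ (1 + α) * (1 + ‖v‖ ^ 2)) := by
    have : L / (1 + α) ≤ L := div_le_self hL.le (by linarith)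
    gcongr
  rw [h4] at h3
  simp only [gap]
  linarith

lemma measurable_gap (hθ : IsSGD P X ξ g γ θ) (h1 : HolderSmooth F L α) (k : ℕ) :
    Measurable[history hθ k] fun ω => gap F (θ k ω) :=
  h1.continuous_gap.measurable.comp (measurable_iterate hθ k)

lemma measurable_gradient (hθ : IsSGD P X ξ g γ θ) (h1 : HolderSmooth F L α) (k : ℕ) :
    Measurable[history hθ k] fun ω => gradient F (θ k ω) :=
  h1.continuous_gradient.measurable.comp (measurable_iterate hθ k)

lemma measurable_gradient' (hθ : IsSGD P X ξ g γ θ) (h1 : HolderSmooth F L α) (k : ℕ) :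
    Measurable fun ω => gradient F (θ k ω) :=
  (measurable_gradient hθ h1 k).mono ((history hθ).le k) le_rfl

lemma memLp_two_of_lintegral_le {E : Type*} [NormedAddCommGroup E] [MeasurableSpace E]
    {f : Ω → E} (hf : AEStronglyMeasurable f P) {C : ENNReal} (hC : C ≠ ⊤)
    (h : ∫⁻ ω, ‖f ω‖ₑ ^ 2 ∂P ≤ C) : MemLp f 2 P := by
  refine ⟨hf, ?_⟩
  rw [eLpNorm_lt_top_iff_lintegral_rpow_enorm_lt_top (by norm_num) (by norm_num)]
  simpa using lt_of_le_of_lt h hC.lt_top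

section OneStep

variable {k : ℕ}

lemma lintegral_gap_ne_top
    (hk : Integrable (fun ω => gap F (θ k ω)) P) {C : ℝ} :
    ∫⁻ ω, ENNReal.ofReal (C * (gap F (θ k ω) + 1)) ∂P ≠ ⊤ :=
  ((hk.add (integrable_const 1)).const_mul C).lintegral_lt_top.ne

lemma memLp_oracle (hθ : IsSGD P X ξ g γ θ)
    (h2 : OracleBounds P X F g Cg κ c) (hk : Integrable (fun ω => gap F (θ k ω)) P) :
    MemLp (fun ω => g (ξ (k + 1) ω) (θ k ω)) 2 P := by
  refine memLp_two_of_lintegral_le (measurable_oracle_eval hθ k).aestronglyMeasurable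
    (lintegral_gap_ne_top hk (C := Cg)) ?_
  simpa using lintegral_mul_oracle_le hθ h2 (k := k) (h := fun _ => 1) measurable_const

lemma memLp_noise (hθ : IsSGD P X ξ g γ θ) (h1 : HolderSmooth F L α)
    (h2 : OracleBounds P X F g Cg κ c) (hk : Integrable (fun ω => gap F (θ k ω)) P) :
    MemLp (noise P X ξ g θ k) 2 P := by
  refine memLp_two_of_lintegral_le (measurable_noise' hθ k).aestronglyMeasurable
    (lintegral_gap_ne_top hk (C := 4 * Cg)) ?_
  simpa using lintegral_mul_noise_le hθ h1 h2 (k := k) (h := fun _ => 1) measurable_const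

lemma memLp_gradient (hθ : IsSGD P X ξ g γ θ) (h1 : HolderSmooth F L α)
    (hk : Integrable (fun ω => gap F (θ k ω)) P) :
    MemLp (fun ω => gradient F (θ k ω)) 2 P := by
  obtain ⟨C, hC, h⟩ := h1.norm_gradient_sq_le
  rw [memLp_two_iff_integrable_sq_norm (measurable_gradient' hθ h1 k).aestronglyMeasurable]
  refine ((hk.add (integrable_const 1)).const_mul C).mono'
    ((measurable_gradient' hθ h1 k).norm.pow_const 2).aestronglyMeasurable
    (Eventually.of_forall fun ω => ?_)
  rw [Real.norm_of_nonneg (by positivity)]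
  exact h _

lemma integrable_inner_noise (hθ : IsSGD P X ξ g γ θ) (h1 : HolderSmooth F L α)
    (h2 : OracleBounds P X F g Cg κ c) (hk : Integrable (fun ω => gap F (θ k ω)) P)
    {ψ : Ω → Vec m} (hψ : MemLp ψ 2 P) :
    Integrable (fun ω => inner ℝ (ψ ω) (noise P X ξ g θ k ω)) P := by
  have h3 := memLp_noise hθ h1 h2 hk
  refine ((hψ.norm.integrable_sq).add h3.norm.integrable_sq).mono'
    (hψ.1.inner h3.1) (Eventually.of_forall fun ω => ?_)
  have h4 := abs_real_inner_le_norm (ψ ω) (noise P X ξ g θ k ω)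
  rw [Real.norm_eq_abs]
  simp only [Pi.add_apply]
  nlinarith [sq_nonneg (‖ψ ω‖ - ‖noise P X ξ g θ k ω‖), norm_nonneg (ψ ω),
    norm_nonneg (noise P X ξ g θ k ω)]

end OneStep

/-- Induction on the time: an integrable gap makes gradient, noise and oracle square integrable at
that time, and `gap_step` then dominates the next gap. -/
lemma integrable_gap (hθ : IsSGD P X ξ g γ θ) (h1 : HolderSmooth F L α)
    (h2 : OracleBounds P X F g Cg κ c) (h3 : RobbinsMonro γ α) (k : ℕ) :
    Integrable (fun ω => gap F (θ k ω)) P := by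
  induction k with
  | zero =>
    obtain ⟨C, -, h⟩ := h1.gap_le
    refine (((integrable_const 1).add hθ.memLp_init.norm.integrable_sq).const_mul C).mono'
      ((measurable_gap hθ h1 0).mono ((history hθ).le 0) le_rfl).aestronglyMeasurable
      (Eventually.of_forall fun ω => ?_)
    rw [Real.norm_of_nonneg (h1.gap_nonneg _)]
    exact h _
  | succ k ih =>
    have hm := ((measurable_gap hθ h1 (k + 1)).mono
      ((history hθ).le (k + 1)) le_rfl).aestronglyMeasurable (μ := P)
    refine (((ih.sub ((memLp_gradient hθ h1 ih).norm.integrable_sq.const_mul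
      (κ * γ (k + 1)))).sub ((integrable_inner_noise hθ h1 h2 ih
        (memLp_gradient hθ h1 ih)).const_mul (γ (k + 1)))).add
      (((integrable_const 1).add (memLp_oracle hθ h2 ih).norm.integrable_sq).const_mul
        (L * γ (k + 1) ^ (1 + α)))).mono' hm (Eventually.of_forall fun ω => ?_)
    rw [Real.norm_of_nonneg (h1.gap_nonneg _)]
    exact gap_step hθ h1 h2 (h3.pos (k + 1) (Nat.le_add_left 1 k)).le ω

/-- The conditional second moment bound tested on an indicator. This requires the event to be
determined by the past. -/
lemma integral_oracle_sq_le (hθ : IsSGD P X ξ g γ θ) (h1 : HolderSmooth F L α)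
    (h2 : OracleBounds P X F g Cg κ c) {k : ℕ} (hk : Integrable (fun ω => gap F (θ k ω)) P)
    {S : Set Ω} (hS : MeasurableSet[history hθ k] S) :
    ∫ ω in S, ‖g (ξ (k + 1) ω) (θ k ω)‖ ^ 2 ∂P ≤ ∫ ω in S, Cg * (gap F (θ k ω) + 1) ∂P := by
  have hS' := (history hθ).le k S hS
  have h3 := lintegral_mul_oracle_le hθ h2 (k := k) (h := S.indicator fun _ => 1)
    ((show Measurable[history hθ k] fun _ : Ω => (1 : ENNReal) from measurable_const).indicator hS)
  have e : ∀ f : Ω → ENNReal, ∫⁻ ω, S.indicator (fun _ => 1) ω * f ω ∂P = ∫⁻ ω in S, f ω ∂P := by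
    intro f
    rw [← lintegral_indicator hS']
    refine lintegral_congr fun ω => ?_
    by_cases h : ω ∈ S <;> simp [h]
  rw [e, e] at h3
  have hint := (memLp_oracle hθ h2 hk).norm.integrable_sq
  have hint2 : Integrable (fun ω => Cg * (gap F (θ k ω) + 1)) P :=
    (hk.add (integrable_const 1)).const_mul Cg
  simp_rw [enorm_sq_eq_ofReal] at h3
  rw [← ofReal_integral_eq_lintegral_ofReal hint.integrableOn
      (Eventually.of_forall fun ω => by positivity),
    ← ofReal_integral_eq_lintegral_ofReal hint2.integrableOn (Eventually.of_forall fun ω =>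
      mul_nonneg h2.C_pos.le (by linarith [h1.gap_nonneg (θ k ω)]))] at h3
  exact (ENNReal.ofReal_le_ofReal_iff (integral_nonneg fun ω =>
    mul_nonneg h2.C_pos.le (by linarith [h1.gap_nonneg (θ k ω)]))).1 h3

/-- Integrated energy inequality on an arbitrary event. -/
lemma setIntegral_gap_step (hθ : IsSGD P X ξ g γ θ) (h1 : HolderSmooth F L α)
    (h2 : OracleBounds P X F g Cg κ c) (h3 : RobbinsMonro γ α) (k : ℕ) (A : Set Ω) :
    ∫ ω in A, gap F (θ (k + 1) ω) ∂P + κ * γ (k + 1) * ∫ ω in A, ‖gradient F (θ k ω)‖ ^ 2 ∂P ≤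
      ∫ ω in A, gap F (θ k ω) ∂P -
      γ (k + 1) * ∫ ω in A, inner ℝ (gradient F (θ k ω)) (noise P X ξ g θ k ω) ∂P +
      L * γ (k + 1) ^ (1 + α) * (P.real A + ∫ ω in A, ‖g (ξ (k + 1) ω) (θ k ω)‖ ^ 2 ∂P) := by
  have hk := integrable_gap hθ h1 h2 h3 k
  have hk1 := (integrable_gap hθ h1 h2 h3 (k + 1)).integrableOn (s := A)
  have i1 := hk.integrableOn (s := A)
  have i2 := (memLp_gradient hθ h1 hk).norm.integrable_sq.integrableOn (s := A)
  have i3 := (integrable_inner_noise hθ h1 h2 hk (memLp_gradient hθ h1 hk)).integrableOn (s := A)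
  have i4 := (memLp_oracle hθ h2 hk).norm.integrable_sq.integrableOn (s := A)
  have i5 : IntegrableOn (fun _ : Ω => (1 : ℝ)) A P := (integrable_const 1).integrableOn
  have h4 := integral_mono (μ := P.restrict A) (hk1)
    (((i1.sub (i2.const_mul (κ * γ (k + 1)))).sub (i3.const_mul (γ (k + 1)))).add
      ((i5.add i4).const_mul (L * γ (k + 1) ^ (1 + α))))
    (fun ω => gap_step hθ h1 h2 (h3.pos (k + 1) (Nat.le_add_left 1 k)).le ω)
  have e1 := integral_add (μ := P.restrict A)
    ((i1.sub (i2.const_mul (κ * γ (k + 1)))).sub (i3.const_mul (γ (k + 1))))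
      ((i5.add i4).const_mul (L * γ (k + 1) ^ (1 + α)))
  have e2 := integral_sub (μ := P.restrict A) (i1.sub (i2.const_mul (κ * γ (k + 1))))
    (i3.const_mul (γ (k + 1)))
  have e3 := integral_sub (μ := P.restrict A) i1 (i2.const_mul (κ * γ (k + 1)))
  have e4 := integral_add (μ := P.restrict A) i5 i4
  simp only [Pi.add_apply, Pi.sub_apply, integral_const_mul] at h4 e1 e2 e3 e4
  rw [integral_const, smul_eq_mul, mul_one, measureReal_restrict_apply_univ] at e4
  rw [e1, e2, e3, e4] at h4
  linarith

lemma setIntegral_inner_noise (hθ : IsSGD P X ξ g γ θ) (h1 : HolderSmooth F L α)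
    (h2 : OracleBounds P X F g Cg κ c) {k : ℕ} (hk : Integrable (fun ω => gap F (θ k ω)) P)
    {ψ : Ω → Vec m} (hψm : Measurable[history hθ k] ψ) (hψ : MemLp ψ 2 P)
    {S : Set Ω} (hS : MeasurableSet[history hθ k] S) :
    ∫ ω in S, inner ℝ (ψ ω) (noise P X ξ g θ k ω) ∂P = 0 := by
  have hS' := (history hθ).le k S hS
  rw [← integral_indicator hS']
  have e : S.indicator (fun ω => inner ℝ (ψ ω) (noise P X ξ g θ k ω)) =
      fun ω => inner ℝ (S.indicator ψ ω) (noise P X ξ g θ k ω) := by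
    funext ω
    by_cases h : ω ∈ S <;> simp [h]
  rw [e]
  refine integral_inner_noise hθ h2 (hψm.indicator hS) ?_
  exact integrable_inner_noise hθ h1 h2 hk (hψ.indicator hS')

end Dynamics

/-- Eventually `γ ≤ 1`, and then `γ² ≤ γ^(1+α)` because `1 + α ≤ 2`. -/
lemma RobbinsMonro.summable_sq {γ : ℕ → ℝ} {α : ℝ} (h : RobbinsMonro γ α) (hα0 : 0 < α)
    (hα : α ≤ 1) : Summable fun n => γ (n + 1) ^ 2 := by
  have h0 : ∀ n, 0 < γ (n + 1) := fun n => h.pos (n + 1) (Nat.le_add_left 1 n)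
  refine Summable.of_norm_bounded_eventually_nat h.summable ?_
  have h1 := h.summable.tendsto_atTop_zero
  filter_upwards [h1.eventually (eventually_lt_nhds one_pos)] with n hn
  rw [Real.norm_of_nonneg (sq_nonneg _), ← Real.rpow_two]
  have h2 : γ (n + 1) ≤ 1 := by
    by_contra! hgt
    exact absurd hn (not_lt.2 (Real.one_le_rpow hgt.le (by linarith)))
  exact Real.rpow_le_rpow_of_exponent_ge (h0 n) h2 (by linarith)

/-! ### Uniform energy bounds, orthogonality of the noise, almost sure convergence of energies and
gradients -/

section Dynamics

set_option linter.unusedSectionVars false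

variable {Ω : Type*} [mΩ : MeasurableSpace Ω] {P : Measure Ω} [IsProbabilityMeasure P] {d m : ℕ}
  {X : Ω → Vec d} {ξ : ℕ → Ω → Vec d} {g : Vec d → Vec m → Vec m} {γ : ℕ → ℝ}
  {θ : ℕ → Ω → Vec m} {F : Vec m → ℝ} {L α Cg κ c : ℝ}

/-- Growth factors of the mean energy. -/
noncomputable def growth (γ : ℕ → ℝ) (α B : ℝ) (n : ℕ) : ℝ :=
  ∏ k ∈ Finset.range n, (1 + B * γ (k + 1) ^ (1 + α))

section growth

variable {B : ℝ}

lemma growth_succ (n : ℕ) :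
    growth γ α B (n + 1) = growth γ α B n * (1 + B * γ (n + 1) ^ (1 + α)) :=
  Finset.prod_range_succ _ _

lemma one_le_growth (h3 : RobbinsMonro γ α) (hB : 0 ≤ B) (n : ℕ) : 1 ≤ growth γ α B n := by
  induction n with
  | zero => simp [growth]
  | succ n ih =>
    have := mul_nonneg hB (Real.rpow_nonneg (h3.pos (n + 1) (Nat.le_add_left 1 n)).le (1 + α))
    rw [growth_succ]
    exact one_le_mul_of_one_le_of_one_le ih (by linarith)

lemma exists_growth_le (h3 : RobbinsMonro γ α) (hB : 0 ≤ B) :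
    ∃ M, ∀ n, growth γ α B n ≤ M := by
  refine ⟨Real.exp (B * ∑' k, γ (k + 1) ^ (1 + α)), fun n => ?_⟩
  have h0 : ∀ k, 0 ≤ γ (k + 1) ^ (1 + α) := fun k =>
    Real.rpow_nonneg (h3.pos (k + 1) (Nat.le_add_left 1 k)).le (1 + α)
  calc growth γ α B n ≤ ∏ k ∈ Finset.range n, Real.exp (B * γ (k + 1) ^ (1 + α)) :=
        Finset.prod_le_prod (fun k _ => by have := mul_nonneg hB (h0 k); linarith)
          fun k _ => by linarith [Real.add_one_le_exp (B * γ (k + 1) ^ (1 + α))]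
    _ = Real.exp (B * ∑ k ∈ Finset.range n, γ (k + 1) ^ (1 + α)) := by
        rw [← Real.exp_sum, Finset.mul_sum]
    _ ≤ _ := Real.exp_le_exp.2 (mul_le_mul_of_nonneg_left
        (h3.summable.sum_le_tsum _ fun k _ => h0 k) hB)

lemma monotone_growth (h3 : RobbinsMonro γ α) (hB : 0 ≤ B) : Monotone (growth γ α B) :=
  monotone_nat_of_le_succ fun n => by
    have := mul_nonneg hB (Real.rpow_nonneg (h3.pos (n + 1) (Nat.le_add_left 1 n)).le (1 + α))
    rw [growth_succ]
    exact le_mul_of_one_le_right (zero_le_one.trans (one_le_growth h3 hB n)) (by linarith)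

end growth

/-- One-step energy growth on past events. -/
lemma setIntegral_gap_succ_le (hθ : IsSGD P X ξ g γ θ) (h1 : HolderSmooth F L α)
    (h2 : OracleBounds P X F g Cg κ c) (h3 : RobbinsMonro γ α) (k : ℕ) {S : Set Ω}
    (hS : MeasurableSet[history hθ k] S) :
    ∫ ω in S, (gap F (θ (k + 1) ω) + 1) ∂P +
        κ * γ (k + 1) * ∫ ω in S, ‖gradient F (θ k ω)‖ ^ 2 ∂P ≤
      (1 + L * (1 + Cg) * γ (k + 1) ^ (1 + α)) * ∫ ω in S, (gap F (θ k ω) + 1) ∂P := by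
  have hk := integrable_gap hθ h1 h2 h3 k
  have hk1 := integrable_gap hθ h1 h2 h3 (k + 1)
  have h4 := setIntegral_gap_step hθ h1 h2 h3 k S
  have h5 := setIntegral_inner_noise hθ h1 h2 hk (measurable_gradient hθ h1 k)
    (memLp_gradient hθ h1 hk) hS
  have h6 := integral_oracle_sq_le hθ h1 h2 hk hS
  have i5 : IntegrableOn (fun _ : Ω => (1 : ℝ)) S P := (integrable_const 1).integrableOn
  have e0 : ∫ ω in S, (1 : ℝ) ∂P = P.real S := by
    rw [integral_const, smul_eq_mul, mul_one, measureReal_restrict_apply_univ]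
  rw [integral_const_mul, integral_add hk.integrableOn i5, e0] at h6
  rw [integral_add hk1.integrableOn i5, integral_add hk.integrableOn i5, e0]
  rw [h5] at h4
  have h0 := Real.rpow_nonneg (h3.pos (k + 1) (Nat.le_add_left 1 k)).le (1 + α)
  have h7 : 0 ≤ ∫ ω in S, gap F (θ k ω) ∂P := integral_nonneg fun ω => h1.gap_nonneg _
  have h8 : 0 ≤ P.real S := measureReal_nonneg
  have h9 : P.real S + ∫ ω in S, ‖g (ξ (k + 1) ω) (θ k ω)‖ ^ 2 ∂P ≤
      (1 + Cg) * (∫ ω in S, gap F (θ k ω) ∂P + P.real S) := by linarith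
  have h10 := mul_le_mul_of_nonneg_left h9 (mul_nonneg h1.L_pos.le h0)
  linarith

/-- The mean energy is bounded and the mean squared gradients are summable. -/
lemma exists_energy_bound (hθ : IsSGD P X ξ g γ θ) (h1 : HolderSmooth F L α)
    (h2 : OracleBounds P X F g Cg κ c) (h3 : RobbinsMonro γ α) :
    ∃ M, 0 ≤ M ∧ (∀ k, ∫ ω, (gap F (θ k ω) + 1) ∂P ≤ M) ∧
      ∀ n, ∑ k ∈ Finset.range n, ∫ ω, γ (k + 1) * ‖gradient F (θ k ω)‖ ^ 2 ∂P ≤ M := by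
  set B := L * (1 + Cg) with hBdef
  have hB : 0 ≤ B := mul_nonneg h1.L_pos.le (by linarith [h2.C_pos])
  obtain ⟨G, hG⟩ := exists_growth_le (α := α) h3 hB
  set e : ℕ → ℝ := fun k => ∫ ω, (gap F (θ k ω) + 1) ∂P with he
  have he0 : ∀ k, 0 ≤ e k := fun k => integral_nonneg fun ω => by
    have := h1.gap_nonneg (θ k ω)
    change 0 ≤ gap F (θ k ω) + 1
    linarith
  have hγ : ∀ k, 0 < γ (k + 1) := fun k => h3.pos (k + 1) (Nat.le_add_left 1 k)
  have hstep : ∀ k, e (k + 1) + κ * γ (k + 1) * ∫ ω, ‖gradient F (θ k ω)‖ ^ 2 ∂P ≤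
      (1 + B * γ (k + 1) ^ (1 + α)) * e k := fun k => by
    simpa using setIntegral_gap_succ_le hθ h1 h2 h3 k MeasurableSet.univ
  have hd0 : ∀ k, 0 ≤ κ * γ (k + 1) * ∫ ω, ‖gradient F (θ k ω)‖ ^ 2 ∂P := fun k =>
    mul_nonneg (mul_nonneg h2.κ_pos.le (hγ k).le) (integral_nonneg fun ω => by positivity)
  -- Discrete Gronwall inequality. With the energies bounded, the one-step inequality is summed once
  -- more to bound the gradients.
  have hle : ∀ k, e k ≤ growth γ α B k * e 0 := by
    intro k
    induction k with
    | zero => simp [growth]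
    | succ k ih =>
      have h0 := mul_nonneg hB (Real.rpow_nonneg (hγ k).le (1 + α))
      calc e (k + 1) ≤ (1 + B * γ (k + 1) ^ (1 + α)) * e k := by linarith [hstep k, hd0 k]
        _ ≤ (1 + B * γ (k + 1) ^ (1 + α)) * (growth γ α B k * e 0) := by gcongr
        _ = _ := by rw [growth_succ]; ring
  have hle' : ∀ k, e k ≤ G * e 0 := fun k =>
    (hle k).trans (mul_le_mul_of_nonneg_right (hG k) (he0 0))
  have hG1 : 1 ≤ G := (one_le_growth h3 hB 0).trans (hG 0)
  have hM0 : 0 ≤ G * e 0 := mul_nonneg (by linarith) (he0 0)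
  set T := ∑' k, γ (k + 1) ^ (1 + α) with hT
  have hT0 : 0 ≤ T := tsum_nonneg fun k => Real.rpow_nonneg (hγ k).le _
  refine ⟨max (G * e 0) ((e 0 + B * T * (G * e 0)) / κ), le_max_of_le_left hM0,
    fun k => (hle' k).trans (le_max_left _ _), fun n => le_trans ?_ (le_max_right _ _)⟩
  rw [le_div_iff₀ h2.κ_pos]
  have hs : ∀ n, ∑ k ∈ Finset.range n, κ * γ (k + 1) * ∫ ω, ‖gradient F (θ k ω)‖ ^ 2 ∂P ≤
      e 0 - e n + ∑ k ∈ Finset.range n, B * (G * e 0) * γ (k + 1) ^ (1 + α) := by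
    intro n
    induction n with
    | zero => simp
    | succ n ih =>
      rw [Finset.sum_range_succ, Finset.sum_range_succ]
      have h0 := mul_nonneg hB (Real.rpow_nonneg (hγ n).le (1 + α))
      have := mul_le_mul_of_nonneg_left (hle' n) h0
      linarith [hstep n]
  have h4 := hs n
  rw [← Finset.mul_sum] at h4
  have h5 := mul_le_mul_of_nonneg_left (h3.summable.sum_le_tsum (Finset.range n)
    fun k _ => Real.rpow_nonneg (hγ k).le _) (mul_nonneg hB hM0)
  have h6 : (∑ k ∈ Finset.range n, ∫ ω, γ (k + 1) * ‖gradient F (θ k ω)‖ ^ 2 ∂P) * κ =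
      ∑ k ∈ Finset.range n, κ * γ (k + 1) * ∫ ω, ‖gradient F (θ k ω)‖ ^ 2 ∂P := by
    rw [Finset.sum_mul]
    refine Finset.sum_congr rfl fun k _ => ?_
    rw [integral_const_mul]; ring
  rw [h6]
  linarith [he0 n]

lemma integral_noise_sq_le (hθ : IsSGD P X ξ g γ θ) (h1 : HolderSmooth F L α)
    (h2 : OracleBounds P X F g Cg κ c) (h3 : RobbinsMonro γ α) {k : ℕ} {ψ : Vec m → Vec m}
    {B : ℝ} (hB : 0 ≤ B)
    (h : ∀ᵐ ω ∂P, ‖ψ (θ k ω)‖ ^ 2 ≤ B) {M : ℝ}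
    (hM : ∫ ω, (gap F (θ k ω) + 1) ∂P ≤ M) :
    ∫ ω, inner ℝ (ψ (θ k ω)) (noise P X ξ g θ k ω) ^ 2 ∂P ≤ B * (4 * Cg * M) := by
  have hk := integrable_gap hθ h1 h2 h3 k
  have hD := (memLp_noise hθ h1 h2 hk).norm.integrable_sq
  have h4 : ∫ ω, ‖noise P X ξ g θ k ω‖ ^ 2 ∂P ≤ 4 * Cg * M := by
    have h5 := lintegral_mul_noise_le hθ h1 h2 (k := k) (h := fun _ => 1) measurable_const
    have hint : Integrable (fun ω => 4 * Cg * (gap F (θ k ω) + 1)) P :=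
      (hk.add (integrable_const 1)).const_mul _
    have hpos : ∀ ω, 0 ≤ 4 * Cg * (gap F (θ k ω) + 1) := fun ω =>
      mul_nonneg (by linarith [h2.C_pos]) (by linarith [h1.gap_nonneg (θ k ω)])
    simp_rw [one_mul, enorm_sq_eq_ofReal] at h5
    rw [← ofReal_integral_eq_lintegral_ofReal hD (Eventually.of_forall fun ω => by positivity),
      ← ofReal_integral_eq_lintegral_ofReal hint (Eventually.of_forall hpos)] at h5
    have h6 := (ENNReal.ofReal_le_ofReal_iff (integral_nonneg hpos)).1 h5
    rw [integral_const_mul] at h6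
    exact h6.trans (mul_le_mul_of_nonneg_left hM (by linarith [h2.C_pos]))
  calc _ ≤ ∫ ω, B * ‖noise P X ξ g θ k ω‖ ^ 2 ∂P := by
        refine integral_mono_of_nonneg (Eventually.of_forall fun ω => sq_nonneg _)
          (hD.const_mul B) ?_
        filter_upwards [h] with ω hω
        have h5 := abs_real_inner_le_norm (ψ (θ k ω)) (noise P X ξ g θ k ω)
        calc inner ℝ (ψ (θ k ω)) (noise P X ξ g θ k ω) ^ 2 =
              |inner ℝ (ψ (θ k ω)) (noise P X ξ g θ k ω)| ^ 2 := (sq_abs _).symm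
          _ ≤ (‖ψ (θ k ω)‖ * ‖noise P X ξ g θ k ω‖) ^ 2 := by gcongr
          _ = ‖ψ (θ k ω)‖ ^ 2 * ‖noise P X ξ g θ k ω‖ ^ 2 := by ring
          _ ≤ _ := by gcongr
    _ = B * ∫ ω, ‖noise P X ξ g θ k ω‖ ^ 2 ∂P := integral_const_mul _ _
    _ ≤ _ := mul_le_mul_of_nonneg_left h4 hB

/-- Weighted partial sums of the noise in the directions `ψ (θ_k)`. -/
noncomputable def noiseSum (P : Measure Ω) (X : Ω → Vec d) (ξ : ℕ → Ω → Vec d)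
    (g : Vec d → Vec m → Vec m) (θ : ℕ → Ω → Vec m) (ψ : Vec m → Vec m) (a : ℕ → ℝ)
    (n l : ℕ) (ω : Ω) : ℝ :=
  ∑ k ∈ Finset.Ico n l, a k * inner ℝ (ψ (θ k ω)) (noise P X ξ g θ k ω)

lemma measurable_noiseSum (hθ : IsSGD P X ξ g γ θ) {ψ : Vec m → Vec m} (hψ : Measurable ψ)
    (a : ℕ → ℝ) (n l : ℕ) : Measurable[history hθ l] (noiseSum P X ξ g θ ψ a n l) := by
  refine Finset.measurable_sum _ fun k hk => ?_
  have hkl : k + 1 ≤ l := (Finset.mem_Ico.1 hk).2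
  have h4 : Measurable[history hθ l] (noise P X ξ g θ k) :=
    (measurable_noise hθ k).mono ((history hθ).mono hkl) le_rfl
  have h5 : Measurable[history hθ l] fun ω => ψ (θ k ω) :=
    hψ.comp ((measurable_iterate hθ k).mono ((history hθ).mono ((Nat.le_succ k).trans hkl)) le_rfl)
  exact (h5.inner h4).const_mul (a k)

section Directions

variable {ψ : Vec m → Vec m} {B : ℝ}

lemma memLp_inner_noise (hθ : IsSGD P X ξ g γ θ) (h1 : HolderSmooth F L α)
    (h2 : OracleBounds P X F g Cg κ c) (h3 : RobbinsMonro γ α)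
    (hψ : Measurable ψ) (hψB : ∀ x, ‖ψ x‖ ≤ B) (k : ℕ) :
    MemLp (fun ω => inner ℝ (ψ (θ k ω)) (noise P X ξ g θ k ω)) 2 P := by
  have hD := memLp_noise hθ h1 h2 (integrable_gap hθ h1 h2 h3 k)
  refine (hD.norm.const_mul B).mono
    (((hψ.comp (measurable_iterate' hθ k)).inner (measurable_noise' hθ k)).aestronglyMeasurable)
    (Eventually.of_forall fun ω => ?_)
  rw [Real.norm_eq_abs, Real.norm_eq_abs, abs_of_nonneg
    (mul_nonneg ((norm_nonneg _).trans (hψB (θ k ω))) (norm_nonneg _))]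
  exact (abs_real_inner_le_norm _ _).trans
    (mul_le_mul_of_nonneg_right (hψB _) (norm_nonneg _))

lemma memLp_noiseSum (hθ : IsSGD P X ξ g γ θ) (h1 : HolderSmooth F L α)
    (h2 : OracleBounds P X F g Cg κ c) (h3 : RobbinsMonro γ α)
    (hψ : Measurable ψ) (hψB : ∀ x, ‖ψ x‖ ≤ B) (a : ℕ → ℝ) (n l : ℕ) :
    MemLp (noiseSum P X ξ g θ ψ a n l) 2 P :=
  memLp_finsetSum _ fun k _ => (memLp_inner_noise hθ h1 h2 h3 hψ hψB k).const_mul (a k)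

/-- Orthogonality of the noise: the second moment of a weighted sum. -/
lemma exists_integral_noiseSum_sq_le (hθ : IsSGD P X ξ g γ θ) (h1 : HolderSmooth F L α)
    (h2 : OracleBounds P X F g Cg κ c) (h3 : RobbinsMonro γ α)
    (hψ : Measurable ψ) (hψB : ∀ x, ‖ψ x‖ ≤ B) :
    ∃ V, 0 ≤ V ∧ ∀ (a : ℕ → ℝ) (n l : ℕ),
      ∫ ω, noiseSum P X ξ g θ ψ a n l ω ^ 2 ∂P ≤ V * ∑ k ∈ Finset.Ico n l, a k ^ 2 := by
  obtain ⟨M, hM0, hM, -⟩ := exists_energy_bound hθ h1 h2 h3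
  have hB : 0 ≤ B := (norm_nonneg _).trans (hψB 0)
  refine ⟨B ^ 2 * (4 * Cg * M), by have := h2.C_pos; positivity, fun a n l => ?_⟩
  induction l with
  | zero => simp [noiseSum]
  | succ l ih =>
    rcases lt_or_ge l n with hln | hnl
    · simp [noiseSum, Finset.Ico_eq_empty_of_le (Nat.succ_le_of_lt hln)]
    · have e : ∀ ω, noiseSum P X ξ g θ ψ a n (l + 1) ω = noiseSum P X ξ g θ ψ a n l ω +
          a l * inner ℝ (ψ (θ l ω)) (noise P X ξ g θ l ω) := fun ω =>
        Finset.sum_Ico_succ_top hnl _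
      have hk := integrable_gap hθ h1 h2 h3 l
      have m1 := memLp_noiseSum hθ h1 h2 h3 hψ hψB a n l
      have m2 := memLp_inner_noise hθ h1 h2 h3 hψ hψB l
      have i12 : Integrable (fun ω => noiseSum P X ξ g θ ψ a n l ω *
          inner ℝ (ψ (θ l ω)) (noise P X ξ g θ l ω)) P := m1.integrable_mul m2
      have e2 : ∀ ω, noiseSum P X ξ g θ ψ a n l ω *
          inner ℝ (ψ (θ l ω)) (noise P X ξ g θ l ω) =
          inner ℝ (noiseSum P X ξ g θ ψ a n l ω • ψ (θ l ω)) (noise P X ξ g θ l ω) := fun ω => by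
        rw [real_inner_smul_left]
      -- The partial sum is known before step `l + 1`, so it can be moved into the direction vector,
      -- and the cross term is the pairing of a past vector with centered noise.
      have horth : ∫ ω, noiseSum P X ξ g θ ψ a n l ω *
          inner ℝ (ψ (θ l ω)) (noise P X ξ g θ l ω) ∂P = 0 := by
        simp_rw [e2] at i12 ⊢
        refine integral_inner_noise hθ h2 ?_ i12
        exact (measurable_noiseSum hθ hψ a n l).smul (hψ.comp (measurable_iterate hθ l))
      have hN := integral_noise_sq_le hθ h1 h2 h3 (ψ := ψ) (sq_nonneg B) (k := l)
        (Eventually.of_forall fun ω => by have := hψB (θ l ω); gcongr) (hM l)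
      have e3 : ∀ ω, noiseSum P X ξ g θ ψ a n (l + 1) ω ^ 2 =
          noiseSum P X ξ g θ ψ a n l ω ^ 2 + (2 * a l * (noiseSum P X ξ g θ ψ a n l ω *
          inner ℝ (ψ (θ l ω)) (noise P X ξ g θ l ω)) +
          a l ^ 2 * inner ℝ (ψ (θ l ω)) (noise P X ξ g θ l ω) ^ 2) := fun ω => by rw [e]; ring
      simp_rw [e3]
      have j1 := i12.const_mul (2 * a l)
      have j2 := m2.integrable_sq.const_mul (a l ^ 2)
      have j12 : Integrable (fun ω => 2 * a l * (noiseSum P X ξ g θ ψ a n l ω *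
          inner ℝ (ψ (θ l ω)) (noise P X ξ g θ l ω)) +
          a l ^ 2 * inner ℝ (ψ (θ l ω)) (noise P X ξ g θ l ω) ^ 2) P := j1.add j2
      rw [integral_add m1.integrable_sq j12, integral_add j1 j2, integral_const_mul,
        integral_const_mul, horth, Finset.sum_Ico_succ_top hnl]
      have := mul_le_mul_of_nonneg_left hN (sq_nonneg (a l))
      linarith

end Directions

/-- The energies converge almost surely. -/
lemma ae_exists_tendsto_energy (hθ : IsSGD P X ξ g γ θ) (h1 : HolderSmooth F L α)
    (h2 : OracleBounds P X F g Cg κ c) (h3 : RobbinsMonro γ α) :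
    ∀ᵐ ω ∂P, ∃ v, Tendsto (fun n => F (θ n ω)) atTop (𝓝 v) := by
  set B := L * (1 + Cg) with hBdef
  have hB : 0 ≤ B := mul_nonneg h1.L_pos.le (by linarith [h2.C_pos])
  obtain ⟨G, hG⟩ := exists_growth_le (α := α) h3 hB
  obtain ⟨M, hM0, hM, -⟩ := exists_energy_bound hθ h1 h2 h3
  have hp : ∀ n, 1 ≤ growth γ α B n := one_le_growth h3 hB
  have hpos : ∀ n, 0 < growth γ α B n := fun n => one_pos.trans_le (hp n)
  -- Dividing by the growth factors turns `gap + 1` into a nonnegative supermartingale. The factors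
  -- increase to a finite limit, so the energies inherit convergence.
  let W : ℕ → Ω → ℝ := fun n ω => (gap F (θ n ω) + 1) / growth γ α B n
  have hint : ∀ n, Integrable (fun ω => gap F (θ n ω) + 1) P := fun n =>
    (integrable_gap hθ h1 h2 h3 n).add (integrable_const 1)
  have hsuper : Supermartingale W (history hθ) P := by
    refine supermartingale_of_setIntegral_succ_le
      (fun n => (((measurable_gap hθ h1 n).add_const 1).div_const _).stronglyMeasurable)
      (fun n => (hint n).div_const _) fun n S hS => ?_
    have h4 := setIntegral_gap_succ_le hθ h1 h2 h3 n hS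
    have h5 : 0 ≤ κ * γ (n + 1) * ∫ ω in S, ‖gradient F (θ n ω)‖ ^ 2 ∂P :=
      mul_nonneg (mul_nonneg h2.κ_pos.le (h3.pos (n + 1) (Nat.le_add_left 1 n)).le)
        (integral_nonneg fun ω => by positivity)
    simp only [W, integral_div]
    rw [div_le_div_iff₀ (hpos _) (hpos _), growth_succ]
    have h6 := mul_le_mul_of_nonneg_right (by linarith : ∫ ω in S, (gap F (θ (n + 1) ω) + 1) ∂P ≤
      (1 + B * γ (n + 1) ^ (1 + α)) * ∫ ω in S, (gap F (θ n ω) + 1) ∂P) (hpos n).le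
    linarith
  have hsub := hsuper.neg
  have hbdd : ∀ n, eLpNorm ((-W) n) 1 P ≤ (Real.toNNReal M : ENNReal) := by
    intro n
    have h0 : ∀ ω, 0 ≤ gap F (θ n ω) + 1 := fun ω => by linarith [h1.gap_nonneg (θ n ω)]
    rw [Pi.neg_apply, eLpNorm_neg, eLpNorm_one_eq_lintegral_enorm]
    calc ∫⁻ ω, ‖W n ω‖ₑ ∂P ≤ ∫⁻ ω, ENNReal.ofReal (gap F (θ n ω) + 1) ∂P := by
          refine lintegral_mono fun ω => ?_
          rw [Real.enorm_eq_ofReal (div_nonneg (h0 ω) (hpos n).le)]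
          exact ENNReal.ofReal_le_ofReal (div_le_self (h0 ω) (hp n))
      _ = ENNReal.ofReal (∫ ω, (gap F (θ n ω) + 1) ∂P) :=
          (ofReal_integral_eq_lintegral_ofReal (hint n) (Eventually.of_forall h0)).symm
      _ ≤ _ := ENNReal.ofReal_le_ofReal (hM n)
  have hgr : ∃ q, Tendsto (growth γ α B) atTop (𝓝 q) :=
    ⟨_, tendsto_atTop_ciSup (monotone_growth h3 hB) ⟨G, by rintro _ ⟨n, rfl⟩; exact hG n⟩⟩
  obtain ⟨q, hq⟩ := hgr
  filter_upwards [hsub.exists_ae_tendsto_of_bdd hbdd] with ω hω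
  obtain ⟨w, hw⟩ := hω
  refine ⟨-(w * q) - 1 + ⨅ η, F η, ?_⟩
  refine (((hw.mul hq).neg.sub_const 1).add_const (⨅ η, F η)).congr fun n => ?_
  simp only [Pi.neg_apply, W, gap]
  have := (hpos n).ne'
  field_simp
  ring

lemma inner_noiseSum_single (a : ℕ → ℝ) (n l : ℕ) (ω : Ω) (i : Fin m) :
    noiseSum P X ξ g θ (fun _ => EuclideanSpace.single i 1) a n l ω =
      (∑ k ∈ Finset.Ico n l, a k • noise P X ξ g θ k ω) i := by
  simp [noiseSum, EuclideanSpace.inner_single_left]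

/-- The weighted noise sums converge almost surely. -/
lemma ae_cauchySeq_noise (hθ : IsSGD P X ξ g γ θ) (h1 : HolderSmooth F L α)
    (h2 : OracleBounds P X F g Cg κ c) (h3 : RobbinsMonro γ α) :
    ∀ᵐ ω ∂P, CauchySeq fun n => ∑ k ∈ Finset.range n, γ (k + 1) • noise P X ξ g θ k ω := by
  -- Each coordinate is a martingale bounded in `L²`, hence in `L¹` by `|y| ≤ 1 + y²`; square
  -- summability of the steps supplies the bound.
  have hcoord : ∀ i : Fin m, ∀ᵐ ω ∂P, ∃ v, Tendsto (fun n =>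
      (∑ k ∈ Finset.range n, γ (k + 1) • noise P X ξ g θ k ω) i) atTop (𝓝 v) := by
    intro i
    let ψ : Vec m → Vec m := fun _ => EuclideanSpace.single i 1
    have hψ : Measurable ψ := measurable_const
    have hψB : ∀ x, ‖ψ x‖ ≤ 1 := fun x => by simp [ψ]
    obtain ⟨V, hV0, hV⟩ := exists_integral_noiseSum_sq_le hθ h1 h2 h3 hψ hψB
    let N : ℕ → Ω → ℝ := fun n => noiseSum P X ξ g θ ψ (fun k => γ (k + 1)) 0 n
    have hL2 : ∀ n, MemLp (N n) 2 P := fun n => memLp_noiseSum hθ h1 h2 h3 hψ hψB _ 0 n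
    have hsub : Submartingale N (history hθ) P := by
      refine submartingale_of_setIntegral_le_succ
        (fun n => (measurable_noiseSum hθ hψ _ 0 n).stronglyMeasurable)
        (fun n => (hL2 n).integrable one_le_two) fun n S hS => le_of_eq ?_
      have hk := integrable_gap hθ h1 h2 h3 n
      have e : ∀ ω, N (n + 1) ω = N n ω +
          γ (n + 1) * inner ℝ (ψ (θ n ω)) (noise P X ξ g θ n ω) := fun ω =>
        Finset.sum_Ico_succ_top (Nat.zero_le n) _
      have i1 := (memLp_inner_noise hθ h1 h2 h3 hψ hψB n).integrable one_le_two
      simp_rw [e]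
      rw [integral_add ((hL2 n).integrable one_le_two).integrableOn
        (i1.const_mul _).integrableOn, integral_const_mul]
      have h4 := setIntegral_inner_noise hθ h1 h2 hk (ψ := fun ω => ψ (θ n ω)) measurable_const
        (memLp_const _) hS
      rw [h4]; ring
    set T := ∑' k, γ (k + 1) ^ 2 with hT
    have hbdd : ∀ n, eLpNorm (N n) 1 P ≤ (Real.toNNReal (1 + V * T) : ENNReal) := by
      intro n
      rw [eLpNorm_one_eq_lintegral_enorm]
      simp_rw [← ofReal_norm]
      rw [← ofReal_integral_eq_lintegral_ofReal ((hL2 n).integrable one_le_two).norm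
        (Eventually.of_forall fun ω => norm_nonneg _)]
      refine ENNReal.ofReal_le_ofReal ?_
      calc ∫ ω, ‖N n ω‖ ∂P ≤ ∫ ω, (1 + N n ω ^ 2) ∂P := by
            refine integral_mono ((hL2 n).integrable one_le_two).norm
              ((integrable_const 1).add (hL2 n).integrable_sq) fun ω => ?_
            simp only [Real.norm_eq_abs]
            rw [← sq_abs]
            nlinarith [sq_nonneg (|N n ω| - 1)]
        _ = 1 + ∫ ω, N n ω ^ 2 ∂P := by
            rw [integral_add (integrable_const 1) (hL2 n).integrable_sq]; simp
        _ ≤ 1 + V * T := by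
            have h5 := hV (fun k => γ (k + 1)) 0 n
            rw [← Finset.range_eq_Ico] at h5
            have h6 := mul_le_mul_of_nonneg_left ((h3.summable_sq h1.α_pos h1.α_le_one).sum_le_tsum
              (Finset.range n) fun k _ => sq_nonneg _) hV0
            linarith
    filter_upwards [hsub.exists_ae_tendsto_of_bdd hbdd] with ω hω
    obtain ⟨v, hv⟩ := hω
    refine ⟨v, hv.congr fun n => ?_⟩
    rw [Finset.range_eq_Ico]
    exact inner_noiseSum_single _ 0 n ω i
  filter_upwards [ae_all_iff.2 hcoord] with ω hω
  choose v hv using hω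
  exact (((PiLp.continuous_toLp 2 (fun _ : Fin m => ℝ)).tendsto v).comp
    (tendsto_pi_nhds.2 hv)).cauchySeq

/-- The gradients vanish along the iterates almost surely. -/
lemma ae_tendsto_gradient (hθ : IsSGD P X ξ g γ θ) (h1 : HolderSmooth F L α)
    (h2 : OracleBounds P X F g Cg κ c) (h3 : RobbinsMonro γ α) :
    ∀ᵐ ω ∂P, Tendsto (fun n => gradient F (θ n ω)) atTop (𝓝 0) := by
  obtain ⟨M, hM0, hM, hsum⟩ := exists_energy_bound hθ h1 h2 h3
  have hγ : ∀ k, 0 ≤ γ (k + 1) := fun k => (h3.pos (k + 1) (Nat.le_add_left 1 k)).le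
  have h4 := ae_summable_of_sum_integral_le (P := P)
    (f := fun k ω => γ (k + 1) * ‖gradient F (θ k ω)‖ ^ 2)
    (fun k => (memLp_gradient hθ h1 (integrable_gap hθ h1 h2 h3 k)).norm.integrable_sq.const_mul _)
    (fun k ω => mul_nonneg (hγ k) (sq_nonneg _)) hsum
  have hdiv : Tendsto (fun n => ∑ k ∈ Finset.range n, γ (k + 1)) atTop atTop := by
    refine h3.diverges.congr fun n => ?_
    rw [partialSum, Finset.range_eq_Ico, Finset.sum_Ico_add' γ 0 n 1]
    rfl
  filter_upwards [h4, ae_cauchySeq_noise hθ h1 h2 h3] with ω hω1 hω2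
  exact tendsto_gradient_zero h1.α_pos (h2.κ_pos.le.trans h2.κ_le) hγ hdiv
    (fun k => step_eq hθ k ω) (fun k => h2.upper _) (fun x y => h1.holder x y) h1.L_pos.le hω1 hω2

end Dynamics

/-! ### Convergence rates on an event -/

lemma StepBounds.mono {Γ τ : ℕ → ℝ} {x u C C' : ℝ} {n₀ : ℕ} (h : StepBounds Γ τ x u C n₀)
    (hC : C ≤ C') : StepBounds Γ τ x u C' n₀ where
  clock := h.clock
  C_nonneg := h.C_nonneg.trans hC
  pos := h.pos
  le k hk := (h.le k hk).trans (mul_le_mul_of_nonneg_right hC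
    (mul_nonneg (sub_nonneg.2 (h.clock.mono k)) (Real.rpow_pos_of_pos (h.clock.pos k) _).le))
  sq_le k hk := (h.sq_le k hk).trans (mul_le_mul_of_nonneg_right hC
    (mul_nonneg (sub_nonneg.2 (h.clock.mono k)) (Real.rpow_pos_of_pos (h.clock.pos k) _).le))

/-- Nonnegative variance of the restricted function. It transfers second moments computed on the
whole space to events that may look into the future. -/
lemma sq_setIntegral_le {Ω : Type*} {mΩ : MeasurableSpace Ω} {P : Measure Ω}
    [IsProbabilityMeasure P] {f : Ω → ℝ} (hf : MemLp f 2 P) {A : Set Ω} (hA : MeasurableSet A) :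
    (∫ ω in A, f ω ∂P) ^ 2 ≤ ∫ ω in A, f ω ^ 2 ∂P := by
  have h := variance_nonneg (A.indicator f) P
  rw [variance_eq_sub (hf.indicator hA), integral_indicator hA] at h
  have e : (A.indicator f ^ 2 : Ω → ℝ) = A.indicator fun ω => f ω ^ 2 := by
    funext ω
    by_cases hω : ω ∈ A <;> simp [hω]
  rw [e, integral_indicator hA] at h
  linarith

section Dynamics

set_option linter.unusedSectionVars false

variable {Ω : Type*} [mΩ : MeasurableSpace Ω] {P : Measure Ω} [IsProbabilityMeasure P] {d m : ℕ}
  {X : Ω → Vec d} {ξ : ℕ → Ω → Vec d} {g : Vec d → Vec m → Vec m} {γ : ℕ → ℝ}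
  {θ : ℕ → Ω → Vec m} {F : Vec m → ℝ} {L α Cg κ c : ℝ}

/-- Orthogonality is applied coordinate by coordinate, with constant directions equal to the
standard basis vectors. -/
lemma exists_integral_noise_norm_le (hθ : IsSGD P X ξ g γ θ) (h1 : HolderSmooth F L α)
    (h2 : OracleBounds P X F g Cg κ c) (h3 : RobbinsMonro γ α) :
    ∃ V, 0 ≤ V ∧ ∀ (a : ℕ → ℝ) (n l : ℕ),
      MemLp (fun ω => ∑ k ∈ Finset.Ico n l, a k • noise P X ξ g θ k ω) 2 P ∧
      ∫ ω, ‖∑ k ∈ Finset.Ico n l, a k • noise P X ξ g θ k ω‖ ∂P ≤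
        √(V * ∑ k ∈ Finset.Ico n l, a k ^ 2) := by
  have hψ : ∀ i : Fin m, Measurable fun _ : Vec m => (EuclideanSpace.single i 1 : Vec m) :=
    fun i => measurable_const
  have hψB : ∀ (i : Fin m) (x : Vec m), ‖(fun _ : Vec m => (EuclideanSpace.single i 1 : Vec m)) x‖
      ≤ 1 := fun i x => by simp
  choose V hV0 hV using fun i : Fin m =>
    exists_integral_noiseSum_sq_le hθ h1 h2 h3 (hψ i) (hψB i)
  refine ⟨∑ i, V i, Finset.sum_nonneg fun i _ => hV0 i, fun a n l => ?_⟩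
  have hmem : MemLp (fun ω => ∑ k ∈ Finset.Ico n l, a k • noise P X ξ g θ k ω) 2 P :=
    memLp_finsetSum _ fun k _ =>
      (memLp_noise hθ h1 h2 (integrable_gap hθ h1 h2 h3 k)).const_smul (a k)
  refine ⟨hmem, ?_⟩
  have h4 := sq_setIntegral_le hmem.norm MeasurableSet.univ
  simp only [setIntegral_univ] at h4
  refine Real.le_sqrt_of_sq_le (h4.trans ?_)
  have e : ∀ ω, ‖∑ k ∈ Finset.Ico n l, a k • noise P X ξ g θ k ω‖ ^ 2 =
      ∑ i, noiseSum P X ξ g θ (fun _ => EuclideanSpace.single i 1) a n l ω ^ 2 := fun ω => by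
    rw [EuclideanSpace.norm_sq_eq]
    refine Finset.sum_congr rfl fun i _ => ?_
    rw [inner_noiseSum_single, Real.norm_eq_abs, sq_abs]
  simp_rw [e]
  rw [integral_finsetSum _ fun i _ =>
    (memLp_noiseSum hθ h1 h2 h3 (hψ i) (hψB i) a n l).integrable_sq, Finset.sum_mul]
  exact Finset.sum_le_sum fun i _ => hV i a n l

lemma iterate_sub_eq (hθ : IsSGD P X ξ g γ θ) {n l : ℕ} (hnl : n ≤ l) (ω : Ω) :
    θ l ω - θ n ω = -(∑ k ∈ Finset.Ico n l, γ (k + 1) • meanOracle P X g (θ k ω)) -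
      ∑ k ∈ Finset.Ico n l, γ (k + 1) • noise P X ξ g θ k ω := by
  rw [← Finset.sum_Ico_sub (fun k => θ k ω) hnl, ← Finset.sum_neg_distrib,
    ← Finset.sum_sub_distrib]
  refine Finset.sum_congr rfl fun j _ => ?_
  rw [step_eq hθ]; abel

/-- Mean trajectory length on an event along which the energy is dissipated at the rate
prescribed by a clock. -/
theorem exists_length_bound (hθ : IsSGD P X ξ g γ θ) (h1 : HolderSmooth F L α)
    (h2 : OracleBounds P X F g Cg κ c) (h3 : RobbinsMonro γ α)
    {τ : ℕ → ℝ} {x u K C : ℝ} {n₀ : ℕ} (hΓ : StepBounds (fun k => γ (k + 1)) τ x u C n₀)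
    (hΓα : ∀ k, n₀ ≤ k → γ (k + 1) ^ (1 + α) ≤ C * ((τ (k + 1) - τ k) * τ k ^ (-1 - x)))
    (hx : 0 < x) (hK : x < K) (hu0 : u ≤ 1) (hu : 1 - u < x)
    {A : Set Ω} (hA : MeasurableSet A) {v : ℝ}
    (hdrift : ∀ k, n₀ ≤ k → ∀ ω ∈ A, contraction τ K k * (F (θ k ω) - v) ≤
      κ * γ (k + 1) * ‖gradient F (θ k ω)‖ ^ 2 + C * ((τ (k + 1) - τ k) * τ k ^ (-1 - x)))
    {V : ℝ} (hV : 0 ≤ V) (hnoise : ∀ (a : ℕ → ℝ) (n l : ℕ), n₀ ≤ n →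
      (∑ k ∈ Finset.Ico n l, a k *
        ∫ ω in A, inner ℝ (gradient F (θ k ω)) (noise P X ξ g θ k ω) ∂P) ^ 2 ≤
        V * ∑ k ∈ Finset.Ico n l, a k ^ 2)
    (hlim : ∀ ε > 0, ∀ᶠ k in atTop, -ε ≤ ∫ ω in A, (F (θ k ω) - v) ∂P) :
    ∃ M, 0 ≤ M ∧ ∀ n l, n₀ ≤ n →
      ∑ k ∈ Finset.Ico n l, γ (k + 1) * ∫ ω in A, ‖gradient F (θ k ω)‖ ∂P ≤
        M * τ n ^ (-((x + u - 1) / 2)) ∧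
      (n ≤ l → ∫ ω in A, ‖θ l ω - θ n ω‖ ∂P ≤ M * τ n ^ (-((x + u - 1) / 2))) := by
  have hτ := hΓ.clock
  have hC := hΓ.C_nonneg
  have hγ : ∀ k, 0 < γ (k + 1) := hΓ.pos
  obtain ⟨M₀, hM₀, hM, -⟩ := exists_energy_bound hθ h1 h2 h3
  have hgapI := fun k => integrable_gap hθ h1 h2 h3 k
  have hPA0 : 0 ≤ P.real A := measureReal_nonneg
  have hPA1 : P.real A ≤ 1 := measureReal_le_one
  have hCg := h2.C_pos
  have hL := h1.L_pos
  set R := L * (1 + Cg * M₀) with hR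
  have hR0 : 0 ≤ R := by positivity
  set C' := C + V + R * C with hC'
  have hCC' : C ≤ C' := by have := mul_nonneg hR0 hC; linarith
  have hRC' : R * C ≤ C' := by linarith
  have hVC' : V ≤ C' := by have := mul_nonneg hR0 hC; linarith
  have hvint : ∀ k, ∫ ω in A, (F (θ k ω) - v) ∂P =
      ∫ ω in A, gap F (θ k ω) ∂P + ((⨅ η, F η) - v) * P.real A := by
    intro k
    have e : ∀ ω, F (θ k ω) - v = gap F (θ k ω) + ((⨅ η, F η) - v) := fun ω => by
      rw [gap]; ring
    simp_rw [e]
    rw [integral_add (hgapI k).integrableOn (integrable_const _).integrableOn, integral_const,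
      smul_eq_mul, measureReal_restrict_apply_univ]
    ring
  have hδ : ∀ k, 0 ≤ (τ (k + 1) - τ k) * τ k ^ (-1 - x) := fun k =>
    mul_nonneg (sub_nonneg.2 (hτ.mono k)) (Real.rpow_pos_of_pos (hτ.pos k) _).le
  have hg2 : ∀ k, P.real A + ∫ ω in A, ‖g (ξ (k + 1) ω) (θ k ω)‖ ^ 2 ∂P ≤ 1 + Cg * M₀ := by
    intro k
    have h4 := integral_oracle_sq_le hθ h1 h2 (hgapI k) MeasurableSet.univ
    simp only [setIntegral_univ] at h4
    have h5 := setIntegral_le_integral (s := A)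
      (memLp_oracle hθ h2 (hgapI k)).norm.integrable_sq
      (Eventually.of_forall fun ω => sq_nonneg ‖g (ξ (k + 1) ω) (θ k ω)‖)
    rw [integral_const_mul] at h4
    have h6 := mul_le_mul_of_nonneg_left (hM k) hCg.le
    linarith
  -- The energy balance over `A` is an instance of the abstract recursion: `setIntegral_gap_step`
  -- gives the dissipation, the pointwise drift integrates over `A`, and `C'` collects all
  -- constants.
  have hrec : EnergyRecursion (fun k => γ (k + 1)) τ (fun k => ∫ ω in A, (F (θ k ω) - v) ∂P)
      (fun k => κ * ∫ ω in A, ‖gradient F (θ k ω)‖ ^ 2 ∂P)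
      (fun k => -(γ (k + 1) *
        ∫ ω in A, inner ℝ (gradient F (θ k ω)) (noise P X ξ g θ k ω) ∂P)) x K C' n₀ := by
    refine ⟨fun k => mul_nonneg h2.κ_pos.le (integral_nonneg fun ω => sq_nonneg _),
      fun k hk => ?_, fun k hk => ?_, fun a n l hn => ?_, hlim⟩
    · have h4 := setIntegral_gap_step hθ h1 h2 h3 k A
      simp only [hvint]
      have h5 : L * γ (k + 1) ^ (1 + α) * (P.real A +
          ∫ ω in A, ‖g (ξ (k + 1) ω) (θ k ω)‖ ^ 2 ∂P) ≤
          C' * ((τ (k + 1) - τ k) * τ k ^ (-1 - x)) := by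
        calc _ ≤ L * γ (k + 1) ^ (1 + α) * (1 + Cg * M₀) :=
              mul_le_mul_of_nonneg_left (hg2 k)
                (mul_nonneg hL.le (Real.rpow_nonneg (hγ k).le _))
          _ = R * γ (k + 1) ^ (1 + α) := by rw [hR]; ring
          _ ≤ R * (C * ((τ (k + 1) - τ k) * τ k ^ (-1 - x))) :=
              mul_le_mul_of_nonneg_left (hΓα k hk) hR0
          _ = (R * C) * ((τ (k + 1) - τ k) * τ k ^ (-1 - x)) := by ring
          _ ≤ _ := mul_le_mul_of_nonneg_right hRC' (hδ k)
      linarith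
    · have i1 : IntegrableOn (fun ω => F (θ k ω) - v) A P := by
        have e : (fun ω => F (θ k ω) - v) = fun ω => gap F (θ k ω) + ((⨅ η, F η) - v) := by
          funext ω; rw [gap]; ring
        rw [e]
        exact ((hgapI k).add (integrable_const _)).integrableOn
      have i2 := (memLp_gradient hθ h1 (hgapI k)).norm.integrable_sq.integrableOn (s := A)
      have i3 : IntegrableOn (fun _ : Ω => C * ((τ (k + 1) - τ k) * τ k ^ (-1 - x))) A P :=
        (integrable_const _).integrableOn
      have h4 := setIntegral_mono_on (i1.const_mul (contraction τ K k))
        ((i2.const_mul (κ * γ (k + 1))).add i3) hA (hdrift k hk)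
      have e1 := integral_add (μ := P.restrict A) (i2.const_mul (κ * γ (k + 1))) i3
      simp only [Pi.add_apply, integral_const_mul, integral_const, smul_eq_mul,
        measureReal_restrict_apply_univ] at h4 e1
      rw [e1] at h4
      have h5 : P.real A * (C * ((τ (k + 1) - τ k) * τ k ^ (-1 - x))) ≤
          C' * ((τ (k + 1) - τ k) * τ k ^ (-1 - x)) :=
        (mul_le_of_le_one_left (mul_nonneg hC (hδ k)) hPA1).trans
          (mul_le_mul_of_nonneg_right hCC' (hδ k))
      linarith
    · have h4 := hnoise (fun k => -(a k * γ (k + 1))) n l hn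
      calc _ = (∑ k ∈ Finset.Ico n l, -(a k * γ (k + 1)) *
            ∫ ω in A, inner ℝ (gradient F (θ k ω)) (noise P X ξ g θ k ω) ∂P) ^ 2 := by
            congr 1
            exact Finset.sum_congr rfl fun k _ => by ring
        _ ≤ V * ∑ k ∈ Finset.Ico n l, (-(a k * γ (k + 1))) ^ 2 := h4
        _ = V * ∑ k ∈ Finset.Ico n l, a k ^ 2 * γ (k + 1) ^ 2 := by
            congr 1
            exact Finset.sum_congr rfl fun k _ => by ring
        _ ≤ _ := mul_le_mul_of_nonneg_right hVC' (Finset.sum_nonneg fun k _ => by positivity)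
  obtain ⟨M₁, hM₁, hlen⟩ := hrec.length_le (hΓ.mono hCC') hx hK hu0 hu
  have hκ := h2.κ_pos
  have hgrad : ∀ n l, n₀ ≤ n →
      ∑ k ∈ Finset.Ico n l, γ (k + 1) * ∫ ω in A, ‖gradient F (θ k ω)‖ ∂P ≤
        M₁ / √κ * τ n ^ (-((x + u - 1) / 2)) := by
    intro n l hn
    have hsκ := Real.sqrt_pos.2 hκ
    rw [div_mul_eq_mul_div, le_div_iff₀ hsκ]
    refine le_trans ?_ (hlen n l hn)
    rw [Finset.sum_mul]
    refine Finset.sum_le_sum fun k _ => ?_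
    rw [mul_assoc, Real.sqrt_mul hκ.le, mul_comm (√κ)]
    refine mul_le_mul_of_nonneg_left (mul_le_mul_of_nonneg_right ?_ hsκ.le) (hγ k).le
    -- The recursion controls root mean squares of the gradient over `A`; these dominate the mean
    -- norms.
    exact Real.le_sqrt_of_sq_le (sq_setIntegral_le (memLp_gradient hθ h1 (hgapI k)).norm hA)
  obtain ⟨W, hW0, hW⟩ := exists_integral_noise_norm_le hθ h1 h2 h3
  have hc0 : 0 ≤ c := h2.κ_pos.le.trans h2.κ_le
  set E : ℝ := 2 ^ (1 + 2 * x) / (2 * x) with hE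
  have hE0 : 0 ≤ E := by positivity
  have hD0 : 0 ≤ M₁ / √κ := by positivity
  refine ⟨(1 + c) * (M₁ / √κ) + √(W * (C * E)), by positivity, fun n l hn => ⟨?_, fun hnl => ?_⟩⟩
  · refine (hgrad n l hn).trans (mul_le_mul_of_nonneg_right ?_
      (Real.rpow_pos_of_pos (hτ.pos n) _).le)
    have := mul_nonneg hc0 hD0
    have := Real.sqrt_nonneg (W * (C * E))
    linarith
  · obtain ⟨hmem, hint⟩ := hW (fun k => γ (k + 1)) n l
    have igrad : ∀ k, Integrable (fun ω => ‖gradient F (θ k ω)‖) P := fun k =>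
      ((memLp_gradient hθ h1 (hgapI k)).integrable one_le_two).norm
    have i1 : Integrable (fun ω => ∑ k ∈ Finset.Ico n l,
        γ (k + 1) * (c * ‖gradient F (θ k ω)‖)) P :=
      integrable_finsetSum _ fun k _ => ((igrad k).const_mul c).const_mul _
    have i2 : Integrable (fun ω => ‖∑ k ∈ Finset.Ico n l,
        γ (k + 1) • noise P X ξ g θ k ω‖) P := (hmem.integrable one_le_two).norm
    have hpt : ∀ ω, ‖θ l ω - θ n ω‖ ≤ ∑ k ∈ Finset.Ico n l,
        γ (k + 1) * (c * ‖gradient F (θ k ω)‖) +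
        ‖∑ k ∈ Finset.Ico n l, γ (k + 1) • noise P X ξ g θ k ω‖ := by
      intro ω
      rw [iterate_sub_eq hθ hnl]
      refine (norm_sub_le _ _).trans (add_le_add_left ?_ _)
      rw [norm_neg]
      refine norm_sum_le_of_le _ fun k _ => ?_
      rw [norm_smul, Real.norm_of_nonneg (hγ k).le]
      exact mul_le_mul_of_nonneg_left (h2.upper _) (hγ k).le
    have h4 : ∫ ω in A, ‖θ l ω - θ n ω‖ ∂P ≤ ∫ ω in A, (∑ k ∈ Finset.Ico n l,
        γ (k + 1) * (c * ‖gradient F (θ k ω)‖) +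
        ‖∑ k ∈ Finset.Ico n l, γ (k + 1) • noise P X ξ g θ k ω‖) ∂P :=
      integral_mono_of_nonneg (Eventually.of_forall fun ω => norm_nonneg _)
        (i1.add i2).integrableOn (Eventually.of_forall hpt)
    rw [integral_add i1.integrableOn i2.integrableOn, integral_finsetSum _ fun k _ =>
      (((igrad k).const_mul c).const_mul _).integrableOn] at h4
    simp_rw [integral_const_mul] at h4
    have h5 : ∑ k ∈ Finset.Ico n l, γ (k + 1) * (c * ∫ ω in A, ‖gradient F (θ k ω)‖ ∂P) ≤
        c * (M₁ / √κ * τ n ^ (-((x + u - 1) / 2))) := by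
      refine le_trans (le_of_eq ?_) (mul_le_mul_of_nonneg_left (hgrad n l hn) hc0)
      rw [Finset.mul_sum]
      exact Finset.sum_congr rfl fun k _ => by ring
    have h6 : ∫ ω in A, ‖∑ k ∈ Finset.Ico n l, γ (k + 1) • noise P X ξ g θ k ω‖ ∂P ≤
        √(W * (C * E)) * τ n ^ (-((x + u - 1) / 2)) := by
      refine (setIntegral_le_integral i2 (Eventually.of_forall fun ω => norm_nonneg _)).trans
        (hint.trans ?_)
      have h7 : ∑ k ∈ Finset.Ico n l, γ (k + 1) ^ 2 ≤ C * E * τ n ^ (-(2 * x)) := by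
        rw [mul_assoc]
        refine le_trans (Finset.sum_le_sum fun k hk =>
          hΓ.sq_le k (hn.trans (Finset.mem_Ico.1 hk).1)) ?_
        rw [← Finset.mul_sum]
        exact mul_le_mul_of_nonneg_left (hτ.sum_decaying (by positivity) n l) hC
      calc _ ≤ √(W * (C * E) * τ n ^ (-(2 * x))) := by
            refine Real.sqrt_le_sqrt ?_
            rw [mul_assoc W]
            exact mul_le_mul_of_nonneg_left h7 hW0
        _ = √(W * (C * E)) * τ n ^ (-x) := by
            rw [Real.sqrt_mul (by positivity), Real.sqrt_eq_rpow (τ n ^ _),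
              ← Real.rpow_mul (hτ.pos n).le]
            congr 2; ring
        _ ≤ _ := mul_le_mul_of_nonneg_left
            -- The displacement due to noise is of order `τ ^ (-x)`, which is no larger than the
            -- length bound because `u ≤ 1` and `x > 0`.
            (Real.rpow_le_rpow_of_exponent_le (hτ.one_le n) (by linarith)) (Real.sqrt_nonneg _)
    have h8 := mul_nonneg hD0 (Real.rpow_pos_of_pos (hτ.pos n) (-((x + u - 1) / 2))).le
    linarith

end Dynamics

/-- A clock `τ` along which the steps are small enough for errors of order `τ ^ (-x)`. -/
structure RateClock (γ : ℕ → ℝ) (α : ℝ) (τ : ℕ → ℝ) (x u : ℝ) (n₀ : ℕ) : Prop where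
  bounds : ∃ C, StepBounds (fun k => γ (k + 1)) τ x u C n₀ ∧
    ∀ k, n₀ ≤ k → γ (k + 1) ^ (1 + α) ≤ C * ((τ (k + 1) - τ k) * τ k ^ (-1 - x))
  x_pos : 0 < x
  u_le : u ≤ 1
  lt_x : 1 - u < x

/-- The energy excess over `v` is dissipated on `U` at the rate prescribed by the clock. -/
def Drift {m : ℕ} (F : Vec m → ℝ) (κ : ℝ) (γ τ : ℕ → ℝ) (x K : ℝ) (n₀ : ℕ) (U : Set (Vec m))
    (v : ℝ) : Prop :=
  ∃ C, 0 ≤ C ∧ ∀ k, n₀ ≤ k → ∀ t ∈ U, contraction τ K k * (F t - v) ≤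
    κ * γ (k + 1) * ‖gradient F t‖ ^ 2 + C * ((τ (k + 1) - τ k) * τ k ^ (-1 - x))

/-! ### Length bounds on capture events and in the global case -/

section Dynamics

set_option linter.unusedSectionVars false

variable {Ω : Type*} [mΩ : MeasurableSpace Ω] {P : Measure Ω} [IsProbabilityMeasure P] {d m : ℕ}
  {X : Ω → Vec d} {ξ : ℕ → Ω → Vec d} {g : Vec d → Vec m → Vec m} {γ : ℕ → ℝ}
  {θ : ℕ → Ω → Vec m} {F : Vec m → ℝ} {L α Cg κ c : ℝ}

lemma memLp_iterate (hθ : IsSGD P X ξ g γ θ) (h1 : HolderSmooth F L α)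
    (h2 : OracleBounds P X F g Cg κ c) (h3 : RobbinsMonro γ α) (n : ℕ) : MemLp (θ n) 2 P := by
  induction n with
  | zero => exact hθ.memLp_init
  | succ n ih =>
    have e : θ (n + 1) = fun ω => θ n ω - γ (n + 1) • g (ξ (n + 1) ω) (θ n ω) :=
      funext (hθ.step n)
    rw [e]
    exact ih.sub ((memLp_oracle hθ h2 (integrable_gap hθ h1 h2 h3 n)).const_smul (γ (n + 1)))

/-- Summable mean gradients on an event force the iterates to converge there. -/
lemma ae_cauchySeq_of_sum_le (hθ : IsSGD P X ξ g γ θ) (h1 : HolderSmooth F L α)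
    (h2 : OracleBounds P X F g Cg κ c) (h3 : RobbinsMonro γ α) {A : Set Ω} {N : ℕ} {M : ℝ}
    (h : ∀ l, ∑ k ∈ Finset.Ico N l, γ (k + 1) * ∫ ω in A, ‖gradient F (θ k ω)‖ ∂P ≤ M) :
    ∀ᵐ ω ∂P.restrict A, CauchySeq fun n => θ n ω := by
  have hγ : ∀ k, 0 ≤ γ (k + 1) := fun k => (h3.pos (k + 1) (Nat.le_add_left 1 k)).le
  have h4 := ae_summable_of_sum_integral_le (P := P.restrict A) (C := M)
    (f := fun k ω => γ (N + k + 1) * ‖gradient F (θ (N + k) ω)‖)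
    (fun k => ((memLp_gradient hθ h1 (integrable_gap hθ h1 h2 h3 _)).integrable
      one_le_two).norm.integrableOn.const_mul _)
    (fun k ω => mul_nonneg (hγ _) (norm_nonneg _)) (fun n => by
      refine le_trans (le_of_eq ?_) (h (N + n))
      rw [Finset.sum_Ico_eq_sum_range, Nat.add_sub_cancel_left]
      simp_rw [integral_const_mul])
  filter_upwards [h4, ae_restrict_of_ae (ae_cauchySeq_noise hθ h1 h2 h3)] with ω hω1 hω2
  -- The displacement splits into the mean oracle part, absolutely summable by the gradient bound,
  -- and the noise part, which converges almost surely.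
  have h5 : Summable fun k => γ (k + 1) • meanOracle P X g (θ k ω) := by
    rw [← summable_nat_add_iff N]
    refine Summable.of_norm_bounded (hω1.mul_left c) fun k => ?_
    rw [norm_smul, Real.norm_of_nonneg (hγ _), add_comm k N]
    have := mul_le_mul_of_nonneg_left (h2.upper (θ (N + k) ω)) (hγ (N + k))
    linarith
  obtain ⟨s, hs⟩ := cauchySeq_tendsto_of_complete hω2
  have h6 := (h5.hasSum.tendsto_sum_nat.neg.sub hs).const_add (θ 0 ω)
  refine (h6.congr fun n => ?_).cauchySeq
  have := iterate_sub_eq hθ (Nat.zero_le n) ω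
  rw [← Finset.range_eq_Ico] at this
  rw [← this]; abel

/-- Passing to the limit in a mean Cauchy estimate. -/
lemma exists_lintegral_limit_le (hθ : IsSGD P X ξ g γ θ) (h1 : HolderSmooth F L α)
    (h2 : OracleBounds P X F g Cg κ c) (h3 : RobbinsMonro γ α) {A : Set Ω} {N : ℕ} {M q : ℝ}
    {τ : ℕ → ℝ} (hτ : IsClock τ) (hq : 0 ≤ q) (hM : 0 ≤ M)
    (h : ∀ n l, N ≤ n → n ≤ l → ∫ ω in A, ‖θ l ω - θ n ω‖ ∂P ≤ M * τ n ^ (-q))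
    {θs : Ω → Vec m}
    (hlim : ∀ᵐ ω ∂P, Tendsto (fun n => θ n ω) atTop (𝓝 (θs ω))) :
    ∃ M', 0 ≤ M' ∧ ∀ n, ∫⁻ ω in A, ‖θ n ω - θs ω‖ₑ ∂P ≤ ENNReal.ofReal (M' * τ n ^ (-q)) := by
  have hmeas : ∀ l n, Measurable fun ω => ‖θ l ω - θ n ω‖ₑ := fun l n =>
    ((measurable_iterate' hθ l).sub (measurable_iterate' hθ n)).enorm
  have hI : ∀ l n, Integrable (fun ω => θ l ω - θ n ω) P := fun l n =>
    ((memLp_iterate hθ h1 h2 h3 l).sub (memLp_iterate hθ h1 h2 h3 n)).integrable one_le_two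
  have hlarge : ∀ n, N ≤ n → ∫⁻ ω in A, ‖θ n ω - θs ω‖ₑ ∂P ≤ ENNReal.ofReal (M * τ n ^ (-q)) := by
    intro n hn
    have h4 : ∀ᵐ ω ∂P.restrict A, Tendsto (fun l => ‖θ l ω - θ n ω‖ₑ) atTop
        (𝓝 ‖θ n ω - θs ω‖ₑ) := by
      filter_upwards [ae_restrict_of_ae hlim] with ω hω
      have := (hω.sub_const (θ n ω)).enorm
      rwa [← enorm_neg (θs ω - θ n ω), neg_sub] at this
    have h5 : ∫⁻ ω in A, ‖θ n ω - θs ω‖ₑ ∂P =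
        ∫⁻ ω in A, liminf (fun l => ‖θ l ω - θ n ω‖ₑ) atTop ∂P :=
      lintegral_congr_ae (h4.mono fun ω hω => hω.liminf_eq.symm)
    rw [h5]
    -- Fatou's lemma as the later index tends to infinity.
    refine (lintegral_liminf_le fun l => hmeas l n).trans ?_
    refine liminf_le_of_frequently_le' (Eventually.frequently ?_)
    filter_upwards [eventually_ge_atTop n] with l hl
    simp_rw [← ofReal_norm]
    rw [← ofReal_integral_eq_lintegral_ofReal (hI l n).norm.integrableOn
      (Eventually.of_forall fun ω => norm_nonneg _)]
    exact ENNReal.ofReal_le_ofReal (h n l hn hl)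
  set e : ℕ → ℝ := fun n => ∫ ω, ‖θ n ω - θ N ω‖ ∂P with he
  have he0 : ∀ n, 0 ≤ e n := fun n => integral_nonneg fun ω => norm_nonneg _
  have hp : ∀ n, 0 < τ n ^ (-q) := fun n => Real.rpow_pos_of_pos (hτ.pos n) _
  set S := ∑ n ∈ Finset.range N, e n with hS
  have hS0 : 0 ≤ S := Finset.sum_nonneg fun n _ => he0 n
  -- The enlarged constant also covers the finitely many times before `N`: their mean displacement
  -- is at most `S`, and `τ ^ (-q)` is larger there than at `N`.
  refine ⟨M + S / τ N ^ (-q), by have := hp N; positivity, fun n => ?_⟩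
  rcases le_or_gt N n with hn | hn
  · refine (hlarge n hn).trans (ENNReal.ofReal_le_ofReal ?_)
    have := hp N
    exact mul_le_mul_of_nonneg_right (by linarith [div_nonneg hS0 this.le]) (hp n).le
  · have h4 : ∫⁻ ω in A, ‖θ n ω - θs ω‖ₑ ∂P ≤
        ∫⁻ ω in A, ‖θ n ω - θ N ω‖ₑ ∂P + ∫⁻ ω in A, ‖θ N ω - θs ω‖ₑ ∂P := by
      rw [← lintegral_add_left (hmeas n N)]
      refine lintegral_mono fun ω => ?_
      rw [← sub_add_sub_cancel (θ n ω) (θ N ω) (θs ω)]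
      exact enorm_add_le _ _
    have h5 : ∫⁻ ω in A, ‖θ n ω - θ N ω‖ₑ ∂P ≤ ENNReal.ofReal (e n) := by
      refine (setLIntegral_le_lintegral A _).trans (le_of_eq ?_)
      simp_rw [← ofReal_norm]
      rw [← ofReal_integral_eq_lintegral_ofReal (hI n N).norm
        (Eventually.of_forall fun ω => norm_nonneg _)]
    refine h4.trans ((add_le_add h5 (hlarge N le_rfl)).trans ?_)
    rw [← ENNReal.ofReal_add (he0 n) (mul_nonneg hM (hp N).le)]
    refine ENNReal.ofReal_le_ofReal ?_
    have h6 : e n ≤ S := Finset.single_le_sum (f := e) (fun i _ => he0 i) (Finset.mem_range.2 hn)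
    have h7 : τ N ^ (-q) ≤ τ n ^ (-q) :=
      Real.rpow_le_rpow_of_nonpos (hτ.pos n) (hτ.monotone hn.le) (by linarith)
    calc e n + M * τ N ^ (-q) ≤ (M + S / τ N ^ (-q)) * τ N ^ (-q) := by
          have := (hp N).ne'
          field_simp; linarith
      _ ≤ _ := mul_le_mul_of_nonneg_left h7 (by have := hp N; positivity)

lemma RateClock.mono {τ : ℕ → ℝ} {x u : ℝ} {n₀ n₁ : ℕ} (h : RateClock γ α τ x u n₀)
    (hn : n₀ ≤ n₁) : RateClock γ α τ x u n₁ := by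
  obtain ⟨⟨C, hC, hα⟩, hx, hu, hl⟩ := h
  exact ⟨⟨C, ⟨hC.clock, hC.C_nonneg, hC.pos, fun k hk => hC.le k (hn.trans hk),
    fun k hk => hC.sq_le k (hn.trans hk)⟩, fun k hk => hα k (hn.trans hk)⟩, hx, hu, hl⟩

lemma RateClock.clock {τ : ℕ → ℝ} {x u : ℝ} {n₀ : ℕ} (h : RateClock γ α τ x u n₀) : IsClock τ := by
  obtain ⟨C, hC, -⟩ := h.bounds
  exact hC.clock

lemma RateClock.exists_length_bound {τ : ℕ → ℝ} {x u K : ℝ} {n₀ : ℕ}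
    (hR : RateClock γ α τ x u n₀) (hθ : IsSGD P X ξ g γ θ) (h1 : HolderSmooth F L α)
    (h2 : OracleBounds P X F g Cg κ c) (h3 : RobbinsMonro γ α) (hK : x < K)
    {U : Set (Vec m)} {A : Set Ω} (hA : MeasurableSet A) {v : ℝ}
    (hdrift : Drift F κ γ τ x K n₀ U v) (hAU : ∀ ω ∈ A, ∀ k, n₀ ≤ k → θ k ω ∈ U)
    {V : ℝ} (hV : 0 ≤ V) (hnoise : ∀ (a : ℕ → ℝ) (n l : ℕ), n₀ ≤ n →
      (∑ k ∈ Finset.Ico n l, a k *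
        ∫ ω in A, inner ℝ (gradient F (θ k ω)) (noise P X ξ g θ k ω) ∂P) ^ 2 ≤
        V * ∑ k ∈ Finset.Ico n l, a k ^ 2)
    (hlim : ∀ ε > 0, ∀ᶠ k in atTop, -ε ≤ ∫ ω in A, (F (θ k ω) - v) ∂P) :
    (∀ᵐ ω ∂P.restrict A, CauchySeq fun n => θ n ω) ∧
    ∃ M, 0 ≤ M ∧ ∀ n l, n₀ ≤ n → n ≤ l →
      ∫ ω in A, ‖θ l ω - θ n ω‖ ∂P ≤ M * τ n ^ (-((x + u - 1) / 2)) := by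
  obtain ⟨C₁, hΓ, hΓα⟩ := hR.bounds
  obtain ⟨C₂, hC₂, hd⟩ := hdrift
  have hδ : ∀ k, 0 ≤ (τ (k + 1) - τ k) * τ k ^ (-1 - x) := fun k =>
    mul_nonneg (sub_nonneg.2 (hΓ.clock.mono k)) (Real.rpow_pos_of_pos (hΓ.clock.pos k) _).le
  obtain ⟨M, hM, h⟩ := SGD.exists_length_bound hθ h1 h2 h3 (hΓ.mono (le_max_left C₁ C₂))
    (fun k hk => (hΓα k hk).trans (mul_le_mul_of_nonneg_right (le_max_left _ _) (hδ k)))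
    hR.x_pos hK hR.u_le hR.lt_x hA
    (fun k hk ω hω => (hd k hk _ (hAU ω hω k hk)).trans (add_le_add_right
      (mul_le_mul_of_nonneg_right (le_max_right _ _) (hδ k)) _)) hV hnoise hlim
  exact ⟨ae_cauchySeq_of_sum_le hθ h1 h2 h3 (fun l => (h n₀ l le_rfl).1),
    M, hM, fun n l hn hnl => (h n l hn).2 hnl⟩

/-- Convergence rate on the event that the iterates stay in a bounded region of dissipation and
that their energies converge to the reference value. -/
theorem RateClock.local_bound {τ : ℕ → ℝ} {x u K : ℝ} {n₀ : ℕ}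
    (hR : RateClock γ α τ x u n₀) (hθ : IsSGD P X ξ g γ θ) (h1 : HolderSmooth F L α)
    (h2 : OracleBounds P X F g Cg κ c) (h3 : RobbinsMonro γ α) (hK : x < K)
    {U : Set (Vec m)} (hU : MeasurableSet U) (hUb : Bornology.IsBounded U)
    {A : Set Ω} (hA : MeasurableSet A) {v : ℝ}
    (hdrift : Drift F κ γ τ x K n₀ U v) {N : ℕ}
    (hAU : ∀ ω ∈ A, (∀ k, N ≤ k → θ k ω ∈ U) ∧ Tendsto (fun n => F (θ n ω)) atTop (𝓝 v)) :
    (∀ᵐ ω ∂P.restrict A, CauchySeq fun n => θ n ω) ∧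
    ∃ N' M, 0 ≤ M ∧ ∀ n l, N' ≤ n → n ≤ l →
      ∫ ω in A, ‖θ l ω - θ n ω‖ ∂P ≤ M * τ n ^ (-((x + u - 1) / 2)) := by
  obtain ⟨C, hC, hd⟩ := hdrift
  have hcl : IsCompact (closure U) := hUb.isCompact_closure
  obtain ⟨B, hB⟩ := hcl.exists_bound_of_continuousOn h1.continuous_gradient.continuousOn
  obtain ⟨B', hB'⟩ := hcl.exists_bound_of_continuousOn
    (h1.continuous.sub (continuous_const (y := v))).continuousOn
  -- Cutting the gradient off outside the bounded set `U` makes it bounded, so its noise sums have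
  -- controlled second moments. On `A` the cutoff is invisible from time `N` on.
  have hψ : Measurable (U.indicator (gradient F)) :=
    h1.continuous_gradient.measurable.indicator hU
  have hψB : ∀ y, ‖U.indicator (gradient F) y‖ ≤ max B 0 := by
    intro y
    by_cases hy : y ∈ U
    · rw [indicator_of_mem hy]
      exact (hB y (subset_closure hy)).trans (le_max_left _ _)
    · rw [indicator_of_notMem hy, norm_zero]
      exact le_max_right _ _
  obtain ⟨V, hV0, hV⟩ := exists_integral_noiseSum_sq_le hθ h1 h2 h3 hψ hψB
  have h4 := (hR.mono (le_max_left n₀ N)).exists_length_bound hθ h1 h2 h3 hK hA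
    (U := U) (v := v) ⟨C, hC, fun k hk => hd k ((le_max_left _ _).trans hk)⟩
    (fun ω hω k hk => (hAU ω hω).1 k ((le_max_right _ _).trans hk)) hV0
    (fun a n l hn => by
      have e : ∀ k ∈ Finset.Ico n l, a k *
          ∫ ω in A, inner ℝ (gradient F (θ k ω)) (noise P X ξ g θ k ω) ∂P =
          ∫ ω in A, a k *
            inner ℝ (U.indicator (gradient F) (θ k ω)) (noise P X ξ g θ k ω) ∂P := by
        intro k hk
        rw [integral_const_mul]
        congr 1
        refine setIntegral_congr_fun hA fun ω hω => ?_
        have := (hAU ω hω).1 k ((le_max_right _ _).trans (hn.trans (Finset.mem_Ico.1 hk).1))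
        simp only [indicator_of_mem this]
      rw [Finset.sum_congr rfl e, ← integral_finsetSum _ fun k _ =>
        (((memLp_inner_noise hθ h1 h2 h3 hψ hψB k).integrable one_le_two).const_mul
          (a k)).integrableOn]
      have hmem := memLp_noiseSum hθ h1 h2 h3 hψ hψB a n l
      refine (sq_setIntegral_le hmem hA).trans (le_trans ?_ (hV a n l))
      exact setIntegral_le_integral hmem.integrable_sq
        (Eventually.of_forall fun ω => sq_nonneg _))
    (fun ε hε => by
      -- Dominated convergence: on `A` the energies are eventually bounded and tend to `v`.
      have h5 : Tendsto (fun k => ∫ ω in A, (F (θ k ω) - v) ∂P) atTop (𝓝 (∫ ω in A, (0 : ℝ) ∂P)) := by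
        refine tendsto_integral_filter_of_dominated_convergence (fun _ => B')
          (Eventually.of_forall fun k => ((h1.continuous.measurable.comp
            (measurable_iterate' hθ k)).sub_const v).aestronglyMeasurable) ?_
          (integrable_const _) ?_
        · filter_upwards [eventually_ge_atTop N] with k hk
          filter_upwards [ae_restrict_mem hA] with ω hω
          exact hB' _ (subset_closure ((hAU ω hω).1 k hk))
        · filter_upwards [ae_restrict_mem hA] with ω hω
          simpa using (hAU ω hω).2.sub_const v
      rw [integral_zero] at h5
      exact (h5.eventually (eventually_gt_nhds (neg_lt_zero.2 hε))).mono fun k hk => hk.le)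
  obtain ⟨h5, M, hM, h6⟩ := h4
  exact ⟨h5, _, M, hM, h6⟩

/-- Convergence rate when the energy excess over the infimum is dissipated everywhere. -/
theorem RateClock.global_bound {τ : ℕ → ℝ} {x u K : ℝ} {n₀ : ℕ}
    (hR : RateClock γ α τ x u n₀) (hθ : IsSGD P X ξ g γ θ) (h1 : HolderSmooth F L α)
    (h2 : OracleBounds P X F g Cg κ c) (h3 : RobbinsMonro γ α) (hK : x < K)
    (hdrift : Drift F κ γ τ x K n₀ univ (⨅ η, F η)) :
    ∃ M, 0 ≤ M ∧ ∀ n l, n₀ ≤ n → n ≤ l →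
      ∫ ω, ‖θ l ω - θ n ω‖ ∂P ≤ M * τ n ^ (-((x + u - 1) / 2)) := by
  have h4 := hR.exists_length_bound hθ h1 h2 h3 hK MeasurableSet.univ hdrift
    (fun ω _ k _ => mem_univ _) le_rfl
    -- The event is the whole space, so every noise mean vanishes and the noise constant is `0`.
    (fun a n l hn => by
      have e : ∀ k ∈ Finset.Ico n l, a k * ∫ ω in univ, inner ℝ (gradient F (θ k ω))
          (noise P X ξ g θ k ω) ∂P = 0 := fun k _ => by
        have hk := integrable_gap hθ h1 h2 h3 k
        rw [setIntegral_inner_noise hθ h1 h2 hk (measurable_gradient hθ h1 k)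
          (memLp_gradient hθ h1 hk) MeasurableSet.univ, mul_zero]
      rw [Finset.sum_eq_zero e]
      simp)
    (fun ε hε => Eventually.of_forall fun k => by
      have : 0 ≤ ∫ ω in univ, (F (θ k ω) - ⨅ η, F η) ∂P :=
        integral_nonneg fun ω => h1.gap_nonneg (θ k ω)
      linarith)
  simpa using h4.2

end Dynamics

/-! ### Clocks for polynomial step sizes -/

/-- The clock for polynomial rates. -/
def powerClock (k : ℕ) : ℝ := k + 1

/-- The clock for logarithmic rates. -/
noncomputable def logClock (k : ℕ) : ℝ := 1 + Real.log (k + 1)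

lemma isClock_powerClock : IsClock powerClock where
  one_le k := by simp [powerClock]
  mono k := by simp [powerClock]
  le_two_mul k := by
    have : (0 : ℝ) ≤ k := Nat.cast_nonneg k
    simp only [powerClock]; push_cast; linarith

lemma log_increment_le (k : ℕ) : Real.log ((k : ℝ) + 1 + 1) - Real.log (k + 1) ≤ 1 / (k + 1) := by
  have hk : (0 : ℝ) < k + 1 := by positivity
  rw [← Real.log_div (by positivity) hk.ne']
  have := Real.log_le_sub_one_of_pos (show 0 < ((k : ℝ) + 1 + 1) / (k + 1) by positivity)
  have e : ((k : ℝ) + 1 + 1) / (k + 1) - 1 = 1 / (k + 1) := by field_simp; ring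
  rwa [e] at this

lemma le_log_increment (k : ℕ) :
    1 / (2 * ((k : ℝ) + 1)) ≤ Real.log ((k : ℝ) + 1 + 1) - Real.log (k + 1) := by
  have hk : (0 : ℝ) < k + 1 := by positivity
  rw [← Real.log_div (by positivity) hk.ne']
  have h := Real.one_sub_inv_le_log_of_pos (show 0 < ((k : ℝ) + 1 + 1) / (k + 1) by positivity)
  refine le_trans ?_ h
  have e : 1 - (((k : ℝ) + 1 + 1) / (k + 1))⁻¹ = 1 / (k + 1 + 1) := by field_simp; ring
  rw [e]
  have : (0 : ℝ) ≤ k := Nat.cast_nonneg k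
  exact one_div_le_one_div_of_le (by positivity) (by linarith)

lemma logClock_increment (k : ℕ) :
    logClock (k + 1) - logClock k = Real.log ((k : ℝ) + 1 + 1) - Real.log (k + 1) := by
  simp [logClock]

lemma one_le_logClock (k : ℕ) : 1 ≤ logClock k := by
  have := Real.log_nonneg (show (1 : ℝ) ≤ k + 1 by simp)
  simp only [logClock]; linarith

lemma isClock_logClock : IsClock logClock where
  one_le := one_le_logClock
  mono k := by
    have h1 := logClock_increment k
    have h2 := le_log_increment k
    have : (0 : ℝ) ≤ 1 / (2 * ((k : ℝ) + 1)) := by positivity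
    linarith
  le_two_mul k := by
    have h1 := logClock_increment k
    have h2 := log_increment_le k
    have h3 := one_le_logClock k
    have : 1 / ((k : ℝ) + 1) ≤ 1 := by
      rw [div_le_one (by positivity)]; simp
    linarith

lemma exists_one_add_log_rpow_le {p w : ℝ} (hp : 0 < p) (hw : 0 < w) :
    ∃ C, 0 < C ∧ ∀ y : ℝ, 1 ≤ y → (1 + Real.log y) ^ p ≤ C * y ^ w := by
  set e := w / p with he
  have he0 : 0 < e := div_pos hw hp
  refine ⟨(1 + 1 / e) ^ p, by positivity, fun y hy => ?_⟩
  have hy0 : 0 ≤ y := zero_le_one.trans hy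
  have h1 := Real.log_le_rpow_div hy0 he0
  have h2 := Real.one_le_rpow hy he0.le
  have h3 : 1 + Real.log y ≤ (1 + 1 / e) * y ^ e := by
    rw [add_mul, one_mul, one_div_mul_eq_div]; linarith
  calc (1 + Real.log y) ^ p ≤ ((1 + 1 / e) * y ^ e) ^ p :=
        Real.rpow_le_rpow (by linarith [Real.log_nonneg hy]) h3 hp.le
    _ = (1 + 1 / e) ^ p * y ^ w := by
        rw [Real.mul_rpow (by positivity) (by positivity), ← Real.rpow_mul hy0, he]
        congr 2; field_simp

/-! ### Comparison of polynomial step sizes with the two clocks -/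

section Steps

variable {γ : ℕ → ℝ} {α s : ℝ}

/-- The index of `γ (k + 1)` is exactly `powerClock k`, which removes the shift by one. -/
lemma exists_step_bounds (hpos : ∀ n, 1 ≤ n → 0 < γ n)
    (h7 : γ =Θ[atTop] fun n : ℕ => 1 / (n : ℝ) ^ s) :
    ∃ c₁ c₂ : ℝ, 0 < c₁ ∧ 0 < c₂ ∧ ∃ n₀ : ℕ, ∀ k, n₀ ≤ k →
      c₁ * powerClock k ^ (-s) ≤ γ (k + 1) ∧ γ (k + 1) ≤ c₂ * powerClock k ^ (-s) := by
  obtain ⟨a, ha, hA⟩ := h7.1.exists_pos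
  obtain ⟨b, hb, hB⟩ := h7.2.exists_pos
  obtain ⟨n₀, hn₀⟩ := eventually_atTop.1 (hA.bound.and hB.bound)
  refine ⟨1 / b, a, by positivity, ha, n₀, fun k hk => ?_⟩
  obtain ⟨h1, h2⟩ := hn₀ (k + 1) (hk.trans (Nat.le_succ k))
  have hγ := hpos (k + 1) (Nat.le_add_left 1 k)
  have hp : 0 < powerClock k ^ (-s) := Real.rpow_pos_of_pos (isClock_powerClock.pos k) _
  have e : (1 : ℝ) / ((k + 1 : ℕ) : ℝ) ^ s = powerClock k ^ (-s) := by
    rw [Real.rpow_neg (isClock_powerClock.pos k).le, powerClock]; push_cast; simp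
  rw [e, Real.norm_of_nonneg hγ.le, Real.norm_of_nonneg hp.le] at h1 h2
  refine ⟨?_, h1⟩
  rw [one_div_mul_eq_div, div_le_iff₀ hb]; linarith

lemma powerClock_increment (k : ℕ) : powerClock (k + 1) - powerClock k = 1 := by
  simp [powerClock]

/-- The clock advances by one, so `u = s`. The condition `x ≤ s - 1/2` comes from `γ²`, `x ≤ (1 + α)
s - 1` from `γ^(1+α)`, and `1 - s < x` is what a finite length requires. -/
lemma exists_rateClock_power (hpos : ∀ n, 1 ≤ n → 0 < γ n)
    (h7 : γ =Θ[atTop] fun n : ℕ => 1 / (n : ℝ) ^ s) (hα : 0 < α) {x : ℝ} (hs : s ≤ 1)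
    (hx1 : x ≤ (1 + α) * s - 1) (hx2 : x ≤ s - 1 / 2) (hx3 : 1 - s < x) :
    ∃ n₀, RateClock γ α powerClock x s n₀ := by
  obtain ⟨c₁, c₂, -, hc₂, n₀, h⟩ := exists_step_bounds hpos h7
  refine ⟨n₀, ⟨max c₂ (max (c₂ ^ 2) (c₂ ^ (1 + α))), ⟨isClock_powerClock,
    le_max_of_le_left hc₂.le, fun k => hpos _ (Nat.le_add_left 1 k), fun k hk => ?_,
    fun k hk => ?_⟩, fun k hk => ?_⟩, by linarith, hs, hx3⟩
  all_goals
    have hτ := isClock_powerClock.pos k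
    have hτ1 := isClock_powerClock.one_le k
    have hγ := hpos (k + 1) (Nat.le_add_left 1 k)
    rw [powerClock_increment, one_mul]
  · exact (h k hk).2.trans (mul_le_mul_of_nonneg_right (le_max_left _ _)
      (Real.rpow_pos_of_pos hτ _).le)
  · calc γ (k + 1) ^ 2 ≤ (c₂ * powerClock k ^ (-s)) ^ 2 := by
          have := (h k hk).2
          gcongr
      _ = c₂ ^ 2 * powerClock k ^ (-(2 * s)) := by
          rw [mul_pow, ← Real.rpow_natCast (powerClock k ^ (-s)), ← Real.rpow_mul hτ.le]
          congr 2; push_cast; ring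
      _ ≤ _ := mul_le_mul ((le_max_left _ _).trans (le_max_right _ _))
          (Real.rpow_le_rpow_of_exponent_le hτ1 (by linarith))
          (Real.rpow_pos_of_pos hτ _).le (le_max_of_le_left hc₂.le)
  · calc γ (k + 1) ^ (1 + α) ≤ (c₂ * powerClock k ^ (-s)) ^ (1 + α) :=
          Real.rpow_le_rpow hγ.le (h k hk).2 (by linarith)
      _ = c₂ ^ (1 + α) * powerClock k ^ (-((1 + α) * s)) := by
          rw [Real.mul_rpow hc₂.le (Real.rpow_pos_of_pos hτ _).le, ← Real.rpow_mul hτ.le]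
          congr 2; ring
      _ ≤ _ := mul_le_mul ((le_max_right _ _).trans (le_max_right _ _))
          (Real.rpow_le_rpow_of_exponent_le hτ1 (by linarith))
          (Real.rpow_pos_of_pos hτ _).le (le_max_of_le_left hc₂.le)

/-- The increments of the logarithmic clock are of order `1 / (k + 1)`, so any additional polynomial
decay beats every power of the clock. -/
lemma exists_inv_le_logClock {p w : ℝ} (hp : 0 < p) (hw : 0 < w) :
    ∃ C, 0 < C ∧ ∀ k, powerClock k ^ (-1 - w) ≤
      C * ((logClock (k + 1) - logClock k) * logClock k ^ (-p)) := by
  obtain ⟨C, hC, h⟩ := exists_one_add_log_rpow_le hp hw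
  refine ⟨2 * C, by positivity, fun k => ?_⟩
  have hτ := isClock_powerClock.pos k
  have hl := isClock_logClock.pos k
  have h1 := h (powerClock k) (isClock_powerClock.one_le k)
  have h2 : logClock k ^ p ≤ C * powerClock k ^ w := h1
  have h3 := le_log_increment k
  rw [← logClock_increment] at h3
  have hw' := Real.rpow_pos_of_pos hτ w
  have hl' := Real.rpow_pos_of_pos hl p
  have h4 : powerClock k ^ (-w) ≤ C * logClock k ^ (-p) := by
    rw [Real.rpow_neg hτ.le, Real.rpow_neg hl.le, ← div_eq_mul_inv, le_div_iff₀ hl',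
      inv_mul_le_iff₀ hw']
    linarith
  have h5 : powerClock k ^ (-1 - w) = (powerClock k)⁻¹ * powerClock k ^ (-w) := by
    rw [sub_eq_add_neg, Real.rpow_add hτ, Real.rpow_neg_one]
  have h6 : (powerClock k)⁻¹ ≤ 2 * (logClock (k + 1) - logClock k) := by
    have : (powerClock k)⁻¹ = 2 * (1 / (2 * ((k : ℝ) + 1))) := by
      rw [powerClock]; field_simp
    rw [this]; linarith
  rw [h5]
  calc _ ≤ (2 * (logClock (k + 1) - logClock k)) * (C * logClock k ^ (-p)) :=
        mul_le_mul h6 h4 (Real.rpow_pos_of_pos hτ _).le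
          ((inv_pos.2 hτ).le.trans h6)
    _ = _ := by ring

/-- Steps of order `1 / n` are comparable to the increments of this clock, hence `u = 0`, while `γ²`
and `γ^(1+α)` are polynomially smaller. The noise thus puts no upper limit on `x`; finite length
asks for `x > 1`. -/
lemma exists_rateClock_log (hpos : ∀ n, 1 ≤ n → 0 < γ n)
    (h7 : γ =Θ[atTop] fun n : ℕ => 1 / (n : ℝ) ^ (1 : ℝ)) (hα : 0 < α) {x : ℝ} (hx : 1 < x) :
    ∃ n₀, RateClock γ α logClock x 0 n₀ := by
  obtain ⟨c₁, c₂, -, hc₂, n₀, h⟩ := exists_step_bounds hpos h7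
  obtain ⟨C₁, hC₁, h1⟩ := exists_inv_le_logClock (p := 1 + 2 * x) (w := 1) (by linarith) one_pos
  obtain ⟨C₂, hC₂, h2⟩ := exists_inv_le_logClock (p := 1 + x) (w := α) (by linarith) hα
  have hδ : ∀ k, 0 ≤ logClock (k + 1) - logClock k := fun k =>
    sub_nonneg.2 (isClock_logClock.mono k)
  refine ⟨n₀, ⟨max (2 * c₂) (max (c₂ ^ 2 * C₁) (c₂ ^ (1 + α) * C₂)), ⟨isClock_logClock,
    le_max_of_le_left (by positivity), fun k => hpos _ (Nat.le_add_left 1 k), fun k hk => ?_,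
    fun k hk => ?_⟩, fun k hk => ?_⟩, by linarith, zero_le_one, by linarith⟩
  all_goals
    have hτ := isClock_powerClock.pos k
    have hl := isClock_logClock.pos k
    have hγ := hpos (k + 1) (Nat.le_add_left 1 k)
  · rw [neg_zero, Real.rpow_zero, mul_one]
    have h3 := le_log_increment k
    rw [← logClock_increment] at h3
    have h4 : powerClock k ^ (-1 : ℝ) = 2 * (1 / (2 * ((k : ℝ) + 1))) := by
      rw [Real.rpow_neg_one, powerClock]; field_simp
    calc γ (k + 1) ≤ c₂ * (2 * (1 / (2 * ((k : ℝ) + 1)))) := h4 ▸ (h k hk).2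
      _ ≤ c₂ * (2 * (logClock (k + 1) - logClock k)) := by gcongr
      _ = (2 * c₂) * (logClock (k + 1) - logClock k) := by ring
      _ ≤ _ := mul_le_mul_of_nonneg_right (le_max_left _ _) (hδ k)
  · calc γ (k + 1) ^ 2 ≤ (c₂ * powerClock k ^ (-1 : ℝ)) ^ 2 := by
          have := (h k hk).2
          gcongr
      _ = c₂ ^ 2 * powerClock k ^ (-1 - 1 : ℝ) := by
          rw [mul_pow, ← Real.rpow_natCast (powerClock k ^ (-1 : ℝ)), ← Real.rpow_mul hτ.le]
          congr 2; push_cast; ring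
      _ ≤ c₂ ^ 2 * (C₁ * ((logClock (k + 1) - logClock k) * logClock k ^ (-(1 + 2 * x)))) :=
          mul_le_mul_of_nonneg_left (h1 k) (sq_nonneg _)
      _ = c₂ ^ 2 * C₁ * ((logClock (k + 1) - logClock k) * logClock k ^ (-1 - 2 * x)) := by
          rw [mul_assoc, show -(1 + 2 * x) = -1 - 2 * x by ring]
      _ ≤ _ := mul_le_mul_of_nonneg_right ((le_max_left _ _).trans (le_max_right _ _))
          (mul_nonneg (hδ k) (Real.rpow_pos_of_pos hl _).le)
  · calc γ (k + 1) ^ (1 + α) ≤ (c₂ * powerClock k ^ (-1 : ℝ)) ^ (1 + α) :=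
          Real.rpow_le_rpow hγ.le (h k hk).2 (by linarith)
      _ = c₂ ^ (1 + α) * powerClock k ^ (-1 - α) := by
          rw [Real.mul_rpow hc₂.le (Real.rpow_pos_of_pos hτ _).le, ← Real.rpow_mul hτ.le]
          congr 2; ring
      _ ≤ c₂ ^ (1 + α) * (C₂ * ((logClock (k + 1) - logClock k) * logClock k ^ (-(1 + x)))) :=
          mul_le_mul_of_nonneg_left (h2 k) (by positivity)
      _ = c₂ ^ (1 + α) * C₂ * ((logClock (k + 1) - logClock k) * logClock k ^ (-1 - x)) := by
          rw [mul_assoc, show -(1 + x) = -1 - x by ring]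
      _ ≤ _ := mul_le_mul_of_nonneg_right ((le_max_right _ _).trans (le_max_right _ _))
          (mul_nonneg (hδ k) (Real.rpow_pos_of_pos hl _).le)

/-- When `γ_n` is of order `1 / n`, regularity identifies the limit of `n γ_n`. -/
lemma tendsto_mul_step (hpos : ∀ n, 1 ≤ n → 0 < γ n)
    (h7 : γ =Θ[atTop] fun n : ℕ => 1 / (n : ℝ) ^ (1 : ℝ)) {ρ γstar : ℝ}
    (h6 : RateRegularity γ α ρ γstar) :
    0 < γstar ∧ Tendsto (fun k : ℕ => ((k : ℝ) + 1) * γ (k + 1)) atTop (𝓝 γstar) := by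
  obtain ⟨c₁, c₂, hc₁, hc₂, n₀, hb⟩ := exists_step_bounds hpos h7
  have hγ0 : Tendsto γ atTop (𝓝 0) := by
    refine h7.1.trans_tendsto ?_
    simp only [Real.rpow_one]
    exact tendsto_const_div_atTop_nhds_zero_nat 1
  have hγp : ∀ k, 0 < γ (k + 1) := fun k => hpos _ (Nat.le_add_left 1 k)
  have hγ0' : Tendsto (fun k => γ (k + 1)) atTop (𝓝 0) := hγ0.comp (tendsto_add_atTop_nat 1)
  -- the logarithmic increments divided by the step sizes converge
  obtain ⟨q, hq, hqstar⟩ : ∃ q, Tendsto (fun n => Real.log (γ (n - 1) / γ n) / γ n) atTop (𝓝 q) ∧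
      (q = 0 ∨ (0 < γstar ∧ q = 1 / γstar)) := by
    rcases h6.log_ratio with h | ⟨hs, h⟩
    · exact ⟨0, h.tendsto_div_nhds_zero, Or.inl rfl⟩
    · refine ⟨1 / γstar, ?_, Or.inr ⟨hs, rfl⟩⟩
      have hne : ∀ᶠ n in atTop, γ n / γstar ≠ 0 := by
        filter_upwards [eventually_ge_atTop 1] with n hn
        exact (div_pos (hpos n hn) hs).ne'
      have h1 := ((isEquivalent_iff_tendsto_one hne).1 h).mul_const (1 / γstar)
      rw [one_mul] at h1
      refine h1.congr' ?_
      filter_upwards [eventually_ge_atTop 1] with n hn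
      have := (hpos n hn).ne'
      simp only [Pi.div_apply]
      field_simp
  have hq' : Tendsto (fun k => Real.log (γ (k + 1) / γ (k + 2)) / γ (k + 2)) atTop (𝓝 q) :=
    (hq.comp (tendsto_add_atTop_nat 2)).congr fun k => by simp
  set l : ℕ → ℝ := fun k => Real.log (γ (k + 1) / γ (k + 2)) with hl
  have hl0 : Tendsto l atTop (𝓝 0) := by
    have h1 := hq'.mul (hγ0.comp (tendsto_add_atTop_nat 2))
    rw [mul_zero] at h1
    refine h1.congr fun k => ?_
    have := (hγp (k + 1)).ne'
    simp only [Function.comp]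
    field_simp
    rfl
  have hexp : ∀ k, γ (k + 1) = γ (k + 2) * Real.exp (l k) := fun k => by
    rw [hl, Real.exp_log (div_pos (hγp k) (hγp (k + 1)))]
    have := (hγp (k + 1)).ne'
    field_simp
  -- increments of the inverse step sizes
  have hinc : Tendsto (fun k => 1 / γ (k + 2) - 1 / γ (k + 1)) atTop (𝓝 q) := by
    have hup : ∀ k, 1 / γ (k + 2) - 1 / γ (k + 1) ≤ l k / γ (k + 2) := fun k => by
      have h1 := Real.add_one_le_exp (-l k)
      have h2 : 1 / γ (k + 1) = Real.exp (-l k) / γ (k + 2) := by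
        rw [hexp k, Real.exp_neg]
        have := (hγp (k + 1)).ne'
        field_simp
      rw [h2, ← sub_div]
      exact div_le_div_of_nonneg_right (by linarith) (hγp (k + 1)).le
    have hlow : ∀ k, l k / γ (k + 2) * Real.exp (-l k) ≤ 1 / γ (k + 2) - 1 / γ (k + 1) := fun k => by
      have h1 := Real.add_one_le_exp (l k)
      have h2 : 1 / γ (k + 2) - 1 / γ (k + 1) =
          (Real.exp (l k) - 1) / γ (k + 2) * Real.exp (-l k) := by
        rw [hexp k, Real.exp_neg]
        have := (hγp (k + 1)).ne'
        have := (Real.exp_pos (l k)).ne'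
        field_simp
      rw [h2]
      exact mul_le_mul_of_nonneg_right (div_le_div_of_nonneg_right (by linarith) (hγp (k + 1)).le)
        (Real.exp_pos _).le
    have hexp1 : Tendsto (fun k => Real.exp (-l k)) atTop (𝓝 1) := by
      have := (Real.continuous_exp.tendsto (-0)).comp hl0.neg
      rwa [neg_zero, Real.exp_zero] at this
    have h1 := hq'.mul hexp1
    rw [mul_one] at h1
    exact tendsto_of_tendsto_of_tendsto_of_le_of_le h1 hq' hlow hup
  -- Averaging the increments of `1 / γ` gives the limit of `1 / (n γ_n)`.
  have hces := hinc.cesaro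
  have hces' : Tendsto (fun n : ℕ => (n : ℝ)⁻¹ * (1 / γ (n + 1) - 1 / γ 1)) atTop (𝓝 q) :=
    hces.congr fun n => by rw [Finset.sum_range_sub (fun k => 1 / γ (k + 1))]
  have hmain : Tendsto (fun n : ℕ => (((n : ℝ) + 1) * γ (n + 1))⁻¹) atTop (𝓝 q) := by
    have h0 : Tendsto (fun n : ℕ => (n : ℝ)⁻¹) atTop (𝓝 0) := tendsto_inv_atTop_nhds_zero_nat
    have h1 : Tendsto (fun n : ℕ => (n : ℝ) / ((n : ℝ) + 1)) atTop (𝓝 1) :=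
      tendsto_natCast_div_add_atTop 1
    have h2 := (hces'.add (h0.mul_const (1 / γ 1))).mul h1
    rw [zero_mul, add_zero, mul_one] at h2
    refine h2.congr' ?_
    filter_upwards [eventually_ge_atTop 1] with n hn
    have hn0 : (n : ℝ) ≠ 0 := by positivity
    have := (hγp n).ne'
    have := (hγp 0).ne'
    field_simp
    ring
  -- The upper bound on `n γ_n` forces a positive limit, which excludes the alternative `o(γ_n)`.
  have hqpos : 1 / c₂ ≤ q := by
    refine ge_of_tendsto hmain ?_
    filter_upwards [eventually_ge_atTop n₀] with n hn
    rw [one_div]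
    have h1 := (hb n hn).2
    rw [Real.rpow_neg_one, powerClock, ← div_eq_mul_inv, le_div_iff₀ (by positivity)] at h1
    exact inv_anti₀ (mul_pos (by positivity) (hγp n)) (by linarith)
  have hq0 : 0 < q := (by positivity : 0 < 1 / c₂).trans_le hqpos
  rcases hqstar with h | ⟨hs, h⟩
  · exact absurd h hq0.ne'
  · refine ⟨hs, ?_⟩
    have h1 := hmain.inv₀ hq0.ne'
    simpa [h] using h1

/-- For `s < 1` the product of step and clock grows without bound, so any `Q` is reached. For `s =
1` it tends to `γstar`; this is where the thresholds on `κ γstar` enter. -/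
lemma eventually_le_mul_step (hpos : ∀ n, 1 ≤ n → 0 < γ n)
    (h7 : γ =Θ[atTop] fun n : ℕ => 1 / (n : ℝ) ^ s) {ρ γstar : ℝ}
    (h6 : RateRegularity γ α ρ γstar) (hs : s ≤ 1) {κ Q : ℝ} (hκ : 0 < κ)
    (hQ : s = 1 → Q < κ * γstar) :
    ∀ᶠ k : ℕ in atTop, Q ≤ κ * γ (k + 1) * powerClock k := by
  rcases hs.eq_or_lt with rfl | hs
  · obtain ⟨-, h⟩ := tendsto_mul_step hpos h7 h6
    refine ((h.const_mul κ).eventually (eventually_gt_nhds (hQ rfl))).mono fun k hk => ?_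
    rw [powerClock]; linarith
  · obtain ⟨c₁, c₂, hc₁, hc₂, n₀, hb⟩ := exists_step_bounds hpos h7
    have h1 : Tendsto (fun k : ℕ => κ * (c₁ * powerClock k ^ (1 - s))) atTop atTop := by
      refine (((tendsto_rpow_atTop (sub_pos.2 hs)).comp ?_).const_mul_atTop hc₁).const_mul_atTop hκ
      exact tendsto_atTop_add_const_right _ _ tendsto_natCast_atTop_atTop
    filter_upwards [h1.eventually (eventually_ge_atTop Q), eventually_ge_atTop n₀] with k hk hk'
    refine hk.trans ?_
    have hτ := isClock_powerClock.pos k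
    rw [mul_assoc]
    refine mul_le_mul_of_nonneg_left ?_ hκ.le
    have : powerClock k ^ (1 - s) = powerClock k ^ (-s) * powerClock k := by
      rw [sub_eq_add_neg, add_comm, Real.rpow_add hτ, Real.rpow_one]
    rw [this, ← mul_assoc]
    exact mul_le_mul_of_nonneg_right (hb k hk').1 hτ.le

end Steps

/-! ### Dissipation from the Łojasiewicz inequality -/

section Dissipation

variable {m : ℕ} {F : Vec m → ℝ} {κ : ℝ} {γ τ : ℕ → ℝ} {x K : ℝ} {n₀ : ℕ} {U : Set (Vec m)} {v : ℝ}

/-- The contraction factor is at most `K Δτ / τ` and the excess at most `Z ‖∇F‖²`, so the step size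
condition gives the drift with zero remainder. -/
lemma drift_of_quadratic (hτ : IsClock τ) (hK : 0 ≤ K) {Z : ℝ}
    (hZ : ∀ t ∈ U, |F t - v| ≤ Z * ‖gradient F t‖ ^ 2)
    (h : ∀ k, n₀ ≤ k → K * Z * ((τ (k + 1) - τ k) / τ k) ≤ κ * γ (k + 1)) :
    Drift F κ γ τ x K n₀ U v := by
  refine ⟨0, le_rfl, fun k hk t ht => ?_⟩
  have hδ : 0 ≤ (τ (k + 1) - τ k) / τ k :=
    div_nonneg (sub_nonneg.2 (hτ.mono k)) (hτ.pos k).le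
  calc contraction τ K k * (F t - v) ≤ contraction τ K k * |F t - v| :=
        mul_le_mul_of_nonneg_left (le_abs_self _) (hτ.contraction_nonneg hK k)
    _ ≤ (K * ((τ (k + 1) - τ k) / τ k)) * (Z * ‖gradient F t‖ ^ 2) :=
        mul_le_mul (hτ.contraction_le hK k) (hZ t ht) (abs_nonneg _) (mul_nonneg hK hδ)
    _ = (K * Z * ((τ (k + 1) - τ k) / τ k)) * ‖gradient F t‖ ^ 2 := by ring
    _ ≤ κ * γ (k + 1) * ‖gradient F t‖ ^ 2 :=
        mul_le_mul_of_nonneg_right (h k hk) (sq_nonneg _)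
    _ ≤ _ := by linarith

/-- An excess below `A τ^(-x)` contracts at a cost admitted in the remainder. Above this level,
`V^(2β) ≥ (A τ^(-x))^(2β-1) V`, so the Łojasiewicz inequality acts like a quadratic one whose
constant depends on the clock. -/
lemma drift_of_superquadratic (hτ : IsClock τ) (hκ : 0 < κ) (hK : 0 < K) {β ζ b : ℝ}
    (hβ : 1 / 2 < β) (hζ : 0 < ζ) (hb : 0 < b) (hγ : ∀ k, 0 < γ (k + 1))
    (hU : ∀ t ∈ U, |F t - v| ^ β ≤ ζ * ‖gradient F t‖)
    (h : ∀ k, n₀ ≤ k → b * (τ (k + 1) - τ k) ≤ γ (k + 1) * τ k ^ (1 - x * (2 * β - 1))) :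
    Drift F κ γ τ x K n₀ U v := by
  have hβ1 : 0 < 2 * β - 1 := by linarith
  -- The level at which the dissipation of a large excess exactly balances the required contraction.
  set A : ℝ := (K * ζ ^ 2 / (κ * b)) ^ (1 / (2 * β - 1)) with hA
  have hbase : 0 < K * ζ ^ 2 / (κ * b) := by positivity
  have hA0 : 0 < A := Real.rpow_pos_of_pos hbase _
  have hAβ : A ^ (2 * β - 1) = K * ζ ^ 2 / (κ * b) := by
    rw [hA, ← Real.rpow_mul hbase.le, one_div_mul_cancel hβ1.ne', Real.rpow_one]
  refine ⟨K * A, by positivity, fun k hk t ht => ?_⟩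
  have hτ0 := hτ.pos k
  have hδ := sub_nonneg.2 (hτ.mono k)
  have hδτ : 0 ≤ (τ (k + 1) - τ k) / τ k := div_nonneg hδ hτ0.le
  have hτx := Real.rpow_pos_of_pos hτ0 (-x)
  have hγk := hγ k
  have ha0 := hτ.contraction_nonneg hK.le k
  have ha1 := hτ.contraction_le hK.le k
  have hG : 0 ≤ κ * γ (k + 1) * ‖gradient F t‖ ^ 2 := by positivity
  have e1 : (τ (k + 1) - τ k) * τ k ^ (-1 - x) = (τ (k + 1) - τ k) / τ k * τ k ^ (-x) := by
    rw [sub_eq_add_neg (-1) x, Real.rpow_add hτ0, Real.rpow_neg_one]; ring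
  rw [e1]
  rcases le_or_gt (F t - v) (A * τ k ^ (-x)) with hsmall | hbig
  · calc contraction τ K k * (F t - v) ≤ contraction τ K k * (A * τ k ^ (-x)) :=
          mul_le_mul_of_nonneg_left hsmall ha0
      _ ≤ (K * ((τ (k + 1) - τ k) / τ k)) * (A * τ k ^ (-x)) :=
          mul_le_mul_of_nonneg_right ha1 (by positivity)
      _ = K * A * ((τ (k + 1) - τ k) / τ k * τ k ^ (-x)) := by ring
      _ ≤ _ := by linarith
  · set V := F t - v with hV
    have hV0 : 0 < V := (mul_pos hA0 hτx).trans hbig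
    have h1 := hU t ht
    rw [← hV, abs_of_pos hV0] at h1
    have h2 : V * V ^ (2 * β - 1) ≤ ζ ^ 2 * ‖gradient F t‖ ^ 2 := by
      have h3 : (V ^ β) ^ 2 ≤ (ζ * ‖gradient F t‖) ^ 2 := by gcongr
      rw [← mul_pow]
      refine le_trans (le_of_eq ?_) h3
      rw [← Real.rpow_natCast (V ^ β), ← Real.rpow_mul hV0.le, ← Real.rpow_one_add' hV0.le
        (by linarith)]
      congr 1; push_cast; ring
    have h3 : A ^ (2 * β - 1) * τ k ^ (-(x * (2 * β - 1))) ≤ V ^ (2 * β - 1) := by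
      have := Real.rpow_le_rpow (mul_pos hA0 hτx).le hbig.le hβ1.le
      rwa [Real.mul_rpow hA0.le hτx.le, ← Real.rpow_mul hτ0.le, neg_mul] at this
    have h4 : b * ((τ (k + 1) - τ k) / τ k) ≤ γ (k + 1) * τ k ^ (-(x * (2 * β - 1))) := by
      have := h k hk
      rw [sub_eq_add_neg 1, Real.rpow_add hτ0, Real.rpow_one] at this
      rw [← mul_div_assoc, div_le_iff₀ hτ0]
      linarith
    have h5 : K * ((τ (k + 1) - τ k) / τ k) * V ≤ κ * γ (k + 1) * ‖gradient F t‖ ^ 2 := by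
      have h6 : (κ / ζ ^ 2) * γ (k + 1) * (V * V ^ (2 * β - 1)) ≤
          κ * γ (k + 1) * ‖gradient F t‖ ^ 2 := by
        calc _ ≤ (κ / ζ ^ 2) * γ (k + 1) * (ζ ^ 2 * ‖gradient F t‖ ^ 2) := by gcongr
          _ = _ := by field_simp
      refine le_trans ?_ h6
      calc K * ((τ (k + 1) - τ k) / τ k) * V =
            (κ / ζ ^ 2) * A ^ (2 * β - 1) * V * (b * ((τ (k + 1) - τ k) / τ k)) := by
            rw [hAβ]; field_simp
        _ ≤ (κ / ζ ^ 2) * A ^ (2 * β - 1) * V * (γ (k + 1) * τ k ^ (-(x * (2 * β - 1)))) := by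
            gcongr
        _ = (κ / ζ ^ 2) * γ (k + 1) * (V * (A ^ (2 * β - 1) * τ k ^ (-(x * (2 * β - 1))))) := by
            ring
        _ ≤ _ := by gcongr
    have h7 : 0 ≤ K * A * ((τ (k + 1) - τ k) / τ k * τ k ^ (-x)) := by positivity
    have h8 := mul_le_mul_of_nonneg_right ha1 hV0.le
    linarith

end Dissipation

/-! ### From clock times to iteration counts -/

/-- The rate `τ ^ (-q)` reaches the tolerance `ε` within the prescribed iteration count, up to a
constant that depends on the proportionality factor only. -/
def Attains (τ : ℕ → ℝ) (q : ℝ) (count : ℝ → ℝ → ℕ) (σ₀ : ℝ) : Prop :=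
  ∀ a > (0 : ℝ), ∃ C > (0 : ℝ), ∀ σ ∈ Ico σ₀ 1, ∀ ε > (0 : ℝ),
    τ (proportional a (count ε σ)) ^ (-q) ≤ C * ε

lemma le_proportional (a : ℝ) (ha : 0 < a) (M : ℝ) : a * M ≤ proportional a ⌈M⌉₊ :=
  (mul_le_mul_of_nonneg_left (Nat.le_ceil M) ha.le).trans (Nat.le_ceil _)

/-- The exponent is at least one exactly because `σ ≥ σ₀`. -/
lemma rpow_div_le_self {ε σ₀ σ : ℝ} (hε : 0 < ε) (hε1 : ε ≤ 1) (hσ : σ ∈ Ico σ₀ 1) :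
    ε ^ ((1 - σ₀) / (1 - σ)) ≤ ε := by
  have h1 : 0 < 1 - σ := sub_pos.2 hσ.2
  have h2 : 1 ≤ (1 - σ₀) / (1 - σ) := by
    rw [one_le_div h1]; linarith [hσ.1]
  calc ε ^ ((1 - σ₀) / (1 - σ)) ≤ ε ^ (1 : ℝ) := Real.rpow_le_rpow_of_exponent_ge hε hε1 h2
    _ = ε := Real.rpow_one ε

lemma attains_of_one_le {τ : ℕ → ℝ} (hτ : IsClock τ) {q C ε : ℝ} (hq : 0 ≤ q) (hC : 1 ≤ C)
    (hε : 1 ≤ ε) (n : ℕ) : τ n ^ (-q) ≤ C * ε :=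
  calc τ n ^ (-q) ≤ 1 := Real.rpow_le_one_of_one_le_of_nonpos (hτ.one_le n) (neg_nonpos.2 hq)
    _ ≤ C * ε := one_le_mul_of_one_le_of_one_le hC hε

/-- The count makes `n` at least `a ε^(-p/(1-σ))`, and its power `-(1-σ₀)/p` is of order
`ε^((1-σ₀)/(1-σ)) ≤ ε`. A larger `q` only helps, since the clock is at least one. -/
lemma attains_power {p q σ₀ : ℝ} (hp : 0 < p) (hσ₀ : σ₀ < 1) (hq : (1 - σ₀) / p ≤ q) :
    Attains powerClock q (fun ε σ => ⌈ε ^ (-1 / (1 - σ) * p)⌉₊) σ₀ := by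
  intro a ha
  set t := (1 - σ₀) / p with ht
  have ht0 : 0 < t := div_pos (sub_pos.2 hσ₀) hp
  refine ⟨max 1 (a ^ (-t)), by positivity, fun σ hσ ε hε => ?_⟩
  rcases le_total 1 ε with h | h
  · exact attains_of_one_le isClock_powerClock (ht0.le.trans hq) (le_max_left _ _) h _
  set M := ε ^ (-1 / (1 - σ) * p) with hM
  have hM0 : 0 < M := Real.rpow_pos_of_pos hε _
  set n := proportional a ⌈M⌉₊ with hn
  have h1 : a * M ≤ powerClock n := (le_proportional a ha M).trans (by rw [powerClock]; linarith)
  have h2 : M ^ (-t) = ε ^ ((1 - σ₀) / (1 - σ)) := by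
    rw [hM, ← Real.rpow_mul hε.le, ht]
    have := (sub_pos.2 hσ.2).ne'
    congr 1; field_simp
  calc powerClock n ^ (-q) ≤ powerClock n ^ (-t) :=
        Real.rpow_le_rpow_of_exponent_le (isClock_powerClock.one_le n) (by linarith)
    _ ≤ (a * M) ^ (-t) := Real.rpow_le_rpow_of_nonpos (by positivity) h1 (by linarith)
    _ = a ^ (-t) * ε ^ ((1 - σ₀) / (1 - σ)) := by rw [Real.mul_rpow ha.le hM0.le, h2]
    _ ≤ max 1 (a ^ (-t)) * ε :=
        mul_le_mul (le_max_right _ _) (rpow_div_le_self hε h hσ) (by positivity) (by positivity)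

lemma attains_log {r σ₀ : ℝ} (hr : 0 < r) (hσ₀ : σ₀ < 1) :
    Attains logClock (r * (1 - σ₀))
      (fun ε σ => ⌈Real.exp (ε ^ (-(1 / (r * (1 - σ)))))⌉₊) σ₀ := by
  intro a ha
  set q := r * (1 - σ₀) with hq
  have hq0 : 0 < q := mul_pos hr (sub_pos.2 hσ₀)
  have hl : 1 ≤ 1 + |Real.log a| := by linarith [abs_nonneg (Real.log a)]
  have hl0 : 0 < 1 + |Real.log a| := by linarith
  refine ⟨(1 + |Real.log a|) ^ q, by positivity, fun σ hσ ε hε => ?_⟩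
  rcases le_total 1 ε with h | h
  · exact attains_of_one_le isClock_logClock hq0.le (Real.one_le_rpow hl hq0.le) h _
  set E := ε ^ (-(1 / (r * (1 - σ)))) with hE
  have hE0 : 0 < E := Real.rpow_pos_of_pos hε _
  set n := proportional a ⌈Real.exp E⌉₊ with hn
  have h1 : a * Real.exp E ≤ (n : ℝ) + 1 :=
    (le_proportional a ha _).trans (by linarith)
  have h2 : Real.log a + E ≤ Real.log (n + 1) := by
    have := Real.log_le_log (by positivity) h1
    rwa [Real.log_mul ha.ne' (Real.exp_pos _).ne', Real.log_exp] at this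
  have h3 : E / (1 + |Real.log a|) ≤ logClock n := by
    -- The proportionality factor shifts the logarithm by `log a`, possibly negative; as the clock
    -- is at least one, the shift costs only the factor `1 + |log a|`.
    rw [div_le_iff₀ hl0, mul_add]
    have h4 := mul_le_mul_of_nonneg_right (one_le_logClock n) (abs_nonneg (Real.log a))
    have h5 : logClock n = 1 + Real.log (n + 1) := rfl
    linarith [neg_abs_le (Real.log a)]
  have h4 : E ^ (-q) = ε ^ ((1 - σ₀) / (1 - σ)) := by
    rw [hE, ← Real.rpow_mul hε.le, hq]
    have := (sub_pos.2 hσ.2).ne'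
    congr 1; field_simp
  calc logClock n ^ (-q) ≤ (E / (1 + |Real.log a|)) ^ (-q) :=
        Real.rpow_le_rpow_of_nonpos (by positivity) h3 (by linarith)
    _ = (1 + |Real.log a|) ^ q * ε ^ ((1 - σ₀) / (1 - σ)) := by
        rw [Real.div_rpow hE0.le hl0.le, h4, Real.rpow_neg hl0.le, div_inv_eq_mul, mul_comm]
    _ ≤ _ := mul_le_mul_of_nonneg_left (rpow_div_le_self hε h hσ) (by positivity)

/-! ### Arithmetic of the exponents -/

section Exponents

variable {α ρ s β : ℝ}

/-- The range of the parameters. -/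
structure Admissible (α ρ s : ℝ) : Prop where
  α_pos : 0 < α
  s_le_one : s ≤ 1
  three_lt : 3 < ρ
  two_lt : 2 < α * ρ
  le_mul : ρ ≤ s * (1 + ρ)

lemma Admissible.of_le (hα : 0 < α) (hs1 : s ≤ 1) (hρ : max 3 (2 / α) < ρ)
    (hs : ρ / (1 + ρ) ≤ s) : Admissible α ρ s := by
  have h3 : 3 < ρ := (le_max_left _ _).trans_lt hρ
  refine ⟨hα, hs1, h3, ?_, ?_⟩
  · have := (le_max_right _ _).trans_lt hρ
    rwa [div_lt_iff₀ hα, mul_comm] at this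
  · rwa [div_le_iff₀ (by linarith)] at hs

namespace Admissible

lemma s_gt (h : Admissible α ρ s) : 3 / 4 < s := by
  have := h.le_mul; have := h.three_lt
  by_contra! hc
  nlinarith

/-- The form in which `s ≥ ρ / (1 + ρ)` is used: multiplying it by `1 + μ`, a value `s (1 + μ) ≤ 1`
would give `μ ρ ≤ 1`. The instances are `μ = α / 2` and `μ = min α (1/2)`. -/
lemma one_lt_mul {μ : ℝ} (h : Admissible α ρ s) (hμ0 : 0 ≤ μ) (hμ : 1 < μ * ρ) :
    1 < s * (1 + μ) := by
  have h1 := h.le_mul; have h3 := h.three_lt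
  have h4 : ρ * (1 + μ) ≤ s * (1 + μ) * (1 + ρ) := by
    have := mul_le_mul_of_nonneg_right h1 (by linarith : 0 ≤ 1 + μ)
    linarith
  by_contra! hc
  have := mul_le_mul_of_nonneg_right hc (by linarith : 0 ≤ 1 + ρ)
  linarith

lemma two_lt_mul (h : Admissible α ρ s) : 2 < (2 + α) * s := by
  have := h.one_lt_mul (μ := α / 2) (by linarith [h.α_pos]) (by linarith [h.two_lt])
  linarith

lemma denom_pos (h : Admissible α ρ s) : 0 < (1 + α) * s - 1 := by
  have := h.two_lt_mul; have := h.s_le_one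
  linarith

lemma bias_lt_one (h : Admissible α ρ s) : 1 / (2 * (2 * s - 1)) < 1 := by
  have := h.s_gt
  rw [div_lt_one (by linarith)]; linarith

lemma noise_lt_one (h : Admissible α ρ s) : α * s / (2 * ((1 + α) * s - 1)) < 1 := by
  have := h.two_lt_mul; have := h.denom_pos
  rw [div_lt_one (by linarith)]; linarith

lemma init_lt_one (h : Admissible α ρ s) :
    (1 - max (1 - α) (1 / 2) * s) / (2 * min α (1 / 2) * s) < 1 := by
  have h1 := h.s_gt
  have h2 := h.α_pos
  have e : max (1 - α) (1 / 2) = 1 - min α (1 / 2) := by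
    rcases le_total α (1 / 2) with h | h
    · rw [min_eq_left h, max_eq_left (by linarith)]
    · rw [min_eq_right h, max_eq_right (by linarith)]; norm_num
  have hμ : 0 < min α (1 / 2) := lt_min h2 (by norm_num)
  have h3 : 1 < min α (1 / 2) * ρ := by
    rw [min_mul_of_nonneg _ _ (by linarith [h.three_lt])]
    exact lt_min (by linarith [h.two_lt]) (by linarith [h.three_lt])
  have h4 := h.one_lt_mul hμ.le h3
  rw [e, div_lt_one (by positivity)]
  linarith

lemma one_lt_inv (hβ : 1 / 2 < β) (hβ1 : β < 1) : 1 < 1 / (2 * β - 1) := by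
  rw [one_lt_div (by linarith)]; linarith

lemma one_lt_rLocal (h : Admissible α ρ s) (hβ : 1 / 2 < β) (hβ1 : β < 1) :
    1 < rLocal α ρ β :=
  lt_min (one_lt_inv hβ hβ1) (lt_min (by linarith [h.two_lt]) (by linarith [h.three_lt]))

lemma one_lt_rGlobal (h : Admissible α ρ s) (hβ : 1 / 2 < β) (hβ1 : β < 1) :
    1 < rGlobal α ρ β :=
  lt_min (one_lt_inv hβ hβ1) (by linarith [h.two_lt])

lemma rate_lt_one {r : ℝ} (hr : 1 < r) : (1 + r) / (2 * r) < 1 := by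
  rw [div_lt_one (by linarith)]; linarith

lemma sigmaLocal_lt_one (h : Admissible α ρ s) (hβ1 : β < 1) : sigmaLocal α ρ s β < 1 := by
  unfold sigmaLocal
  split_ifs with h1 h2
  · exact max_lt h.bias_lt_one (max_lt h.noise_lt_one h.init_lt_one)
  · exact max_lt h.bias_lt_one
      (max_lt h.noise_lt_one (rate_lt_one (h.one_lt_rLocal (not_le.1 h1) hβ1)))
  · exact rate_lt_one (h.one_lt_rLocal (not_le.1 h1) hβ1)

lemma sigmaGlobal_lt_one (h : Admissible α ρ s) (hβ1 : β < 1) : sigmaGlobal α ρ s β < 1 := by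
  unfold sigmaGlobal
  split_ifs with h1 h2
  · exact max_lt h.bias_lt_one h.noise_lt_one
  · exact max_lt h.bias_lt_one
      (max_lt h.noise_lt_one (rate_lt_one (h.one_lt_rGlobal (not_le.1 h1) hβ1)))
  · exact rate_lt_one (h.one_lt_rGlobal (not_le.1 h1) hβ1)

lemma bias_pos (h : Admissible α ρ s) : 0 < 1 / (2 * (2 * s - 1)) := by
  have := h.s_gt
  exact div_pos one_pos (by linarith)

lemma sigmaLocal_pos (h : Admissible α ρ s) (hβ1 : β < 1) : 0 < sigmaLocal α ρ s β := by
  unfold sigmaLocal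
  split_ifs with h1 h2
  · exact lt_max_of_lt_left h.bias_pos
  · exact lt_max_of_lt_left h.bias_pos
  · have := h.one_lt_rLocal (not_le.1 h1) hβ1
    positivity

lemma sigmaGlobal_pos (h : Admissible α ρ s) (hβ1 : β < 1) : 0 < sigmaGlobal α ρ s β := by
  unfold sigmaGlobal
  split_ifs with h1 h2
  · exact lt_max_of_lt_left h.bias_pos
  · exact lt_max_of_lt_left h.bias_pos
  · have := h.one_lt_rGlobal (not_le.1 h1) hβ1
    positivity

/-- The exponent of the energy excess that the noise permits on the power clock. -/
lemma one_sub_lt_min (h : Admissible α ρ s) : 1 - s < min ((1 + α) * s - 1) (s - 1 / 2) :=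
  lt_min (by linarith [h.two_lt_mul]) (by linarith [h.s_gt])

lemma div_le_of_le {σ₀ l p p' : ℝ} (hσ₀ : σ₀ ≤ 1) (hl : l ≤ σ₀) (hp' : 0 < p') (hp : p' ≤ p) :
    (1 - σ₀) / p ≤ (1 - l) / p' :=
  div_le_div₀ (by linarith) (by linarith) hp' hp

/-- Each lower bound on `σ₀` is paired with one lower bound on `p`; the two quotients are exactly
`(x + s - 1) / 2` for the two candidates `x` in the minimum. -/
lemma div_le_min (h : Admissible α ρ s) {σ₀ p : ℝ} (hσ₀ : σ₀ ≤ 1)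
    (hσ1 : 1 / (2 * (2 * s - 1)) ≤ σ₀) (hσ2 : α * s / (2 * ((1 + α) * s - 1)) ≤ σ₀)
    (hp : max (2 / (2 * s - 1)) (1 / ((1 + α) * s - 1)) ≤ p) :
    (1 - σ₀) / p ≤ (min ((1 + α) * s - 1) (s - 1 / 2) + s - 1) / 2 := by
  have hs : 0 < 2 * s - 1 := by linarith [h.s_gt]
  have hD := h.denom_pos
  have h1 := div_le_of_le hσ₀ hσ1 (by positivity) ((le_max_left _ _).trans hp)
  have h2 := div_le_of_le hσ₀ hσ2 (by positivity) ((le_max_right _ _).trans hp)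
  have e1 : (1 - 1 / (2 * (2 * s - 1))) / (2 / (2 * s - 1)) = (s - 1 / 2 + s - 1) / 2 := by
    field_simp; ring
  have e2 : (1 - α * s / (2 * ((1 + α) * s - 1))) / (1 / ((1 + α) * s - 1)) =
      ((1 + α) * s - 1 + s - 1) / 2 := by
    have e3 : ∀ D : ℝ, D ≠ 0 → (1 - α * s / (2 * D)) / (1 / D) = D - α * s / 2 := fun D hD => by
      field_simp
    rw [e3 _ hD.ne']; ring
  rw [e1] at h1
  rw [e2] at h2
  rcases min_choice ((1 + α) * s - 1) (s - 1 / 2) with e | e <;> rw [e] <;> assumption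

/-- The same pairing for the candidate `x = r (1 - s)`. -/
lemma div_le_rate {r σ₀ p : ℝ} (hr : 1 < r) (hs : s < 1) (hσ₀ : σ₀ ≤ 1)
    (hσ : (1 + r) / (2 * r) ≤ σ₀) (hp : 1 / (r * (1 - s)) ≤ p) :
    (1 - σ₀) / p ≤ (r * (1 - s) + s - 1) / 2 := by
  have h1 : 0 < 1 - s := by linarith
  have h2 := div_le_of_le hσ₀ hσ (by positivity) hp
  have e : (1 - (1 + r) / (2 * r)) / (1 / (r * (1 - s))) = (r * (1 - s) + s - 1) / 2 := by
    have : r ≠ 0 := by positivity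
    field_simp; ring
  rwa [e] at h2

lemma count_exponent_pos (h : Admissible α ρ s) (y : ℝ) :
    0 < max y (max (2 / (2 * s - 1)) (1 / ((1 + α) * s - 1))) :=
  lt_max_of_lt_right (lt_max_of_lt_left (div_pos two_pos (by linarith [h.s_gt])))

end Admissible

end Exponents

/-! ### Rates of dissipation -/

section Rates

variable {m : ℕ} {F : Vec m → ℝ} {L α κ ρ γstar s β ζ : ℝ} {γ : ℕ → ℝ}

/-- Quadratic dissipation yields the exponent permitted by the noise. -/
lemma exists_drift_of_quadratic (ha : Admissible α ρ s) (hpos : ∀ n, 1 ≤ n → 0 < γ n)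
    (h7 : γ =Θ[atTop] fun n : ℕ => 1 / (n : ℝ) ^ s) (h6 : RateRegularity γ α ρ γstar)
    (hκ : 0 < κ) {Z : ℝ} (hZ : 0 < Z) (hZs : s = 1 → min α (1 / 2) * Z < κ * γstar) :
    ∃ x K n₀, x = min ((1 + α) * s - 1) (s - 1 / 2) ∧ RateClock γ α powerClock x s n₀ ∧ x < K ∧
      ∀ U v, (∀ t ∈ U, |F t - v| ≤ Z * ‖gradient F t‖ ^ 2) →
        Drift F κ γ powerClock x K n₀ U v := by
  set x := min ((1 + α) * s - 1) (s - 1 / 2) with hx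
  have hx0 : 1 - s < x := ha.one_sub_lt_min
  have hxp : 0 < x := by linarith [ha.s_le_one]
  -- For `s = 1` the contraction exponent must fit strictly between `x = min α (1/2)` and `κ γstar /
  -- Z`; for `s < 1` any `K > x` works.
  obtain ⟨K, hK, hKs⟩ : ∃ K, x < K ∧ (s = 1 → K * Z < κ * γstar) := by
    rcases ha.s_le_one.eq_or_lt with h | h
    · have e : x = min α (1 / 2) := by rw [hx, h]; norm_num
      obtain ⟨K, h1, h2⟩ := exists_between ((lt_div_iff₀ hZ).2 (e ▸ hZs h))
      exact ⟨K, h1, fun _ => (lt_div_iff₀ hZ).1 h2⟩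
    · exact ⟨x + 1, by linarith, fun h' => absurd h' h.ne⟩
  obtain ⟨n₁, hn₁⟩ := exists_rateClock_power hpos h7 ha.α_pos ha.s_le_one (min_le_left _ _)
    (min_le_right _ _) hx0
  obtain ⟨n₂, hn₂⟩ := eventually_atTop.1 (eventually_le_mul_step hpos h7 h6 ha.s_le_one hκ hKs)
  refine ⟨x, K, max n₁ n₂, rfl, hn₁.mono (le_max_left _ _), hK, fun U v hU =>
    drift_of_quadratic isClock_powerClock (hxp.trans hK).le hU fun k hk => ?_⟩
  rw [powerClock_increment, mul_one_div, div_le_iff₀ (isClock_powerClock.pos k)]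
  exact hn₂ k ((le_max_right _ _).trans hk)

/-- Superquadratic dissipation along decreasing steps of order `n ^ (-s)`, `s < 1`. -/
lemma exists_drift_of_superquadratic (ha : Admissible α ρ s) (hpos : ∀ n, 1 ≤ n → 0 < γ n)
    (h7 : γ =Θ[atTop] fun n : ℕ => 1 / (n : ℝ) ^ s) (hκ : 0 < κ) (hζ : 0 < ζ)
    (hβ : 1 / 2 < β) (hs : s < 1) {r : ℝ} (hr : 1 < r) (hrβ : r ≤ 1 / (2 * β - 1)) :
    ∃ x K n₀, x = min (min ((1 + α) * s - 1) (s - 1 / 2)) (r * (1 - s)) ∧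
      RateClock γ α powerClock x s n₀ ∧ x < K ∧
      ∀ U v, (∀ t ∈ U, |F t - v| ^ β ≤ ζ * ‖gradient F t‖) →
        Drift F κ γ powerClock x K n₀ U v := by
  set x := min (min ((1 + α) * s - 1) (s - 1 / 2)) (r * (1 - s)) with hx
  have hs0 : 0 < 1 - s := by linarith
  have hx0 : 1 - s < x := lt_min ha.one_sub_lt_min (by nlinarith)
  have hβ1 : 0 < 2 * β - 1 := by linarith
  obtain ⟨n₁, hn₁⟩ := exists_rateClock_power hpos h7 ha.α_pos ha.s_le_one
    ((min_le_left _ _).trans (min_le_left _ _)) ((min_le_left _ _).trans (min_le_right _ _)) hx0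
  obtain ⟨c₁, c₂, hc₁, -, n₂, hb⟩ := exists_step_bounds hpos h7
  refine ⟨x, x + 1, max n₁ n₂, rfl, hn₁.mono (le_max_left _ _), by linarith, fun U v hU =>
    drift_of_superquadratic isClock_powerClock hκ (by linarith) hβ hζ hc₁
      (fun k => hpos _ (Nat.le_add_left 1 k)) hU fun k hk => ?_⟩
  have hτ := isClock_powerClock.pos k
  -- From `x ≤ r (1 - s) ≤ (1 - s) / (2β - 1)`; the power of the clock then compensates the decay of
  -- the steps.
  have h1 : s ≤ 1 - x * (2 * β - 1) := by
    have h2 : x * (2 * β - 1) ≤ 1 / (2 * β - 1) * (1 - s) * (2 * β - 1) :=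
      mul_le_mul_of_nonneg_right ((min_le_right _ _).trans
        (mul_le_mul_of_nonneg_right hrβ hs0.le)) hβ1.le
    have e : 1 / (2 * β - 1) * (1 - s) * (2 * β - 1) = 1 - s := by field_simp
    linarith
  rw [powerClock_increment, mul_one]
  calc c₁ = c₁ * powerClock k ^ (-s) * powerClock k ^ s := by
        rw [mul_assoc, ← Real.rpow_add hτ, neg_add_cancel, Real.rpow_zero, mul_one]
    _ ≤ γ (k + 1) * powerClock k ^ (1 - x * (2 * β - 1)) :=
        mul_le_mul (hb k ((le_max_right _ _).trans hk)).1
          (Real.rpow_le_rpow_of_exponent_le (isClock_powerClock.one_le k) h1)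
          (Real.rpow_pos_of_pos hτ _).le (hpos _ (Nat.le_add_left 1 k)).le

/-- Superquadratic dissipation along steps of order `1 / n`. -/
lemma exists_drift_of_superquadratic_log (ha : Admissible α ρ s) (hpos : ∀ n, 1 ≤ n → 0 < γ n)
    (h7 : γ =Θ[atTop] fun n : ℕ => 1 / (n : ℝ) ^ s) (hκ : 0 < κ) (hζ : 0 < ζ)
    (hβ : 1 / 2 < β) (hs : s = 1) {r : ℝ} (hr : 1 < r) (hrβ : r ≤ 1 / (2 * β - 1)) :
    ∃ K n₀, RateClock γ α logClock r 0 n₀ ∧ r < K ∧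
      ∀ U v, (∀ t ∈ U, |F t - v| ^ β ≤ ζ * ‖gradient F t‖) →
        Drift F κ γ logClock r K n₀ U v := by
  have hβ1 : 0 < 2 * β - 1 := by linarith
  subst hs
  obtain ⟨n₁, hn₁⟩ := exists_rateClock_log hpos h7 ha.α_pos hr
  obtain ⟨c₁, c₂, hc₁, -, n₂, hb⟩ := exists_step_bounds hpos h7
  refine ⟨r + 1, max n₁ n₂, hn₁.mono (le_max_left _ _), by linarith, fun U v hU =>
    drift_of_superquadratic isClock_logClock hκ (by linarith) hβ hζ hc₁
      (fun k => hpos _ (Nat.le_add_left 1 k)) hU fun k hk => ?_⟩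
  have h1 : 0 ≤ 1 - r * (2 * β - 1) := by
    have := mul_le_mul_of_nonneg_right hrβ hβ1.le
    rw [one_div_mul_cancel hβ1.ne'] at this
    linarith
  have h2 := (hb k ((le_max_right _ _).trans hk)).1
  calc c₁ * (logClock (k + 1) - logClock k) ≤ c₁ * powerClock k ^ (-1 : ℝ) := by
        refine mul_le_mul_of_nonneg_left ?_ hc₁.le
        rw [logClock_increment, Real.rpow_neg_one, powerClock, ← one_div]
        exact log_increment_le k
    _ ≤ γ (k + 1) * 1 := by rwa [mul_one]
    _ ≤ _ := mul_le_mul_of_nonneg_left (Real.one_le_rpow (one_le_logClock k) h1)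
        (hpos _ (Nat.le_add_left 1 k)).le

lemma attains_linear (ha : Admissible α ρ s) {σ₀ y : ℝ} (hσ₀ : σ₀ < 1)
    (hσ1 : 1 / (2 * (2 * s - 1)) ≤ σ₀) (hσ2 : α * s / (2 * ((1 + α) * s - 1)) ≤ σ₀) :
    Attains powerClock ((min ((1 + α) * s - 1) (s - 1 / 2) + s - 1) / 2) (fun ε σ =>
      ⌈ε ^ (-1 / (1 - σ) * max y (max (2 / (2 * s - 1)) (1 / ((1 + α) * s - 1))))⌉₊) σ₀ :=
  attains_power (ha.count_exponent_pos y) hσ₀ (ha.div_le_min hσ₀.le hσ1 hσ2 (le_max_right _ _))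

lemma attains_sublinear (ha : Admissible α ρ s) {σ₀ r : ℝ} (hr : 1 < r) (hs : s < 1) (hσ₀ : σ₀ < 1)
    (hσ1 : 1 / (2 * (2 * s - 1)) ≤ σ₀) (hσ2 : α * s / (2 * ((1 + α) * s - 1)) ≤ σ₀)
    (hσ3 : (1 + r) / (2 * r) ≤ σ₀) :
    Attains powerClock ((min (min ((1 + α) * s - 1) (s - 1 / 2)) (r * (1 - s)) + s - 1) / 2)
      (fun ε σ => ⌈ε ^ (-1 / (1 - σ) *
        max (1 / (r * (1 - s))) (max (2 / (2 * s - 1)) (1 / ((1 + α) * s - 1))))⌉₊) σ₀ := by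
  refine attains_power (ha.count_exponent_pos _) hσ₀ ?_
  have h1 := ha.div_le_min hσ₀.le hσ1 hσ2 (le_max_right (1 / (r * (1 - s))) _)
  have h2 := Admissible.div_le_rate hr hs hσ₀.le hσ3 (le_max_left _
    (max (2 / (2 * s - 1)) (1 / ((1 + α) * s - 1))))
  rcases min_choice (min ((1 + α) * s - 1) (s - 1 / 2)) (r * (1 - s)) with e | e <;> rw [e] <;>
    assumption

lemma attains_logarithmic {r : ℝ} (hr : 1 < r) :
    Attains logClock ((r + 0 - 1) / 2)
      (fun ε σ => ⌈Real.exp (ε ^ (-(1 / (r * (1 - σ)))))⌉₊) ((1 + r) / (2 * r)) := by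
  have h := attains_log (zero_lt_one.trans hr) (Admissible.rate_lt_one hr)
  have hr0 : r ≠ 0 := by positivity
  rwa [show r * (1 - (1 + r) / (2 * r)) = (r + 0 - 1) / 2 by field_simp; ring] at h

/-- A clock whose rate is compatible with the counts, and along which the energy excess dissipates
wherever the hypothesis `H U v` holds. -/
def HasClock (F : Vec m → ℝ) (κ α : ℝ) (γ : ℕ → ℝ) (H : Set (Vec m) → ℝ → Prop)
    (count : ℝ → ℝ → ℕ) (σ₀ : ℝ) : Prop :=
  ∃ τ x u K n₀, RateClock γ α τ x u n₀ ∧ x < K ∧ (∀ U v, H U v → Drift F κ γ τ x K n₀ U v) ∧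
    Attains τ ((x + u - 1) / 2) count σ₀

lemma abs_le_of_rpow_le {V G : ℝ} (h : |V| ^ (1 / 2 : ℝ) ≤ ζ * G) : |V| ≤ ζ ^ 2 * G ^ 2 := by
  have h1 : (|V| ^ (1 / 2 : ℝ)) ^ 2 ≤ (ζ * G) ^ 2 :=
    pow_le_pow_left₀ (by positivity) h 2
  rwa [← Real.rpow_natCast, ← Real.rpow_mul (abs_nonneg V), mul_pow,
    show (1 / 2 : ℝ) * (2 : ℕ) = 1 by norm_num, Real.rpow_one] at h1

/-- Below exponent `1/2`, write `|V| = |V|^(1-2β) |V|^(2β)`: a bound on the surplus power yields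
quadratic dissipation. -/
lemma abs_le_mul_of_rpow_le {V G B : ℝ} (hB : |V| ^ (1 - 2 * β) ≤ B)
    (h : |V| ^ β ≤ ζ * G) : |V| ≤ B * ζ ^ 2 * G ^ 2 := by
  rcases (abs_nonneg V).eq_or_lt with h0 | h0
  · rw [← h0]
    have : 0 ≤ B := (by positivity : (0 : ℝ) ≤ |V| ^ (1 - 2 * β)).trans hB
    positivity
  have h1 : (|V| ^ β) ^ 2 ≤ (ζ * G) ^ 2 := pow_le_pow_left₀ (by positivity) h 2
  rw [← Real.rpow_natCast, ← Real.rpow_mul h0.le, mul_pow] at h1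
  calc |V| = |V| ^ (1 - 2 * β) * |V| ^ (β * (2 : ℕ)) := by
        rw [← Real.rpow_add h0]; push_cast
        rw [show 1 - 2 * β + β * 2 = 1 by ring, Real.rpow_one]
    _ ≤ B * (ζ ^ 2 * G ^ 2) := mul_le_mul hB h1 (by positivity)
        ((by positivity : (0 : ℝ) ≤ |V| ^ (1 - 2 * β)).trans hB)
    _ = _ := by ring

/-- At exponent `1/2` the quadratic constant is `ζ²`. Below, `η` is shrunk until the surplus power
makes it `1`, for which `max (1/2) α < κ γstar` suffices. Above `1/2` the clock is the power clock
for `s < 1` and the logarithmic one for `s = 1`. -/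
theorem exists_hasClock_local (ha : Admissible α ρ s) (hpos : ∀ n, 1 ≤ n → 0 < γ n)
    (h7 : γ =Θ[atTop] fun n : ℕ => 1 / (n : ℝ) ^ s) (h6 : RateRegularity γ α ρ γstar)
    (hκ : 0 < κ) (hγ : s = 1 → max (1 / 2) α < κ * γstar) (hβ : β ∈ Ioo (0 : ℝ) 1) (hζ : 0 < ζ)
    (hζs : β ≤ 1 / 2 → s = 1 → ζ ^ (1 / β) * max α (1 / 2) < κ * γstar) :
    ∃ η, 0 < η ∧ HasClock F κ α γ
      (fun U v => ∀ t ∈ U, |F t - v| ^ β ≤ ζ * ‖gradient F t‖ ∧ |F t - v| ≤ η)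
      (countLocal α ρ s β) (sigmaLocal α ρ s β) := by
  have hσ := ha.sigmaLocal_lt_one hβ.2
  rcases le_or_gt β (1 / 2) with hβ2 | hβ2
  · -- reduce to quadratic dissipation
    obtain ⟨η, Z, hη, hZ, hZs, hV⟩ : ∃ η Z : ℝ, 0 < η ∧ 0 < Z ∧
        (s = 1 → min α (1 / 2) * Z < κ * γstar) ∧
        ∀ V G : ℝ, |V| ^ β ≤ ζ * G → |V| ≤ η → |V| ≤ Z * G ^ 2 := by
      rcases hβ2.eq_or_lt with rfl | hβ2
      · refine ⟨1, ζ ^ 2, one_pos, by positivity, fun h => ?_, fun V G h _ => abs_le_of_rpow_le h⟩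
        have h1 := hζs le_rfl h
        rw [show (1 : ℝ) / (1 / 2) = (2 : ℕ) by norm_num, Real.rpow_natCast] at h1
        refine lt_of_le_of_lt ?_ h1
        rw [mul_comm]
        gcongr
        exact (min_le_left _ _).trans (le_max_left _ _)
      · have h2 : 0 < 1 - 2 * β := by linarith
        -- Chosen so that `η^(1-2β) ζ² = 1`.
        refine ⟨(1 / ζ ^ 2) ^ (1 / (1 - 2 * β)), 1, by positivity, one_pos, fun h => ?_,
          fun V G h hη => ?_⟩
        · rw [mul_one]
          exact ((min_le_right _ _).trans (le_max_left _ _)).trans_lt (hγ h)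
        · have h3 := Real.rpow_le_rpow (abs_nonneg V) hη h2.le
          rw [← Real.rpow_mul (by positivity), one_div_mul_cancel h2.ne', Real.rpow_one] at h3
          have h4 := abs_le_mul_of_rpow_le h3 h
          rwa [one_div_mul_cancel (by positivity)] at h4
    obtain ⟨x, K, n₀, hx, hR, hK, hD⟩ :=
      exists_drift_of_quadratic (F := F) ha hpos h7 h6 hκ hZ hZs
    refine ⟨η, hη, powerClock, x, s, K, n₀, hR, hK, fun U v hU =>
      hD U v fun t ht => hV _ _ (hU t ht).1 (hU t ht).2, ?_⟩
    have e : countLocal α ρ s β = fun ε σ => ⌈ε ^ (-1 / (1 - σ) *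
        max (max 2 α⁻¹ / s) (max (2 / (2 * s - 1)) (1 / ((1 + α) * s - 1))))⌉₊ := by
      funext ε σ; rw [countLocal, if_pos hβ2]
    rw [e, hx]
    refine attains_linear ha hσ ?_ ?_ <;> rw [sigmaLocal, if_pos hβ2]
    · exact le_max_left _ _
    · exact (le_max_left _ _).trans (le_max_right _ _)
  have hr := ha.one_lt_rLocal hβ2 hβ.2
  have hrβ : rLocal α ρ β ≤ 1 / (2 * β - 1) := min_le_left _ _
  rcases ha.s_le_one.lt_or_eq with hs | hs
  · obtain ⟨x, K, n₀, hx, hR, hK, hD⟩ :=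
      exists_drift_of_superquadratic (F := F) ha hpos h7 hκ hζ hβ2 hs hr hrβ
    refine ⟨1, one_pos, powerClock, x, s, K, n₀, hR, hK, fun U v hU =>
      hD U v fun t ht => (hU t ht).1, ?_⟩
    have e : countLocal α ρ s β = fun ε σ => ⌈ε ^ (-1 / (1 - σ) *
        max (1 / (rLocal α ρ β * (1 - s))) (max (2 / (2 * s - 1)) (1 / ((1 + α) * s - 1))))⌉₊ := by
      funext ε σ; rw [countLocal, if_neg hβ2.not_ge, if_pos hs]
    rw [e, hx]
    refine attains_sublinear ha hr hs hσ ?_ ?_ ?_ <;> rw [sigmaLocal, if_neg hβ2.not_ge, if_pos hs]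
    · exact le_max_left _ _
    · exact (le_max_left _ _).trans (le_max_right _ _)
    · exact (le_max_right _ _).trans (le_max_right _ _)
  · obtain ⟨K, n₀, hR, hK, hD⟩ :=
      exists_drift_of_superquadratic_log (F := F) ha hpos h7 hκ hζ hβ2 hs hr hrβ
    refine ⟨1, one_pos, logClock, rLocal α ρ β, 0, K, n₀, hR, hK, fun U v hU =>
      hD U v fun t ht => (hU t ht).1, ?_⟩
    have e : countLocal α ρ s β =
        fun ε σ => ⌈Real.exp (ε ^ (-(1 / (rLocal α ρ β * (1 - σ)))))⌉₊ := by
      funext ε σ; rw [countLocal, if_neg hβ2.not_ge, if_neg hs.not_lt]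
    rw [e, sigmaLocal, if_neg hβ2.not_ge, if_neg hs.not_lt]
    exact attains_logarithmic hr

/-- Hölder smoothness bounds the energy gap when the Łojasiewicz exponent is large enough. -/
lemma HolderSmooth.gap_rpow_le (h1 : HolderSmooth F L α) (hβ : α / (1 + α) < β) (hβ2 : β < 1 / 2)
    (hζ : 0 < ζ) (h : LojasiewiczGap F β ζ) (t : Vec m) :
    gap F t ^ (1 - 2 * β) ≤ ζ ^ (lambdaExp α β * ((1 + α) / α)) *
      ((1 + α) * L ^ (1 / α) / α) ^ lambdaExp α β := by
  have hα := h1.α_pos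
  have hL := h1.L_pos
  set e := (1 + α) / α with he
  set Q := (1 + α) * L ^ (1 / α) / α with hQ
  have he0 : 0 < e := by positivity
  have hQ0 : 0 < Q := by positivity
  have hβ' : 0 < e * β - 1 := by
    have h2 := mul_lt_mul_of_pos_left hβ he0
    rw [he, show (1 + α) / α * (α / (1 + α)) = 1 by field_simp] at h2
    linarith
  have hl : lambdaExp α β = (1 - 2 * β) / (e * β - 1) := by rw [lambdaExp, if_pos hβ2]
  have hl0 : 0 < lambdaExp α β := by rw [hl]; exact div_pos (by linarith) hβ'
  rcases (h1.gap_nonneg t).eq_or_lt with h0 | h0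
  · rw [← h0, Real.zero_rpow (by linarith)]
    positivity
  -- Raise the Łojasiewicz inequality to the power `e` and insert `‖∇F‖^e ≤ Q gap`. The exponent `e
  -- β - 1` is positive since `β > α / (1 + α)`, and the power `lambdaExp` turns it into `1 - 2β`.
  have h2 : gap F t ^ (e * β - 1) ≤ ζ ^ e * Q := by
    have h3 := Real.rpow_le_rpow (by positivity) (h t) he0.le
    change (gap F t ^ β) ^ e ≤ _ at h3
    rw [← Real.rpow_mul h0.le, Real.mul_rpow hζ.le (norm_nonneg _)] at h3
    have h4 := h3.trans (mul_le_mul_of_nonneg_left (h1.norm_gradient_rpow_le t) (by positivity))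
    rw [Real.rpow_sub h0, Real.rpow_one, div_le_iff₀ h0, mul_comm e β, mul_assoc]
    exact h4
  have h3 := Real.rpow_le_rpow (by positivity) h2 hl0.le
  rw [← Real.rpow_mul h0.le, Real.mul_rpow (by positivity) hQ0.le, ← Real.rpow_mul hζ.le,
    mul_comm e (lambdaExp α β)] at h3
  rwa [hl, mul_div_cancel₀ _ hβ'.ne', ← hl] at h3

/-- The regimes are those of the local case, but below `1/2` the surplus power of the gap is bounded
on the whole space by `gap_rpow_le` instead of by shrinking a neighborhood. The resulting quadratic
constant times `α` is `globalThreshold`, which dominates the requirement with `min α (1/2)`. -/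
theorem exists_hasClock_global (h1 : HolderSmooth F L α) (ha : Admissible α ρ s)
    (hpos : ∀ n, 1 ≤ n → 0 < γ n)
    (h7 : γ =Θ[atTop] fun n : ℕ => 1 / (n : ℝ) ^ s) (h6 : RateRegularity γ α ρ γstar)
    (hκ : 0 < κ) (hβ : β ∈ Ioo (α / (1 + α)) 1 ∪ {1 / 2}) (hζ : 0 < ζ)
    (hζs : β ≤ 1 / 2 → s = 1 → globalThreshold L α β ζ < κ * γstar)
    (h : LojasiewiczGap F β ζ) :
    HasClock F κ α γ (fun U v => U = univ ∧ v = ⨅ η, F η)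
      (countGlobal α ρ s β) (sigmaGlobal α ρ s β) := by
  have hα := h1.α_pos
  have hL := h1.L_pos
  have hβ1 : β < 1 := by
    rcases hβ with h | h
    · exact h.2
    · rw [mem_singleton_iff.1 h]; norm_num
  have habs : ∀ t, |F t - ⨅ η, F η| = F t - ⨅ η, F η := fun t => abs_of_nonneg (h1.gap_nonneg t)
  have hσ := ha.sigmaGlobal_lt_one hβ1
  have hV : ∀ t, |F t - ⨅ η, F η| ^ β ≤ ζ * ‖gradient F t‖ := fun t => by
    rw [habs]; exact h t
  rcases le_or_gt β (1 / 2) with hβ2 | hβ2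
  · -- reduce to quadratic dissipation
    obtain ⟨Z, hZ, hZs, hV⟩ : ∃ Z : ℝ, 0 < Z ∧ (s = 1 → min α (1 / 2) * Z < κ * γstar) ∧
        ∀ t, |F t - ⨅ η, F η| ≤ Z * ‖gradient F t‖ ^ 2 := by
      rcases hβ2.eq_or_lt with rfl | hβ2
      · refine ⟨ζ ^ 2, by positivity, fun h => ?_, fun t => abs_le_of_rpow_le (hV t)⟩
        have h1 := hζs le_rfl h
        rw [globalThreshold, lambdaExp, if_neg (lt_irrefl _), zero_mul, add_zero, Real.rpow_zero,
          mul_one, Real.rpow_two] at h1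
        refine lt_of_le_of_lt ?_ h1
        rw [mul_comm]
        gcongr
        exact min_le_left _ _
      · have hβ3 : α / (1 + α) < β := by
          rcases hβ with h | h
          · exact h.1
          · exact absurd (mem_singleton_iff.1 h) hβ2.ne
        refine ⟨ζ ^ (lambdaExp α β * ((1 + α) / α)) *
          ((1 + α) * L ^ (1 / α) / α) ^ lambdaExp α β * ζ ^ 2, by positivity, fun hs => ?_,
          fun t => abs_le_mul_of_rpow_le ?_ (hV t)⟩
        · refine lt_of_le_of_lt ?_ (hζs hβ2.le hs)
          rw [globalThreshold, Real.rpow_add hζ, Real.rpow_two, mul_comm]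
          calc _ ≤ ζ ^ (lambdaExp α β * ((1 + α) / α)) *
                ((1 + α) * L ^ (1 / α) / α) ^ lambdaExp α β * ζ ^ 2 * α := by
                gcongr
                exact min_le_left _ _
            _ = _ := by ring
        · rw [habs]
          exact h1.gap_rpow_le hβ3 hβ2 hζ h t
    obtain ⟨x, K, n₀, hx, hR, hK, hD⟩ :=
      exists_drift_of_quadratic (F := F) ha hpos h7 h6 hκ hZ hZs
    refine ⟨powerClock, x, s, K, n₀, hR, hK, fun U v hU =>
      hD U v fun t _ => hU.2 ▸ hV t, ?_⟩
    have e : countGlobal α ρ s β = fun ε σ => ⌈ε ^ (-1 / (1 - σ) *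
        max (1 / (α * s)) (max (2 / (2 * s - 1)) (1 / ((1 + α) * s - 1))))⌉₊ := by
      funext ε σ; rw [countGlobal, if_pos hβ2]
    rw [e, hx]
    refine attains_linear ha hσ ?_ ?_ <;> rw [sigmaGlobal, if_pos hβ2]
    · exact le_max_left _ _
    · exact le_max_right _ _
  have hr := ha.one_lt_rGlobal hβ2 hβ1
  have hrβ : rGlobal α ρ β ≤ 1 / (2 * β - 1) := min_le_left _ _
  rcases ha.s_le_one.lt_or_eq with hs | hs
  · obtain ⟨x, K, n₀, hx, hR, hK, hD⟩ :=
      exists_drift_of_superquadratic (F := F) ha hpos h7 hκ hζ hβ2 hs hr hrβ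
    refine ⟨powerClock, x, s, K, n₀, hR, hK, fun U v hU =>
      hD U v fun t _ => hU.2 ▸ hV t, ?_⟩
    have e : countGlobal α ρ s β = fun ε σ => ⌈ε ^ (-1 / (1 - σ) *
        max (1 / (rGlobal α ρ β * (1 - s))) (max (2 / (2 * s - 1)) (1 / ((1 + α) * s - 1))))⌉₊ := by
      funext ε σ; rw [countGlobal, if_neg hβ2.not_ge, if_pos hs]
    rw [e, hx]
    refine attains_sublinear ha hr hs hσ ?_ ?_ ?_ <;> rw [sigmaGlobal, if_neg hβ2.not_ge, if_pos hs]
    · exact le_max_left _ _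
    · exact (le_max_left _ _).trans (le_max_right _ _)
    · exact (le_max_right _ _).trans (le_max_right _ _)
  · obtain ⟨K, n₀, hR, hK, hD⟩ :=
      exists_drift_of_superquadratic_log (F := F) ha hpos h7 hκ hζ hβ2 hs hr hrβ
    refine ⟨logClock, rGlobal α ρ β, 0, K, n₀, hR, hK, fun U v hU =>
      hD U v fun t _ => hU.2 ▸ hV t, ?_⟩
    have e : countGlobal α ρ s β =
        fun ε σ => ⌈Real.exp (ε ^ (-(1 / (rGlobal α ρ β * (1 - σ)))))⌉₊ := by
      funext ε σ; rw [countGlobal, if_neg hβ2.not_ge, if_neg hs.not_lt]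
    rw [e, sigmaGlobal, if_neg hβ2.not_ge, if_neg hs.not_lt]
    exact attains_logarithmic hr

end Rates

/-! ### Computational cost -/

section Cost

variable {d m : ℕ} {p : Prices} {g : Vec d → Vec m → Vec m} {γ : ℕ → ℝ}

/-- The price of one iteration. -/
noncomputable def Prices.iteration (p : Prices) (m : ℕ) : ℝ≥0 :=
  p.rate + (p.sample + (p.oracle + (m * p.arith + m * p.arith)))

lemma timedRun_cost (x : ℕ → Vec d) (θ0 : Vec m) (n : ℕ) :
    (timedRun p g γ x θ0 n).cost = p.init + n * p.iteration m := by
  induction n with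
  | zero => simp [timedRun, Timed.pay]
  | succ n ih =>
    simp only [timedRun, Timed.andThen, ih, timedStep, Timed.pay, Prices.iteration]
    push_cast; ring

lemma timedRun_val (x : ℕ → Vec d) (t : ℕ → Vec m)
    (h : ∀ n, t (n + 1) = t n - γ (n + 1) • g (x (n + 1)) (t n)) (n : ℕ) :
    (timedRun p g γ x (t 0) n).val = t n := by
  induction n with
  | zero => rfl
  | succ n ih => simp only [timedRun, Timed.andThen, ih, timedStep, Timed.pay, h]

lemma exists_timedRun_cost_le (p : Prices) (m : ℕ) : ∃ C > (0 : ℝ), ∀ n : ℕ, 1 ≤ n →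
    ∀ {d : ℕ} (g : Vec d → Vec m → Vec m) (γ : ℕ → ℝ) (x : ℕ → Vec d) (θ0 : Vec m),
      ((timedRun p g γ x θ0 n).cost : ℝ) ≤ C * n := by
  refine ⟨p.init + p.iteration m + 1, by positivity, fun n hn d g γ x θ0 => ?_⟩
  rw [timedRun_cost]
  have hn' : (1 : ℝ) ≤ n := by exact_mod_cast hn
  have h1 := mul_le_mul_of_nonneg_left hn' p.init.coe_nonneg
  push_cast
  linarith

lemma timedRun_cost_mono (x : ℕ → Vec d) (θ0 : Vec m) :
    Monotone fun n => (timedRun p g γ x θ0 n).cost := fun n l hnl => by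
  simp only [timedRun_cost]
  gcongr

lemma proportional_mono {a : ℝ} (ha : 0 < a) : Monotone (proportional a) := fun n l hnl => by
  unfold proportional
  gcongr

lemma ceil_rpow_mono {ε p : ℝ} (hε : ε ∈ Ioc (0 : ℝ) 1) (hp : 0 < p) {σ σ' : ℝ} (hσ : σ ≤ σ')
    (hσ' : σ' < 1) : ⌈ε ^ (-1 / (1 - σ) * p)⌉₊ ≤ ⌈ε ^ (-1 / (1 - σ') * p)⌉₊ := by
  refine Nat.ceil_mono (Real.rpow_le_rpow_of_exponent_ge hε.1 hε.2 ?_)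
  refine mul_le_mul_of_nonneg_right ?_ hp.le
  rw [neg_div, neg_div, neg_le_neg_iff]
  exact one_div_le_one_div_of_le (by linarith) (by linarith)

lemma ceil_exp_mono {ε r : ℝ} (hε : ε ∈ Ioc (0 : ℝ) 1) (hr : 0 < r) {σ σ' : ℝ} (hσ : σ ≤ σ')
    (hσ' : σ' < 1) : ⌈Real.exp (ε ^ (-(1 / (r * (1 - σ)))))⌉₊ ≤
      ⌈Real.exp (ε ^ (-(1 / (r * (1 - σ')))))⌉₊ := by
  refine Nat.ceil_mono (Real.exp_le_exp.2 (Real.rpow_le_rpow_of_exponent_ge hε.1 hε.2 ?_))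
  rw [neg_le_neg_iff]
  have h : 0 < 1 - σ' := by linarith
  exact one_div_le_one_div_of_le (by positivity) (by gcongr)

variable {α ρ s β ε σ σ' : ℝ}

lemma Admissible.countLocal_mono (ha : Admissible α ρ s) (hβ : β < 1) (hε : ε ∈ Ioc (0 : ℝ) 1)
    (hσ : σ ≤ σ') (hσ' : σ' < 1) : countLocal α ρ s β ε σ ≤ countLocal α ρ s β ε σ' := by
  unfold countLocal
  split_ifs with h1 h2
  · exact ceil_rpow_mono hε (ha.count_exponent_pos _) hσ hσ'
  · exact ceil_rpow_mono hε (ha.count_exponent_pos _) hσ hσ'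
  · exact ceil_exp_mono hε (zero_lt_one.trans (ha.one_lt_rLocal (not_le.1 h1) hβ)) hσ hσ'

lemma Admissible.countGlobal_mono (ha : Admissible α ρ s) (hβ : β < 1) (hε : ε ∈ Ioc (0 : ℝ) 1)
    (hσ : σ ≤ σ') (hσ' : σ' < 1) : countGlobal α ρ s β ε σ ≤ countGlobal α ρ s β ε σ' := by
  unfold countGlobal
  split_ifs with h1 h2
  · exact ceil_rpow_mono hε (ha.count_exponent_pos _) hσ hσ'
  · exact ceil_rpow_mono hε (ha.count_exponent_pos _) hσ hσ'
  · exact ceil_exp_mono hε (zero_lt_one.trans (ha.one_lt_rGlobal (not_le.1 h1) hβ)) hσ hσ'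

/-- The cost is nondecreasing in the number of iterations, and the count is least at `σ₀`. -/
lemma isLeast_cost {count : ℝ → ℕ} {σ₀ a : ℝ} (hσ₀ : σ₀ < 1) (ha : 0 < a)
    (h : ∀ σ ∈ Ico σ₀ 1, count σ₀ ≤ count σ) (x : ℕ → Vec d) (θ0 : Vec m) :
    IsLeast ((fun σ => (timedRun p g γ x θ0 (proportional a (count σ))).cost) '' Ico σ₀ 1)
      (timedRun p g γ x θ0 (proportional a (count σ₀))).cost := by
  refine ⟨⟨σ₀, ⟨le_rfl, hσ₀⟩, rfl⟩, ?_⟩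
  rintro _ ⟨σ, hσ, rfl⟩
  exact timedRun_cost_mono x θ0 (proportional_mono ha (h σ hσ))

end Cost

/-! ### Convergence and convergence rates -/

section Convergence

set_option linter.unusedSectionVars false

variable {Ω : Type*} [mΩ : MeasurableSpace Ω] {P : Measure Ω} [IsProbabilityMeasure P] {d m : ℕ}
  {X : Ω → Vec d} {ξ : ℕ → Ω → Vec d} {g : Vec d → Vec m → Vec m} {γ : ℕ → ℝ}
  {θ : ℕ → Ω → Vec m} {F : Vec m → ℝ} {L α Cg κ c ρ γstar s β ζ : ℝ}

/-- Markov's inequality on an event. -/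
lemma measureReal_sub_le_of_lintegral_le {E : Type*} [NormedAddCommGroup E] [MeasurableSpace E]
    [BorelSpace E] {Y : Ω → E} (hY : Measurable Y) {A : Set Ω} {B R : ℝ} (hB : 0 ≤ B) (hR : 0 < R)
    (h : ∫⁻ ω in A, ‖Y ω‖ₑ ∂P ≤ ENNReal.ofReal B) :
    P.real A - B / R ≤ P.real {ω | ‖Y ω‖ ≤ R} := by
  set D : Set Ω := {ω | ENNReal.ofReal R ≤ ‖Y ω‖ₑ} with hD
  have hDm : MeasurableSet D := measurableSet_le measurable_const hY.enorm
  have h1 : A ⊆ {ω | ‖Y ω‖ ≤ R} ∪ (D ∩ A) := fun ω hω => by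
    by_cases hn : ‖Y ω‖ ≤ R
    · exact Or.inl hn
    · refine Or.inr ⟨?_, hω⟩
      rw [hD, mem_ofPred, ← ofReal_norm]
      exact ENNReal.ofReal_le_ofReal (not_le.1 hn).le
  have h2 : P (D ∩ A) ≤ ENNReal.ofReal (B / R) := by
    rw [← Measure.restrict_apply hDm, ENNReal.ofReal_div_of_pos hR]
    exact (meas_ge_le_lintegral_div hY.enorm.aemeasurable (by simpa using hR)
      ENNReal.ofReal_ne_top).trans (ENNReal.div_le_div_right h _)
  have h3 : P.real (D ∩ A) ≤ B / R :=
    ENNReal.toReal_le_of_le_ofReal (by positivity) h2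
  have h4 := (measureReal_mono (μ := P) h1).trans (measureReal_union_le _ _)
  linarith

/-- The iterates stay in `U` from time `n` on and their energies converge to `v`. -/
def capture (F : Vec m → ℝ) (θ : ℕ → Ω → Vec m) (U : Set (Vec m)) (v : ℝ) (n : ℕ) : Set Ω :=
  {ω | (∀ k, n ≤ k → θ k ω ∈ U) ∧ Tendsto (fun k => F (θ k ω)) atTop (𝓝 v)}

lemma measurableSet_capture (hθ : IsSGD P X ξ g γ θ) (h1 : HolderSmooth F L α)
    {U : Set (Vec m)} (hU : MeasurableSet U) (v : ℝ) (n : ℕ) :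
    MeasurableSet (capture F θ U v n) := by
  have h2 : MeasurableSet {ω | ∀ k, n ≤ k → θ k ω ∈ U} := by
    have e : {ω | ∀ k, n ≤ k → θ k ω ∈ U} = ⋂ k, ⋂ (_ : n ≤ k), θ k ⁻¹' U := by
      ext ω; simp
    rw [e]
    exact MeasurableSet.iInter fun k => MeasurableSet.iInter fun _ => measurable_iterate' hθ k hU
  have h3 : MeasurableSet {ω | Tendsto (fun k => F (θ k ω)) atTop (𝓝 v)} :=
    measurableSet_tendsto _ fun k => h1.continuous.measurable.comp (measurable_iterate' hθ k)
  exact h2.inter h3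

/-- Increasing events that exhaust the trajectories of asymptotic energy at most `ℓ`, each with a
rate of convergence in mean. -/
lemma exists_capture (hθ : IsSGD P X ξ g γ θ) (h1 : HolderSmooth F L α)
    (h2 : OracleBounds P X F g Cg κ c) (h3 : RobbinsMonro γ α)
    (h4 : Tendsto F (Bornology.cobounded (Vec m)) atTop) {ℓ η σ₀ : ℝ} {count : ℝ → ℝ → ℕ}
    (hη : 0 < η) (hβ : 0 < β)
    (hclock : HasClock F κ α γ
      (fun U v => ∀ t ∈ U, |F t - v| ^ β ≤ ζ * ‖gradient F t‖ ∧ |F t - v| ≤ η) count σ₀)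
    (hL : LojasiewiczOn F (sublevel F ℓ) β ζ) :
    ∃ τ q, IsClock τ ∧ 0 ≤ q ∧ Attains τ q count σ₀ ∧ ∃ A : ℕ → Set Ω,
      (∀ n, MeasurableSet (A n)) ∧ Monotone A ∧
      (∀ᵐ ω ∂P, (∃ v ≤ ℓ, Tendsto (fun n => F (θ n ω)) atTop (𝓝 v)) → ∃ n, ω ∈ A n) ∧
      ∀ n, (∀ᵐ ω ∂P.restrict (A n), CauchySeq fun k => θ k ω) ∧
        ∃ N M, 0 ≤ M ∧ ∀ k l, N ≤ k → k ≤ l →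
          ∫ ω in A n, ‖θ l ω - θ k ω‖ ∂P ≤ M * τ k ^ (-q) := by
  obtain ⟨τ, x, u, K, n₀, hR, hK, hD, hatt⟩ := hclock
  obtain ⟨S, U, hU, hS⟩ := hL.exists_cover h1 h4 hβ hη
  have hlt := hR.lt_x
  have hm : ∀ v n, MeasurableSet (capture F θ (U v) v n) := fun v n =>
    measurableSet_capture hθ h1 (hU v).1.measurableSet v n
  have hb : ∀ v n, _ := fun v n => hR.local_bound hθ h1 h2 h3 hK (hU v).1.measurableSet (hU v).2.1
    (hm v n) (hD (U v) v (hU v).2.2) (N := n) fun ω hω => hω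
  choose hc N M hM hNM using hb
  refine ⟨τ, (x + u - 1) / 2, hR.clock, by linarith, hatt,
    fun n => ⋃ v ∈ S, capture F θ (U v) v n, fun n => S.measurableSet_biUnion fun v _ => hm v n,
    fun n l hnl => iUnion₂_mono fun v _ ω hω => ⟨fun k hk => hω.1 k (hnl.trans hk), hω.2⟩, ?_,
    fun n => ⟨?_, S.sup fun v => N v n, ∑ v ∈ S, M v n, Finset.sum_nonneg fun v _ => hM v n,
      fun k l hk hkl => ?_⟩⟩
  -- Vanishing gradients together with the limiting energy `v` force the trajectory into `U v` from
  -- some time on.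
  · filter_upwards [ae_tendsto_gradient hθ h1 h2 h3] with ω hω
    rintro ⟨v, hv, hFv⟩
    obtain ⟨hvS, hev⟩ := hS (fun n => θ n ω) v hv hFv hω
    obtain ⟨n, hn⟩ := eventually_atTop.1 hev
    exact ⟨n, mem_iUnion₂.2 ⟨v, hvS, hn, hFv⟩⟩
  · rw [ae_restrict_biUnion_finset_iff]
    exact fun v _ => hc v n
  · have hI : Integrable (fun ω => ‖θ l ω - θ k ω‖) P :=
      (((memLp_iterate hθ h1 h2 h3 l).sub (memLp_iterate hθ h1 h2 h3 k)).integrable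
        one_le_two).norm
    rw [integral_biUnion_finset S (fun v _ => hm v n) ?_ fun v _ => hI.integrableOn,
      Finset.sum_mul]
    · exact Finset.sum_le_sum fun v hv =>
        hNM v n k l ((Finset.le_sup (f := fun v => N v n) hv).trans hk) hkl
    -- Captures for different values are disjoint, since the energies have only one limit; the
    -- integral over their union is therefore a sum.
    · intro v _ w _ hvw
      exact Set.disjoint_left.2 fun ω hω hω' => hvw (tendsto_nhds_unique hω.2 hω'.2)

/-- Almost sure convergence to a random stationary point. -/
theorem exists_limit (hθ : IsSGD P X ξ g γ θ) (h1 : HolderSmooth F L α)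
    (h2 : OracleBounds P X F g Cg κ c) (h3 : RobbinsMonro γ α)
    (h4 : Tendsto F (Bornology.cobounded (Vec m)) atTop) (h5 : IsLojasiewicz F)
    (h6 : RateRegularity γ α ρ γstar) (h7 : γ =Θ[atTop] fun n : ℕ => 1 / (n : ℝ) ^ s)
    (ha : Admissible α ρ s) (hγ : s = 1 → max (1 / 2) α < κ * γstar) :
    ∃ θs : Ω → Vec m, Measurable θs ∧
      ∀ᵐ ω ∂P, Tendsto (fun n => θ n ω) atTop (𝓝 (θs ω)) ∧ θs ω ∈ stationary F ∧
        Tendsto (fun n => F (θ n ω)) atTop (𝓝 (F (θs ω))) := by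
  have hcauchy : ∀ i : ℕ, ∀ᵐ ω ∂P, (∃ v ≤ (i : ℝ), Tendsto (fun n => F (θ n ω)) atTop (𝓝 v)) →
      CauchySeq fun n => θ n ω := by
    intro i
    obtain ⟨β, hβ, ζ, hζ, hL⟩ := exists_lojasiewiczOn h1 h4 h5 i
    -- Raising the exponent above `1/2` gives constant one and makes the threshold condition on `ζ`
    -- vacuous, so convergence holds at every energy level.
    obtain ⟨β', hβ', hβ1⟩ := exists_between (max_lt hβ.2 (by norm_num : (1 : ℝ) / 2 < 1))
    have hβ2 : 1 / 2 < β' := (le_max_right _ _).trans_lt hβ'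
    have hβ0 : 0 < β' := by linarith
    have hL' := LojasiewiczOn.normalize h1 hL hβ.1.le ((le_max_left _ _).trans_lt hβ')
    obtain ⟨η, hη, hclock⟩ := exists_hasClock_local (F := F) (ζ := 1) ha h3.pos h7 h6 h2.κ_pos hγ
      ⟨hβ0, hβ1⟩ one_pos fun h => absurd h hβ2.not_ge
    obtain ⟨τ, q, -, -, -, A, hA, -, hex, hb⟩ :=
      exists_capture hθ h1 h2 h3 h4 hη hβ0 hclock hL'
    have hall : ∀ᵐ ω ∂P, ∀ n, ω ∈ A n → CauchySeq fun k => θ k ω :=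
      ae_all_iff.2 fun n => (ae_restrict_iff' (hA n)).1 (hb n).1
    filter_upwards [hex, hall] with ω h8 h9 h10
    obtain ⟨n, hn⟩ := h8 h10
    exact h9 n hn
  have hconv : ∀ᵐ ω ∂P, ∃ x, Tendsto (fun n => θ n ω) atTop (𝓝 x) := by
    filter_upwards [ae_all_iff.2 hcauchy, ae_exists_tendsto_energy hθ h1 h2 h3] with ω h8 ⟨v, hv⟩
    obtain ⟨i, hi⟩ := exists_nat_ge v
    exact cauchySeq_tendsto_of_complete (h8 i ⟨v, hi, hv⟩)
  obtain ⟨θs, hθs, hlim⟩ := measurable_limit_of_tendsto_metrizable_ae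
    (fun n => (measurable_iterate' hθ n).aemeasurable) hconv
  refine ⟨θs, hθs, ?_⟩
  filter_upwards [hlim, ae_tendsto_gradient hθ h1 h2 h3] with ω h8 h9
  exact ⟨h8, tendsto_nhds_unique ((h1.continuous_gradient.tendsto _).comp h8) h9,
    (h1.continuous.tendsto _).comp h8⟩

variable {θs : Ω → Vec m}

/-- The limit lies in a sublevel set with high probability. -/
lemma exists_sublevel (F : Vec m → ℝ) (θs : Ω → Vec m) {δ : ℝ} (hδ : 0 < δ) :
    ∃ ℓ > ⨅ η, F η, 1 - δ < P.real {ω | F (θs ω) ≤ ℓ} := by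
  set A : ℕ → Set Ω := fun n => {ω | F (θs ω) ≤ (⨅ η, F η) + 1 + n} with hA
  have hmono : Monotone A := fun n l hnl ω hω => by
    have h2 : (n : ℝ) ≤ l := by exact_mod_cast hnl
    have h3 : F (θs ω) ≤ (⨅ η, F η) + 1 + n := hω
    rw [hA, mem_ofPred]; linarith
  have hU : ⋃ n, A n = univ := eq_univ_of_forall fun ω => by
    obtain ⟨n, hn⟩ := exists_nat_ge (F (θs ω) - ((⨅ η, F η) + 1))
    exact mem_iUnion.2 ⟨n, by rw [hA, mem_ofPred]; linarith⟩
  have h2 := tendsto_measure_iUnion_atTop (μ := P) hmono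
  rw [hU, measure_univ] at h2
  have h3 : Tendsto (fun n => P.real (A n)) atTop (𝓝 1) := by
    exact (ENNReal.tendsto_toReal ENNReal.one_ne_top).comp h2
  obtain ⟨n, hn⟩ := (h3.eventually (eventually_gt_nhds (sub_lt_self 1 hδ))).exists
  exact ⟨_, by have : (0 : ℝ) ≤ n := n.cast_nonneg; linarith, hn⟩

lemma accPoints_eq {u : ℕ → Vec m} {x : Vec m} (h : Tendsto u atTop (𝓝 x)) : accPoints u ⊆ {x} := by
  intro y hy
  have h2 : ClusterPt y (𝓝 x) := ClusterPt.mono hy h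
  exact eq_of_nhds_neBot h2

lemma measureReal_accPoints (hlim : ∀ᵐ ω ∂P, Tendsto (fun n => θ n ω) atTop (𝓝 (θs ω))) (ℓ : ℝ) :
    P.real {ω | F (θs ω) ≤ ℓ} ≤ P.real {ω | accPoints (fun n => θ n ω) ⊆ sublevel F ℓ} := by
  refine ENNReal.toReal_mono (measure_ne_top _ _) (measure_mono_ae ?_)
  filter_upwards [hlim] with ω hω hle
  refine (accPoints_eq hω).trans (singleton_subset_iff.2 hle)

/-- The rate in the local case. -/
theorem exists_rate_local (hθ : IsSGD P X ξ g γ θ) (h1 : HolderSmooth F L α)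
    (h2 : OracleBounds P X F g Cg κ c) (h3 : RobbinsMonro γ α)
    (h4 : Tendsto F (Bornology.cobounded (Vec m)) atTop)
    (h6 : RateRegularity γ α ρ γstar) (h7 : γ =Θ[atTop] fun n : ℕ => 1 / (n : ℝ) ^ s)
    (ha : Admissible α ρ s) (hγ : s = 1 → max (1 / 2) α < κ * γstar) (hθs : Measurable θs)
    (hlim : ∀ᵐ ω ∂P, Tendsto (fun n => θ n ω) atTop (𝓝 (θs ω))) {δ ℓ : ℝ}
    (hℓ : 1 - δ < P.real {ω | F (θs ω) ≤ ℓ}) (hβ : β ∈ Ioo (0 : ℝ) 1) (hζ : 0 < ζ)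
    (hL : LojasiewiczOn F (sublevel F ℓ) β ζ)
    (hζs : β ≤ 1 / 2 → s = 1 → ζ ^ (1 / β) * max α (1 / 2) < κ * γstar) {a : ℝ} (ha0 : 0 < a) :
    ∃ C > (0 : ℝ), ∀ σ ∈ Ico (sigmaLocal α ρ s β) 1, ∀ ε > (0 : ℝ), ∀ n : ℕ,
      n = proportional a (countLocal α ρ s β ε σ) →
      1 - δ ≤ P.real {ω | ‖θ n ω - θs ω‖ ≤ C / (1 - σ) * ε} := by
  obtain ⟨η, hη, hclock⟩ := exists_hasClock_local (F := F) ha h3.pos h7 h6 h2.κ_pos hγ hβ hζ hζs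
  obtain ⟨τ, q, hτ, hq, hatt, A, hA, hmono, hex, hb⟩ :=
    exists_capture hθ h1 h2 h3 h4 hη hβ.1 hclock hL
  obtain ⟨N, hN⟩ : ∃ N, 1 - δ < P.real (A N) := by
    have h8 : P {ω | F (θs ω) ≤ ℓ} ≤ P (⋃ n, A n) := by
      refine measure_mono_ae ?_
      filter_upwards [hlim, hex] with ω h9 h10 h11
      exact mem_iUnion.2 (h10 ⟨_, h11, (h1.continuous.tendsto _).comp h9⟩)
    have h9 : 1 - δ < P.real (⋃ n, A n) :=
      hℓ.trans_le (ENNReal.toReal_mono (measure_ne_top _ _) h8)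
    have h10 : Tendsto (fun n => P.real (A n)) atTop (𝓝 (P.real (⋃ n, A n))) :=
      (ENNReal.tendsto_toReal (measure_ne_top _ _)).comp (tendsto_measure_iUnion_atTop hmono)
    exact (h10.eventually (eventually_gt_nhds h9)).exists
  obtain ⟨N', M, hM, hNM⟩ := (hb N).2
  obtain ⟨M', hM', hbound⟩ := exists_lintegral_limit_le hθ h1 h2 h3 hτ hq hM hNM hlim
  obtain ⟨C₀, hC₀, hC⟩ := hatt a ha0
  -- The choice of `ℓ` and `N` leaves a strictly positive slack, and this is the probability that
  -- Markov's inequality may spend.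
  set D := P.real (A N) - (1 - δ) with hD
  have hD0 : 0 < D := sub_pos.2 hN
  refine ⟨(M' + 1) * C₀ / D, by positivity, fun σ hσ ε hε n hn => ?_⟩
  have hσ0 : 0 < 1 - σ := sub_pos.2 hσ.2
  -- Admissible `σ` are positive, so the factor `1 / (1 - σ)` only weakens the bound.
  have hσ1 : 1 - σ ≤ 1 := by linarith [hσ.1, ha.sigmaLocal_pos hβ.2]
  set R := (M' + 1) * C₀ / D / (1 - σ) * ε with hR
  have hR0 : 0 < R := by positivity
  have hτn : 0 < τ n ^ (-q) := Real.rpow_pos_of_pos (hτ.pos n) _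
  have h8 := measureReal_sub_le_of_lintegral_le ((measurable_iterate' hθ n).sub hθs)
    (mul_nonneg hM' hτn.le) hR0 (hbound n)
  have h9 : M' * τ n ^ (-q) / R ≤ D := by
    rw [div_le_iff₀ hR0]
    calc M' * τ n ^ (-q) ≤ (M' + 1) * (C₀ * ε) :=
          mul_le_mul (by linarith) (hn ▸ hC σ hσ ε hε) hτn.le (by linarith)
      _ = D * (((M' + 1) * C₀ / D) * ε) := by field_simp
      _ ≤ D * R := by
          rw [hR]
          refine mul_le_mul_of_nonneg_left (mul_le_mul_of_nonneg_right ?_ hε.le) hD0.le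
          exact le_div_self (by positivity) hσ0 hσ1
  exact le_trans (by linarith) h8

/-- The rate in the global case. -/
theorem exists_rate_global (hθ : IsSGD P X ξ g γ θ) (h1 : HolderSmooth F L α)
    (h2 : OracleBounds P X F g Cg κ c) (h3 : RobbinsMonro γ α)
    (h6 : RateRegularity γ α ρ γstar) (h7 : γ =Θ[atTop] fun n : ℕ => 1 / (n : ℝ) ^ s)
    (ha : Admissible α ρ s) (hθs : Measurable θs)
    (hlim : ∀ᵐ ω ∂P, Tendsto (fun n => θ n ω) atTop (𝓝 (θs ω)))
    (hβ : β ∈ Ioo (α / (1 + α)) 1 ∪ {1 / 2}) (hβ1 : β < 1) (hζ : 0 < ζ) (hL : LojasiewiczGap F β ζ)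
    (hζs : β ≤ 1 / 2 → s = 1 → globalThreshold L α β ζ < κ * γstar) {a : ℝ} (ha0 : 0 < a) :
    ∃ C > (0 : ℝ), ∀ δ ∈ Ioo (0 : ℝ) 1, ∀ σ ∈ Ico (sigmaGlobal α ρ s β) 1, ∀ ε > (0 : ℝ),
      ∀ n : ℕ, n = proportional a (countGlobal α ρ s β ε σ) →
      1 - δ ≤ P.real {ω | ‖θ n ω - θs ω‖ ≤ C / (δ * (1 - σ)) * ε} := by
  obtain ⟨τ, x, u, K, n₀, hR, hK, hD, hatt⟩ :=
    exists_hasClock_global h1 ha h3.pos h7 h6 h2.κ_pos hβ hζ hζs hL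
  obtain ⟨M, hM, hNM⟩ := hR.global_bound hθ h1 h2 h3 hK (hD univ _ ⟨rfl, rfl⟩)
  have hlt := hR.lt_x
  have hτ := hR.clock
  set q := (x + u - 1) / 2 with hq
  obtain ⟨M', hM', hbound⟩ := exists_lintegral_limit_le hθ h1 h2 h3 (A := univ) hτ
    (by linarith : 0 ≤ q) hM (by simpa only [Measure.restrict_univ] using hNM) hlim
  obtain ⟨C₀, hC₀, hC⟩ := hatt a ha0
  refine ⟨(M' + 1) * C₀, by positivity, fun δ hδ σ hσ ε hε n hn => ?_⟩
  have hδ0 := hδ.1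
  have hσ0 : 0 < 1 - σ := sub_pos.2 hσ.2
  have hσ1 : 1 - σ ≤ 1 := by linarith [hσ.1, ha.sigmaGlobal_pos hβ1]
  set R := (M' + 1) * C₀ / (δ * (1 - σ)) * ε with hR
  have hR0 : 0 < R := by positivity
  have hτn : 0 < τ n ^ (-q) := Real.rpow_pos_of_pos (hτ.pos n) _
  have h8 := measureReal_sub_le_of_lintegral_le ((measurable_iterate' hθ n).sub hθs)
    (mul_nonneg hM' hτn.le) hR0 (hbound n)
  rw [probReal_univ] at h8
  -- Markov's inequality on the whole space: dividing the radius by `δ` leaves an exceptional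
  -- probability of at most `δ`.
  have h9 : M' * τ n ^ (-q) / R ≤ δ := by
    rw [div_le_iff₀ hR0]
    calc M' * τ n ^ (-q) ≤ (M' + 1) * (C₀ * ε) :=
          mul_le_mul (by linarith) (hn ▸ hC σ hσ ε hε) hτn.le (by linarith)
      _ ≤ (M' + 1) * C₀ * ε / (1 - σ) := by
          rw [← mul_assoc]; exact le_div_self (by positivity) hσ0 hσ1
      _ = δ * R := by rw [hR]; field_simp
  exact le_trans (by linarith) h8

end Convergence

end SGD

/-! ### Assembly of the convergence, rate and cost statements -/

theorem mainTheorem9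
    {Ω : Type*} [MeasurableSpace Ω] (P : Measure Ω) [IsProbabilityMeasure P]
    {d m : ℕ} (hd : 1 ≤ d) (hm : 1 ≤ m)
    -- the stochastic optimization problem, the oracle and the SGD iterates
    (X : Ω → SGD.Vec d) (f : SGD.Vec d → SGD.Vec m → ℝ)
    (hf : ∀ θ, Integrable (fun ω => f (X ω) θ) P)
    (F : SGD.Vec m → ℝ) (hF : F = SGD.objective P X f)
    (g : SGD.Vec d → SGD.Vec m → SGD.Vec m) (ξ : ℕ → Ω → SGD.Vec d)
    (γ : ℕ → ℝ) (θ : ℕ → Ω → SGD.Vec m) (hθ : SGD.IsSGD P X ξ g γ θ)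
    -- standing assumptions
    (L α Cg κ c ρ γstar s : ℝ)
    (h1 : SGD.HolderSmooth F L α)
    (h2 : SGD.OracleBounds P X F g Cg κ c)
    (h3 : SGD.RobbinsMonro γ α)
    (h4 : Tendsto F (Bornology.cobounded (SGD.Vec m)) atTop)
    (h5 : SGD.IsLojasiewicz F)
    (h6 : SGD.RateRegularity γ α ρ γstar)
    (h7 : γ =Θ[atTop] fun n : ℕ => 1 / (n : ℝ) ^ s)
    (hs0 : 0 < s) (hs1 : s ≤ 1)
    (hρ : max 3 (2 / α) < ρ) (hs : ρ / (1 + ρ) ≤ s)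
    (hγ : s = 1 → max (1 / 2) α < κ * γstar)
    -- prices of the primitives of the algorithm
    (p : SGD.Prices) :
    -- the iterates converge to a random stationary point, and
    (∃ θstar : Ω → SGD.Vec m, Measurable θstar ∧
      (∀ᵐ ω ∂P, Tendsto (fun n => θ n ω) atTop (𝓝 (θstar ω)) ∧ θstar ω ∈ SGD.stationary F ∧
        Tendsto (fun n => F (θ n ω)) atTop (𝓝 (F (θstar ω)))) ∧
      -- (i) the local case
      (∀ δ ∈ Ioo (0 : ℝ) 1, ∃ ℓ > ⨅ η, F η,
        1 - δ ≤ P.real {ω | SGD.accPoints (fun n => θ n ω) ⊆ SGD.sublevel F ℓ} ∧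
        -- a. uniform exponent and constant on the sublevel set
        ((∃ β ∈ Ioo (0 : ℝ) 1, ∃ ζ > (0 : ℝ), SGD.LojasiewiczOn F (SGD.sublevel F ℓ) β ζ) ∧
          ∀ β ∈ Ioo (0 : ℝ) 1, ∀ ζ > (0 : ℝ), SGD.LojasiewiczOn F (SGD.sublevel F ℓ) β ζ →
            (β ≤ 1 / 2 → s = 1 → ζ ^ (1 / β) * max α (1 / 2) < κ * γstar) →
            ∀ a > (0 : ℝ), ∃ C > (0 : ℝ),
              ∀ σ ∈ Ico (SGD.sigmaLocal α ρ s β) 1, ∀ ε > (0 : ℝ), ∀ n : ℕ,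
                n = SGD.proportional a (SGD.countLocal α ρ s β ε σ) →
                1 - δ ≤ P.real {ω | ‖θ n ω - θstar ω‖ ≤ C / (1 - σ) * ε}) ∧
        -- b. uniform exponent with constant one on the sublevel set
        ((∃ β ∈ Ioo (0 : ℝ) 1, SGD.LojasiewiczOn F (SGD.sublevel F ℓ) β 1) ∧
          ∀ β ∈ Ioo (0 : ℝ) 1, SGD.LojasiewiczOn F (SGD.sublevel F ℓ) β 1 →
            ∀ a > (0 : ℝ), ∃ C > (0 : ℝ),
              ∀ σ ∈ Ico (SGD.sigmaLocal α ρ s β) 1, ∀ ε > (0 : ℝ), ∀ n : ℕ,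
                n = SGD.proportional a (SGD.countLocal α ρ s β ε σ) →
                1 - δ ≤ P.real {ω | ‖θ n ω - θstar ω‖ ≤ C / (1 - σ) * ε})) ∧
      -- (ii) the global case
      (SGD.IsGloballyLojasiewicz F →
        (∃ β ∈ Ico (α / (1 + α)) 1, ∃ ζ > (0 : ℝ), SGD.LojasiewiczGap F β ζ) ∧
        ∀ β ∈ Ioo (α / (1 + α)) 1 ∪ {1 / 2}, ∀ ζ > (0 : ℝ), SGD.LojasiewiczGap F β ζ →
          (β ≤ 1 / 2 → s = 1 → SGD.globalThreshold L α β ζ < κ * γstar) →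
          ∀ a > (0 : ℝ), ∃ C > (0 : ℝ), ∀ δ ∈ Ioo (0 : ℝ) 1,
            ∀ σ ∈ Ico (SGD.sigmaGlobal α ρ s β) 1, ∀ ε > (0 : ℝ), ∀ n : ℕ,
              n = SGD.proportional a (SGD.countGlobal α ρ s β ε σ) →
              1 - δ ≤ P.real {ω | ‖θ n ω - θstar ω‖ ≤ C / (δ * (1 - σ)) * ε})) ∧
    -- the cost of computing the `n`-th iterate is at most linear in `n`
    (∃ C > (0 : ℝ), ∀ n : ℕ, 1 ≤ n → ∀ ω,
      (SGD.timedRun p g γ (fun k => ξ k ω) (θ 0 ω) n).val = θ n ω ∧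
      ((SGD.timedRun p g γ (fun k => ξ k ω) (θ 0 ω) n).cost : ℝ) ≤ C * n) ∧
    -- the smallest admissible `σ` is available and yields the least cost
    (∀ ω, ∀ a > (0 : ℝ), ∀ ε ∈ Ioc (0 : ℝ) 1,
      (∀ β ∈ Ioo (0 : ℝ) 1,
        IsLeast ((fun σ => (SGD.timedRun p g γ (fun k => ξ k ω) (θ 0 ω)
            (SGD.proportional a (SGD.countLocal α ρ s β ε σ))).cost) ''
              Ico (SGD.sigmaLocal α ρ s β) 1)
          (SGD.timedRun p g γ (fun k => ξ k ω) (θ 0 ω)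
            (SGD.proportional a
              (SGD.countLocal α ρ s β ε (SGD.sigmaLocal α ρ s β)))).cost) ∧
      (∀ β ∈ Ioo (α / (1 + α)) 1 ∪ {1 / 2},
        IsLeast ((fun σ => (SGD.timedRun p g γ (fun k => ξ k ω) (θ 0 ω)
            (SGD.proportional a (SGD.countGlobal α ρ s β ε σ))).cost) ''
              Ico (SGD.sigmaGlobal α ρ s β) 1)
          (SGD.timedRun p g γ (fun k => ξ k ω) (θ 0 ω)
            (SGD.proportional a
              (SGD.countGlobal α ρ s β ε (SGD.sigmaGlobal α ρ s β)))).cost)) := by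
  have ha := SGD.Admissible.of_le h1.α_pos hs1 hρ hs
  have hval : ∀ n ω, (SGD.timedRun p g γ (fun k => ξ k ω) (θ 0 ω) n).val = θ n ω := fun n ω =>
    SGD.timedRun_val (fun k => ξ k ω) (fun k => θ k ω) (fun k => hθ.step k ω) n
  have hβ1 : ∀ β ∈ Ioo (α / (1 + α)) 1 ∪ {1 / 2}, β < 1 := by
    rintro β (h | rfl)
    · exact h.2
    · norm_num
  refine ⟨?_, ?_, fun ω a ha0 ε hε => ⟨fun β hβ => ?_, fun β hβ => ?_⟩⟩
  · obtain ⟨θs, hθs, hlim⟩ := SGD.exists_limit hθ h1 h2 h3 h4 h5 h6 h7 ha hγ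
    have hlim' : ∀ᵐ ω ∂P, Tendsto (fun n => θ n ω) atTop (𝓝 (θs ω)) := hlim.mono fun ω h => h.1
    refine ⟨θs, hθs, hlim, fun δ hδ => ?_, fun hG => ⟨SGD.exists_lojasiewiczGap hm h1 h4 hG,
      fun β hβ ζ hζ hL hζs a ha0 => SGD.exists_rate_global hθ h1 h2 h3 h6 h7 ha hθs hlim' hβ
        (hβ1 β hβ) hζ hL hζs ha0⟩⟩
    obtain ⟨ℓ, hℓ, hP⟩ := SGD.exists_sublevel (P := P) F θs hδ.1
    obtain ⟨β₀, hβ₀, ζ₀, hζ₀, hL₀⟩ := SGD.exists_lojasiewiczOn h1 h4 h5 ℓ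
    obtain ⟨β', hβ', hβ'1⟩ := exists_between hβ₀.2
    refine ⟨ℓ, hℓ, hP.le.trans (SGD.measureReal_accPoints hlim' ℓ), ⟨⟨β₀, hβ₀, ζ₀, hζ₀, hL₀⟩,
      fun β hβ ζ hζ hL hζs a ha0 => SGD.exists_rate_local hθ h1 h2 h3 h4 h6 h7 ha hγ hθs hlim'
        hP hβ hζ hL hζs ha0⟩, ⟨β', ⟨hβ₀.1.trans hβ', hβ'1⟩,
      SGD.LojasiewiczOn.normalize h1 hL₀ hβ₀.1.le hβ'⟩, fun β hβ hL a ha0 =>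
        SGD.exists_rate_local hθ h1 h2 h3 h4 h6 h7 ha hγ hθs hlim' hP hβ one_pos hL
          (fun _ h => ?_) ha0⟩
    -- For `ζ = 1` the threshold condition reduces to the standing assumption on `κ γstar`.
    rw [Real.one_rpow, one_mul, max_comm]
    exact hγ h
  · obtain ⟨C, hC, h⟩ := SGD.exists_timedRun_cost_le p m
    exact ⟨C, hC, fun n hn ω => ⟨hval n ω, h n hn g γ _ _⟩⟩
  · exact SGD.isLeast_cost (ha.sigmaLocal_lt_one hβ.2) ha0
      (fun σ hσ => ha.countLocal_mono hβ.2 hε hσ.1 hσ.2) _ _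
  · exact SGD.isLeast_cost (ha.sigmaGlobal_lt_one (hβ1 β hβ)) ha0
      (fun σ hσ => ha.countGlobal_mono (hβ1 β hβ) hε hσ.1 hσ.2) _ _
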